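/- Let $F$ be a finite extension of $\mathbf{Q}_p$, $\pi$ a uniformizer of its ring of integers $O_F$, $L$ the completion of the maximal unramified extension of $F$, $O_L$ its ring of integers, $\mathbf{F}$ the residue field of $O_L$, and $\sigma$ the relative Frobenius automorphism of $L/F$. Let $n\ge 1$, and let $(N,\langle\cdot,\cdot\rangle,\Phi)$ be a symplectic isocrystal of dimension $2n$: $(N,\langle\cdot,\cdot\rangle)$ is a symplectic $L$-vector space of dimension $2n$, and $\Phi:N\to N$ is a $\sigma$-linear bijection such that for some $c\in L^\times$ we have $\langle \Phi x,\Phi y\rangle=c\,\sigma(\langle x,y\rangle)$ for all $x,y\in N$. Let $0\le r\le 2n$. The isocrystal is called minuscule of weight $r$ if its slope vector $(\nu_1\ge\dots\ge\nu_{2n})\in\mathbf{Q}^{2n}$ satisfies $0\le\nu_{2n}\le\dots\le\nu_1\le 1$ and $\sum_i\nu_i=r$. For a non-empty symmetric ($-\bar I=\bar I$) subset $\bar I\subset\mathbf{Z}/2n\mathbf{Z}$ with inverse image $I\subset\mathbf{Z}$, a periodic lattice chain of type $\bar I$ in $N$ is a family of $O_L$-lattices $M_i\subset N$ $(i\in I)$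 such that $M_i\subset M_j$ with $\operatorname{length}(M_j/M_i)=j-i$ for $i<j$ in $I$, and $M_{i+2n}=\pi^{-1}M_i$ for $i\in I$. It is selfdual if there is $d\in\mathbf{Z}$ with $M_i^\perp=M_{-i+2nd}$ for all $i\in I$, where $M^\perp=\{x\in N:\langle x,M\rangle\subset O_L\}$. Let $X^G(\omega_r,\Phi)_{\bar I}$ be the set of selfdual periodic lattice chains of type $\bar I$ in $N$ such that for all $i\in I$ we have $\pi M_i\subset \Phi M_i\subset M_i$ and $\dim_{\mathbf{F}}M_i/\Phi M_i=r$ (equivalently, the relative position of $M_i$ and $\Phi M_i$ is $\omega_r=(1^r,0^{2n-r})$). Proposition 2.1. (i) For every non-empty symmetric subset $\bar I$ of $\mathbf{Z}/2n\mathbf{Z}$, the set $X^G(\omega_r,\Phi)_{\bar I}$ is non-empty if and only if $(N,\langle\cdot,\cdot\rangle,\Phi)$ is minuscule of weight $r$. (ii) For all non-empty symmetric subsets $\bar J\subset\bar I$ of $\mathbf{Z}/2n\mathbf{Z}$, the forgetful map $X^G(\omega_r,\Phi)_{\bar I}\to X^G(\omega_r,\Phi)_{\bar J}$ is surjective. 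-/

import Mathlib

open scoped Pointwise

/-- `OL` (the ring of integers of `L`) is the completed maximal unramified extension of the discrete
valuation ring `OF` (the ring of integers of a finite extension of `ℚ_p`): it is a complete discrete
valuation ring, unramified over `OF`, whose residue field is an algebraic closure of that of `OF`.
These conditions determine `OL` over `OF`, hence also `L = Frac OL`, up to isomorphism.
(Integrality over `OF` of the residue field of `OL` is the same as algebraicity over the residue
field of `OF`.) -/
structure IsCompletedMaxUnramified (OF OL : Type*) [CommRing OF] [IsDomain OF]
    [IsDiscreteValuationRing OF] [CommRing OL] [IsDomain OL] [IsDiscreteValuationRing OL]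
    [Algebra OF OL] : Prop where
  complete : IsAdicComplete (IsLocalRing.maximalIdeal OL) OL
  unramified : (IsLocalRing.maximalIdeal OF).map (algebraMap OF OL) = IsLocalRing.maximalIdeal OL
  residue_isAlgClosed : IsAlgClosed (IsLocalRing.ResidueField OL)
  residue_isIntegral : Algebra.IsIntegral OF (IsLocalRing.ResidueField OL)

/-- `σ` is the relative Frobenius automorphism of `L` over `F`: it preserves the ring of integers
`OL` and induces `x ↦ x ^ q` on its residue field, `q` being the cardinality of the residue field of
`F`. -/
def IsRelativeFrobenius (OF OL : Type*) {F L : Type*} [CommRing OF] [IsDomain OF]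
    [IsDiscreteValuationRing OF] [CommRing OL] [IsDomain OL] [IsDiscreteValuationRing OL]
    [Field F] [Field L] [Algebra F L] [Algebra OL L] (σ : L ≃ₐ[F] L) : Prop :=
  ∀ a : OL, ∃ b : OL, σ (algebraMap OL L a) = algebraMap OL L b ∧
    IsLocalRing.residue OL b =
      IsLocalRing.residue OL a ^ Nat.card (IsLocalRing.ResidueField OF)

section Isocrystal

variable {OL L N : Type*} [CommRing OL] [Field L] [Algebra OL L] [AddCommGroup N] [Module L N]
  [Module OL N] [IsScalarTower OL L N] {τ : L →+* L}

/-- The `OL`-submodule `Φ M` of `N`. (For a bijective `Φ` that is semilinear with respect to an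
automorphism of `L` preserving `OL`, the set `Φ '' M` is already a submodule.) -/
def frobeniusImage (Φ : N →ₛₗ[τ] N) (M : Submodule OL N) : Submodule OL N :=
  Submodule.span OL (Φ '' (M : Set N))

variable (OL) in
/-- `W` is a `Φ`-stable subspace that is isoclinic of slope `s`: there are an `OL`-lattice `M` of `W`
and an integer `t > 0` with `t s` an integer and `Φ ^ t M = ϖ ^ (t s) M`, where `ϖ` is a
uniformizer. -/
def IsIsoclinic (ϖ : L) (Φ : N →ₛₗ[τ] N) (W : Submodule L N) (s : ℚ) : Prop :=
  (∀ x ∈ W, Φ x ∈ W) ∧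
  ∃ M : Submodule OL N, M.FG ∧ Submodule.span L (M : Set N) = W ∧
    ∃ t : ℕ, 0 < t ∧ ∃ a : ℤ, (a : ℚ) = t * s ∧
      Φ^[t] '' (M : Set N) = ((ϖ ^ a • M : Submodule OL N) : Set N)

variable (OL) in
/-- `ν` is the slope vector of `(N, Φ)`: its entries are decreasing, and `N` is the direct sum of
`Φ`-stable subspaces `W s` (`s ∈ ℚ`), with `W s` isoclinic of slope `s` and of dimension the
multiplicity of `s` in `ν`. -/
def IsSlopeVector (ϖ : L) (Φ : N →ₛₗ[τ] N) {m : ℕ} (ν : Fin m → ℚ) : Prop :=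
  Antitone ν ∧ ∃ W : ℚ → Submodule L N, iSupIndep W ∧ (⨆ s, W s) = ⊤ ∧
    ∀ s, IsIsoclinic OL ϖ Φ (W s) s ∧
      Module.finrank L (W s) = (Finset.univ.filter fun i => ν i = s).card

variable (OL) in
/-- The isocrystal `(N, Φ)` is minuscule of weight `r`: its slopes lie between `0` and `1`, and their
sum is `r`. -/
def IsMinuscule (ϖ : L) (Φ : N →ₛₗ[τ] N) (r : ℕ) : Prop :=
  ∃ ν : Fin (Module.finrank L N) → ℚ, IsSlopeVector OL ϖ Φ ν ∧
    (∀ i, 0 ≤ ν i ∧ ν i ≤ 1) ∧ ∑ i, ν i = r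

/-- `(N, B, Φ)` is a symplectic isocrystal of dimension `2 n`. -/
structure IsSymplecticIsocrystal (n : ℕ) (Φ : N →ₛₗ[τ] N) (B : LinearMap.BilinForm L N) :
    Prop where
  finiteDimensional : FiniteDimensional L N
  finrank_eq : Module.finrank L N = 2 * n
  bijective : Function.Bijective Φ
  isAlt : B.IsAlt
  nondegenerate : B.Nondegenerate
  similitude : ∃ c : L, c ≠ 0 ∧ ∀ x y, B (Φ x) (Φ y) = c * τ (B x y)

/-- The inverse image in `ℤ` of a subset of `ℤ/mℤ`. -/
abbrev typeIndex {m : ℕ} (I : Set (ZMod m)) : Set ℤ := {i | (i : ZMod m) ∈ I}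

/-- The subset `I` of `ℤ/mℤ` is symmetric, i.e. invariant under multiplication by `-1`. -/
def IsSymmetricType {m : ℕ} (I : Set (ZMod m)) : Prop := ∀ a ∈ I, -a ∈ I

/-- The family `M` is a periodic lattice chain of type `I ⊆ ℤ/mℤ` in `N` (where `m = dim N`). -/
structure IsPeriodicLatticeChain (ϖ : L) {m : ℕ} (I : Set (ZMod m))
    (M : typeIndex I → Submodule OL N) : Prop where
  isLattice : ∀ i, (M i).IsLattice L
  le : ∀ i j, i < j → M i ≤ M j
  length_eq : ∀ i j, i < j →
    Module.length OL (M j ⧸ (M i).submoduleOf (M j)) = ((j - i : ℤ).toNat : ℕ∞)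
  periodic : ∀ i j : typeIndex I, (j : ℤ) = i + m → M j = ϖ⁻¹ • M i

/-- The chain `M` is selfdual: there is `d` with `(M i)^⊥ = M (-i + d m)` for all `i`. Here `M^⊥` is
the set of `x` such that `B x y` is in `OL` for all `y ∈ M`; the index `-i + d m` belongs to the
index set if `I` is symmetric. -/
def IsSelfdualChain (B : LinearMap.BilinForm L N) {m : ℕ} (I : Set (ZMod m))
    (M : typeIndex I → Submodule OL N) : Prop :=
  ∃ d : ℤ, ∀ i j : typeIndex I, (j : ℤ) = -i + d * m → B.dualSubmodule (M i) = M j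

/-- `ϖ M ⊆ Φ M ⊆ M` and `M / Φ M` has dimension `r` over the residue field. (As `M / Φ M` is killed by
`ϖ`, its dimension is its length as an `OL`-module.) Equivalently, the relative position of `M` and
`Φ M` is `(1^r, 0^(m - r))`. -/
def HasMinusculePosition (ϖ : L) (Φ : N →ₛₗ[τ] N) (r : ℕ) (M : Submodule OL N) : Prop :=
  ϖ • M ≤ frobeniusImage Φ M ∧ frobeniusImage Φ M ≤ M ∧
    Module.length OL (M ⧸ (frobeniusImage Φ M).submoduleOf M) = r

variable (OL) in
/-- The set of selfdual periodic lattice chains of type `I` in `N` all of whose members `M i` have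
relative position `(1^r, 0^(m - r))` to `Φ (M i)`. -/
def selfdualMinusculeChains (ϖ : L) (Φ : N →ₛₗ[τ] N) (B : LinearMap.BilinForm L N) (r : ℕ) {m : ℕ}
    (I : Set (ZMod m)) : Set (typeIndex I → Submodule OL N) :=
  {M | IsPeriodicLatticeChain ϖ I M ∧ IsSelfdualChain B I M ∧
    ∀ i, HasMinusculePosition ϖ Φ r (M i)}

variable (OL) in
/-- The forgetful map from chains of type `I` to chains of type `J ⊆ I`. -/
def forgetChain (ϖ : L) (Φ : N →ₛₗ[τ] N) (B : LinearMap.BilinForm L N) (r : ℕ) {m : ℕ}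
    {I J : Set (ZMod m)} (h : J ⊆ I) (M : selfdualMinusculeChains OL ϖ Φ B r I) :
    selfdualMinusculeChains OL ϖ Φ B r J :=
  ⟨fun j => M.1 ⟨j.1, h j.2⟩,
    ⟨fun _ => M.2.1.isLattice _, fun _ _ hij => M.2.1.le _ _ hij,
      fun _ _ hij => M.2.1.length_eq _ _ hij, fun _ _ hij => M.2.1.periodic _ _ hij⟩,
    M.2.2.1.imp fun _ hd _ _ hij => hd _ _ hij,
    fun _ => M.2.2.2 _⟩

end Isocrystal

/-!
Let `ϖ` be a uniformizer and write `Φ`, `ϖ` for the semilinear bijections of `N` given by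
Frobenius and by multiplication with `ϖ`; both live in the group `SemilinearGroup ϖ L N`, in which
`ϖ` is central and which acts on the `OL`-submodules of `N`. A lattice `M` is *stable* if
`ϖ M ⊆ Φ M ⊆ M`. The index `[M : Φ M]` (`latticeIndex`) is the same for all lattices `M`, so the
number `r` is not a condition on the individual members of a chain.

*Existence of stable lattices* (`isMinuscule_iff_exists_isStableLattice`). A stable lattice of
index `r` exists if and only if the isocrystal is minuscule of weight `r`. Both directions rest on
the slope decomposition (`exists_slope_decomposition`): in a cyclic isocrystal, the Newton polygon
of the relation `Φ ^ m x = ∑ b_j Φ ^ j x` has a smallest slope `a / t`, and the Fitting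
decomposition for `ϖ ^ (-a) Φ ^ t` (`exists_fitting`, where completeness of `OL` is used) splits
off the part of that slope. On an isoclinic part `Φ ^ t` acts on some lattice as `ϖ ^ (t s)`,
whence `[M : Φ M]` is the sum of the slopes. Stability of a lattice forces `0 ≤ s ≤ 1`; conversely
these inequalities say that powers of `Φ` and of `ϖ Φ⁻¹` preserve a lattice, and summing its
images gives a stable one.

*Refinement of chains* (`IsSelfdualFamily.exists_full`). Between stable lattices `X < Y` there is
a stable lattice of length one over `X` (`exists_stable_line`): on the socle part of `Y / X` the
operators `Φ` and `ϖ Φ⁻¹` are semilinear for the `q`-th power map and its inverse, and as the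
residue field is algebraically closed they have a common eigenline. As the form is alternating, a
line `X ⊂ X + OL x` inside the dual of `X` is again contained in its own dual. So a family of
stable lattices which is totally ordered and closed under duality and under multiplication with
powers of `ϖ` (`IsSelfdualFamily`) and which is maximal as such has members of all indices. From
such a full family one reads off chains of any type (`IsSelfdualFamily.exists_chain`), extending a
given one, which is the surjectivity of the forgetful map (`forgetChain_surjective`). For the
existence of chains one starts from a stable lattice that is maximal among those contained in
their duals. It is selfdual, since otherwise a stable line over it would enlarge it
(`exists_selfdual_stableLattice`), and its multiples by powers of `ϖ` form a selfdual family
(`selfdualMinusculeChains_nonempty`).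
-/

set_option linter.unusedSectionVars false

/-! ### Semilinear automorphisms and their action on submodules -/

section SemilinearGroup

variable {OL : Type*} [CommRing OL]

/-- The group of bijections of the `L`-vector space `N` that are semilinear with respect to some
automorphism of `L` which preserves `OL` and fixes the element `ϖ` of `OL`. It contains `Φ` as
well as multiplication by `ϖ`, and the latter is central. -/
def SemilinearGroup (ϖ : OL) (L N : Type*) [Field L] [Algebra OL L] [AddCommGroup N]
    [Module L N] : Subgroup (Equiv.Perm N) where
  carrier := {g | (∀ x y, g (x + y) = g x + g y) ∧
    ∃ τ : L ≃+* L, τ (algebraMap OL L ϖ) = algebraMap OL L ϖ ∧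
      (∀ x, τ x ∈ (1 : Submodule OL L) ↔ x ∈ (1 : Submodule OL L)) ∧
      ∀ (c : L) x, g (c • x) = τ c • g x}
  mul_mem' := by
    rintro g h ⟨hg, τ, h1, h2, h3⟩ ⟨hh, τ', h1', h2', h3'⟩
    refine ⟨fun x y => by simp [hg, hh], τ'.trans τ, by simp [h1, h1'], fun x => ?_,
      fun c x => by simp [h3, h3']⟩
    simp [h2, h2']
  one_mem' := ⟨by simp, RingEquiv.refl _, by simp, by simp, by simp⟩
  inv_mem' := by
    rintro g ⟨hg, τ, h1, h2, h3⟩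
    refine ⟨fun x y => ?_, τ.symm, ?_, fun x => ?_, fun c x => ?_⟩
    · rw [Equiv.Perm.inv_eq_iff_eq, hg]
      simp
    · rw [RingEquiv.symm_apply_eq, h1]
    · rw [← h2]
      simp
    · rw [Equiv.Perm.inv_eq_iff_eq, h3]
      simp

variable {L N : Type*} [Field L] [Algebra OL L] [AddCommGroup N] [Module L N] {ϖ : OL}

namespace SemilinearGroup

theorem smul_eq (g : SemilinearGroup ϖ L N) (x : N) : g • x = g.1 x := rfl

instance : DistribMulAction (SemilinearGroup ϖ L N) N where
  smul_zero g := by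
    have := g.2.1 0 0
    simp only [add_zero] at this
    rw [smul_eq]
    exact left_eq_add.mp this
  smul_add g := g.2.1

theorem exists_ringEquiv (g : SemilinearGroup ϖ L N) :
    ∃ τ : L ≃+* L, τ (algebraMap OL L ϖ) = algebraMap OL L ϖ ∧
      (∀ x, τ x ∈ (1 : Submodule OL L) ↔ x ∈ (1 : Submodule OL L)) ∧
      ∀ (c : L) (x : N), g • (c • x) = τ c • g • x :=
  g.2.2

theorem exists_integral_smul [Module OL N] [IsScalarTower OL L N] (g : SemilinearGroup ϖ L N)
    (a : OL) : ∃ b : OL, ∀ x : N, g • (a • x) = b • g • x := by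
  obtain ⟨τ, -, h2, h3⟩ := exists_ringEquiv g
  obtain ⟨b, hb⟩ := Submodule.mem_one.mp
    ((h2 (algebraMap OL L a)).mpr (Submodule.mem_one.mpr ⟨a, rfl⟩))
  refine ⟨b, fun x => ?_⟩
  rw [← algebraMap_smul L a x, h3, ← hb, algebraMap_smul]

variable [Module OL N] [IsScalarTower OL L N]

/-- The image of an `OL`-submodule under a semilinear bijection. -/
instance : SMul (SemilinearGroup ϖ L N) (Submodule OL N) where
  smul g M :=
    { carrier := {x | g⁻¹ • x ∈ M}
      add_mem' := fun {x y} hx hy => by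
        simp only [Set.mem_ofPred_eq, smul_add] at *
        exact add_mem hx hy
      zero_mem' := by simp
      smul_mem' := fun a x hx => by
        obtain ⟨b, hb⟩ := exists_integral_smul (g⁻¹) a
        simp only [Set.mem_ofPred_eq, hb] at *
        exact M.smul_mem _ hx }

theorem mem_smul {g : SemilinearGroup ϖ L N} {M : Submodule OL N} {x : N} :
    x ∈ g • M ↔ g⁻¹ • x ∈ M := Iff.rfl

theorem smul_mem_smul {g : SemilinearGroup ϖ L N} {M : Submodule OL N} {x : N} :
    g • x ∈ g • M ↔ x ∈ M := by rw [mem_smul, inv_smul_smul]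

instance : MulAction (SemilinearGroup ϖ L N) (Submodule OL N) where
  one_smul M := by ext; simp [mem_smul]
  mul_smul g h M := by ext; simp [mem_smul, mul_smul]

theorem smul_le_smul_iff {g : SemilinearGroup ϖ L N} {M M' : Submodule OL N} :
    g • M ≤ g • M' ↔ M ≤ M' := by
  refine ⟨fun h x hx => ?_, fun h x hx => h hx⟩
  rw [← smul_mem_smul (g := g)] at hx ⊢
  exact h hx

theorem smul_mono (g : SemilinearGroup ϖ L N) {M M' : Submodule OL N} (h : M ≤ M') :
    g • M ≤ g • M' := smul_le_smul_iff.mpr h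

theorem smul_le_iff {g : SemilinearGroup ϖ L N} {M M' : Submodule OL N} :
    g • M ≤ M' ↔ M ≤ g⁻¹ • M' := by
  rw [← smul_le_smul_iff (g := g) (M' := g⁻¹ • M'), smul_inv_smul]

theorem smul_le_iff_forall {g : SemilinearGroup ϖ L N} {M M' : Submodule OL N} :
    g • M ≤ M' ↔ ∀ x ∈ M, g • x ∈ M' := by
  rw [smul_le_iff]
  refine forall₂_congr fun x _ => ?_
  rw [mem_smul, inv_inv]

/-- A semilinear bijection acts on the lattice of submodules by an order automorphism. -/
def orderIso (g : SemilinearGroup ϖ L N) : Submodule OL N ≃o Submodule OL N where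
  toEquiv := MulAction.toPerm g
  map_rel_iff' := smul_le_smul_iff

theorem smul_sup (g : SemilinearGroup ϖ L N) (M M' : Submodule OL N) :
    g • (M ⊔ M') = g • M ⊔ g • M' := (orderIso g).map_sup M M'

theorem smul_inf (g : SemilinearGroup ϖ L N) (M M' : Submodule OL N) :
    g • (M ⊓ M') = g • M ⊓ g • M' := (orderIso g).map_inf M M'

theorem smul_iSup {ι : Sort*} (g : SemilinearGroup ϖ L N) (M : ι → Submodule OL N) :
    g • (⨆ i, M i) = ⨆ i, g • M i := (orderIso g).map_iSup M

theorem coe_smul (g : SemilinearGroup ϖ L N) (M : Submodule OL N) :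
    ((g • M : Submodule OL N) : Set N) = (g • ·) '' (M : Set N) := by
  ext x
  exact ⟨fun h => ⟨_, h, smul_inv_smul g x⟩, by rintro ⟨y, hy, rfl⟩; exact smul_mem_smul.mpr hy⟩

theorem smul_span (g : SemilinearGroup ϖ L N) (s : Set N) :
    g • Submodule.span OL s = Submodule.span OL ((g • ·) '' s) := by
  apply le_antisymm
  · rw [smul_le_iff, Submodule.span_le]
    intro x hx
    rw [SetLike.mem_coe, mem_smul, inv_inv]
    exact Submodule.subset_span ⟨x, hx, rfl⟩
  · rw [Submodule.span_le]
    rintro _ ⟨x, hx, rfl⟩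
    exact smul_mem_smul.mpr (Submodule.subset_span hx)

theorem smul_fg (g : SemilinearGroup ϖ L N) {M : Submodule OL N} (h : M.FG) : (g • M).FG := by
  obtain ⟨s, rfl⟩ := h
  rw [smul_span]
  exact Submodule.fg_span (s.finite_toSet.image _)

theorem smul_mem_span (g : SemilinearGroup ϖ L N) {s : Set N} {x : N}
    (hx : x ∈ Submodule.span L s) : g • x ∈ Submodule.span L ((g • ·) '' s) := by
  obtain ⟨τ, -, -, h⟩ := exists_ringEquiv g
  induction hx using Submodule.span_induction with
  | mem x hx => exact Submodule.subset_span ⟨x, hx, rfl⟩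
  | zero => simp
  | add x y _ _ hx hy => rw [smul_add]; exact add_mem hx hy
  | smul a x _ hx => rw [h]; exact Submodule.smul_mem _ _ hx

theorem smul_isLattice (g : SemilinearGroup ϖ L N) {M : Submodule OL N} (h : M.IsLattice L) :
    (g • M).IsLattice L := by
  refine ⟨smul_fg g h.fg, ?_⟩
  rw [eq_top_iff, coe_smul]
  intro x _
  rw [← smul_inv_smul g x]
  apply smul_mem_span
  rw [h.span_eq_top]
  trivial

end SemilinearGroup

end SemilinearGroup

section Uniformizer

variable {OL : Type*} [CommRing OL] [IsDomain OL] [IsDiscreteValuationRing OL]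
  {ϖ : OL} [hϖ : Fact (Irreducible ϖ)]
  {L N : Type*} [Field L] [Algebra OL L] [IsFractionRing OL L] [AddCommGroup N] [Module L N]

variable (L) in
theorem algebraMap_uniformizer_ne_zero : algebraMap OL L ϖ ≠ 0 := by
  simpa using hϖ.out.ne_zero

variable (ϖ L N) in
/-- Multiplication by the uniformizer `ϖ`. -/
def uniformizerMul : SemilinearGroup ϖ L N :=
  ⟨MulAction.toPerm (Units.mk0 _ (algebraMap_uniformizer_ne_zero (ϖ := ϖ) L)),
    fun x y => by simp [Units.smul_def], RingEquiv.refl _, rfl, fun _ => Iff.rfl,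
    fun c x => by simp [Units.smul_def, smul_comm c]⟩

open SemilinearGroup

theorem uniformizerMul_smul (x : N) :
    uniformizerMul ϖ L N • x = algebraMap OL L ϖ • x := rfl

theorem uniformizerMul_comm (g : SemilinearGroup ϖ L N) :
    Commute (uniformizerMul ϖ L N) g := by
  obtain ⟨τ, h1, -, h3⟩ := exists_ringEquiv g
  ext x
  have := h3 (algebraMap OL L ϖ) x
  rw [h1] at this
  exact this.symm

theorem zpow_uniformizerMul_smul (k : ℤ) (x : N) :
    uniformizerMul ϖ L N ^ k • x = algebraMap OL L ϖ ^ k • x := by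
  have h0 := algebraMap_uniformizer_ne_zero (ϖ := ϖ) L
  induction k using Int.induction_on generalizing x with
  | zero => simp
  | succ k ih => rw [zpow_add_one, mul_smul, ih, uniformizerMul_smul, smul_smul, zpow_add_one₀ h0]
  | pred k ih =>
    rw [zpow_sub_one, mul_smul, ih, zpow_sub_one₀ h0, mul_smul]
    congr 1

theorem smul_zpow_uniformizerMul_smul {α : Type*} [MulAction (SemilinearGroup ϖ L N) α]
    (g : SemilinearGroup ϖ L N) (k : ℤ) (x : α) :
    g • uniformizerMul ϖ L N ^ k • x = uniformizerMul ϖ L N ^ k • g • x := by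
  rw [smul_smul, smul_smul, ((uniformizerMul_comm g).zpow_left k).eq]

theorem smul_uniformizerMul_smul {α : Type*} [MulAction (SemilinearGroup ϖ L N) α]
    (g : SemilinearGroup ϖ L N) (x : α) :
    g • uniformizerMul ϖ L N • x = uniformizerMul ϖ L N • g • x := by
  simpa using smul_zpow_uniformizerMul_smul g 1 x

variable [Module OL N] [IsScalarTower OL L N]

theorem pow_uniformizerMul_smul (k : ℕ) (x : N) :
    uniformizerMul ϖ L N ^ k • x = ϖ ^ k • x := by
  rw [← zpow_natCast, zpow_uniformizerMul_smul, zpow_natCast, ← map_pow, algebraMap_smul]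

theorem zpow_uniformizerMul_smul_eq (k : ℤ) (M : Submodule OL N) :
    uniformizerMul ϖ L N ^ k • M = (algebraMap OL L ϖ ^ k • M : Submodule OL N) := by
  have h0 := algebraMap_uniformizer_ne_zero (ϖ := ϖ) L
  ext x
  rw [mem_smul, ← zpow_neg, zpow_uniformizerMul_smul, Submodule.mem_smul_pointwise_iff_exists]
  constructor
  · intro h
    refine ⟨_, h, ?_⟩
    rw [smul_smul, ← zpow_add₀ h0]
    simp
  · rintro ⟨y, hy, rfl⟩
    rwa [smul_smul, ← zpow_add₀ h0, neg_add_cancel, zpow_zero, one_smul]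

theorem mem_zpow_uniformizerMul_smul {k : ℤ} {M : Submodule OL N} {x : N} :
    x ∈ uniformizerMul ϖ L N ^ k • M ↔ algebraMap OL L ϖ ^ (-k) • x ∈ M := by
  rw [mem_smul, ← zpow_neg, zpow_uniformizerMul_smul]

theorem mem_pow_uniformizerMul_smul {k : ℕ} {M : Submodule OL N} {x : N} :
    x ∈ uniformizerMul ϖ L N ^ k • M ↔ ∃ y ∈ M, x = ϖ ^ k • y := by
  constructor
  · intro h
    exact ⟨_, h, by rw [← pow_uniformizerMul_smul (L := L), smul_inv_smul]⟩
  · rintro ⟨y, hy, rfl⟩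
    rw [← pow_uniformizerMul_smul (L := L)]
    exact smul_mem_smul.mpr hy

theorem uniformizerMul_smul_eq_smul (x : N) : uniformizerMul ϖ L N • x = ϖ • x := by
  simpa using pow_uniformizerMul_smul (L := L) (ϖ := ϖ) 1 x

theorem pow_uniformizerMul_smul_le (k : ℕ) (M : Submodule OL N) :
    uniformizerMul ϖ L N ^ k • M ≤ M := by
  intro x hx
  obtain ⟨y, hy, rfl⟩ := mem_pow_uniformizerMul_smul.mp hx
  exact M.smul_mem _ hy

theorem zpow_uniformizerMul_smul_anti {k l : ℤ} (h : k ≤ l) (M : Submodule OL N) :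
    uniformizerMul ϖ L N ^ l • M ≤ uniformizerMul ϖ L N ^ k • M := by
  obtain ⟨n, rfl⟩ := Int.le.dest h
  rw [zpow_add, mul_smul, zpow_natCast]
  exact smul_mono _ (pow_uniformizerMul_smul_le _ _)

theorem uniformizerMul_smul_le (M : Submodule OL N) : uniformizerMul ϖ L N • M ≤ M := by
  simpa using pow_uniformizerMul_smul_le (ϖ := ϖ) (L := L) 1 M

theorem exists_eq_zpow_mul {c : L} (hc : c ≠ 0) :
    ∃ (k : ℤ) (u : OLˣ), c = algebraMap OL L ϖ ^ k * algebraMap OL L u := by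
  have h0 := algebraMap_uniformizer_ne_zero (ϖ := ϖ) L
  obtain ⟨a, b, hb, rfl⟩ := IsFractionRing.div_surjective (A := OL) c
  have hb0 : b ≠ 0 := nonZeroDivisors.ne_zero hb
  have ha0 : a ≠ 0 := by rintro rfl; simp at hc
  obtain ⟨m, u, rfl⟩ := IsDiscreteValuationRing.eq_unit_mul_pow_irreducible ha0 hϖ.out
  obtain ⟨n, v, rfl⟩ := IsDiscreteValuationRing.eq_unit_mul_pow_irreducible hb0 hϖ.out
  refine ⟨m - n, u * v⁻¹, ?_⟩
  have hv : algebraMap OL L v ≠ 0 := by simp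
  have hvv : algebraMap OL L ((v⁻¹ : OLˣ) : OL) = (algebraMap OL L v)⁻¹ := by
    refine eq_inv_of_mul_eq_one_left ?_
    rw [← map_mul]
    simp
  rw [zpow_sub₀ h0, Units.val_mul]
  simp only [map_mul, map_pow, zpow_natCast, hvv]
  field_simp

theorem exists_pow_smul_mem_of_mem_span {M : Submodule OL N} {x : N}
    (hx : x ∈ Submodule.span L (M : Set N)) : ∃ k : ℕ, uniformizerMul ϖ L N ^ k • x ∈ M := by
  simp_rw [pow_uniformizerMul_smul]
  have hmono : ∀ {k l : ℕ} {y : N}, k ≤ l → ϖ ^ k • y ∈ M → ϖ ^ l • y ∈ M := by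
    intro k l y hkl hy
    obtain ⟨m, rfl⟩ := Nat.le.dest hkl
    rw [pow_add, mul_comm, mul_smul]
    exact M.smul_mem _ hy
  induction hx using Submodule.span_induction with
  | mem x hx => exact ⟨0, by simpa using hx⟩
  | zero => exact ⟨0, by simp⟩
  | add x y _ _ hx hy =>
    obtain ⟨k, hk⟩ := hx
    obtain ⟨l, hl⟩ := hy
    refine ⟨max k l, ?_⟩
    rw [smul_add]
    exact add_mem (hmono (le_max_left _ _) hk) (hmono (le_max_right _ _) hl)
  | smul c x _ hx =>
    obtain ⟨k, hk⟩ := hx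
    rcases eq_or_ne c 0 with rfl | hc
    · exact ⟨0, by simp⟩
    obtain ⟨m, u, rfl⟩ := exists_eq_zpow_mul (ϖ := ϖ) hc
    refine ⟨k + m.natAbs, ?_⟩
    have hm : ∃ j : ℕ, (m.natAbs : ℤ) + m = j := ⟨(m.natAbs + m).toNat, by omega⟩
    obtain ⟨j, hj⟩ := hm
    have h0 := algebraMap_uniformizer_ne_zero (ϖ := ϖ) L
    have : ϖ ^ (k + m.natAbs) • (algebraMap OL L ϖ ^ m * algebraMap OL L ↑u) • x =
        ((u : OL) * ϖ ^ j) • ϖ ^ k • x := by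
      rw [← algebraMap_smul L (ϖ ^ (k + m.natAbs)), ← algebraMap_smul L (ϖ ^ k),
        ← algebraMap_smul L (↑u * ϖ ^ j), smul_smul, smul_smul, map_mul, map_pow, map_pow, map_pow]
      congr 1
      rw [← zpow_natCast _ j, ← hj, zpow_add₀ h0, zpow_natCast]
      ring
    rw [this]
    exact M.smul_mem _ hk

/-- A finitely generated submodule of the span of `M` becomes a submodule of `M` when multiplied
by a high power of `ϖ`. -/
theorem exists_pow_smul_le {K M : Submodule OL N} (hK : K.FG)
    (h : (K : Set N) ⊆ Submodule.span L (M : Set N)) :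
    ∃ k : ℕ, uniformizerMul ϖ L N ^ k • K ≤ M := by
  obtain ⟨s, rfl⟩ := hK
  classical
  induction s using Finset.induction_on with
  | empty => exact ⟨0, by simp⟩
  | insert x s _ ih =>
    rw [Finset.coe_insert, Submodule.span_insert] at h ⊢
    obtain ⟨k, hk⟩ := ih
      (subset_trans (by exact (le_sup_right : _ ≤ (Submodule.span OL {x} ⊔ _))) h)
    obtain ⟨l, hl⟩ := exists_pow_smul_mem_of_mem_span (ϖ := ϖ)
      (h (le_sup_left (b := Submodule.span OL (s : Set N)) (Submodule.mem_span_singleton_self x)))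
    refine ⟨k + l, ?_⟩
    rw [smul_sup, sup_le_iff]
    constructor
    · rw [smul_span, Set.image_singleton, Submodule.span_singleton_le_iff_mem, pow_add, mul_smul]
      apply pow_uniformizerMul_smul_le (ϖ := ϖ) (L := L) k
      exact smul_mem_smul.mpr hl
    · rw [add_comm, pow_add, mul_smul]
      exact le_trans (pow_uniformizerMul_smul_le _ _) hk

theorem exists_pow_smul_le_of_isLattice {K M : Submodule OL N} (hK : K.FG) (hM : M.IsLattice L) :
    ∃ k : ℕ, uniformizerMul ϖ L N ^ k • K ≤ M :=
  exists_pow_smul_le hK (by rw [hM.span_eq_top]; exact Set.subset_univ _)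

/-- Krull's intersection theorem for a finitely generated submodule. -/
theorem eq_zero_of_forall_mem_pow_smul {M : Submodule OL N} (hM : M.FG) {x : N}
    (hx : ∀ k : ℕ, x ∈ uniformizerMul ϖ L N ^ k • M) : x = 0 := by
  have hxM : x ∈ M := by simpa using hx 0
  have : Module.Finite OL M := Module.Finite.iff_fg.mpr hM
  have key := Ideal.iInf_pow_smul_eq_bot_of_isLocalRing (M := M) (IsLocalRing.maximalIdeal OL)
    (Ideal.IsPrime.ne_top inferInstance)
  have : (⟨x, hxM⟩ : M) ∈ ⨅ i : ℕ, IsLocalRing.maximalIdeal OL ^ i • (⊤ : Submodule OL M) := by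
    rw [Submodule.mem_iInf]
    intro i
    obtain ⟨y, hy, hxy⟩ := mem_pow_uniformizerMul_smul.mp (hx i)
    have : (⟨x, hxM⟩ : M) = ϖ ^ i • ⟨y, hy⟩ := Subtype.ext hxy
    rw [this]
    refine Submodule.smul_mem_smul (Ideal.pow_mem_pow ?_ _) trivial
    exact (IsLocalRing.mem_maximalIdeal _).mpr hϖ.out.not_isUnit
  rw [key, Submodule.mem_bot] at this
  exact congrArg Subtype.val this

end Uniformizer

/-! ### Relative lengths and the index of two lattices -/

section RelativeLength

variable {R N : Type*} [CommRing R] [AddCommGroup N] [Module R N]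

/-- The length of `A / (A ⊓ B)`. -/
noncomputable def relLength (A B : Submodule R N) : ℕ∞ :=
  Module.length R (A ⧸ B.submoduleOf A)

/-- The submodules of `A / B` are the submodules of `N` between `B` and `A`. -/
def quotientSubmoduleOrderIso {A B : Submodule R N} (h : B ≤ A) :
    Submodule R (A ⧸ B.submoduleOf A) ≃o Set.Icc B A :=
  (Submodule.comapMkQRelIso _).trans
    { toFun := fun C => ⟨C.1.map A.subtype, by
        have := Submodule.map_mono (f := A.subtype) C.2
        exact (inf_eq_right.mpr h).ge.trans ((Submodule.map_comap_subtype A B).ge.trans this),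
        Submodule.map_subtype_le _ _⟩
      invFun := fun C => ⟨C.1.submoduleOf A, Submodule.comap_mono C.2.1⟩
      left_inv := fun C => by
        ext1
        exact Submodule.comap_map_eq_of_injective A.injective_subtype _
      right_inv := fun C => by
        ext1
        simp only [Submodule.submoduleOf, Submodule.map_comap_subtype]
        exact inf_eq_right.mpr C.2.2
      map_rel_iff' := fun {C D} => by
        exact Submodule.map_le_map_iff_of_injective A.injective_subtype _ _ }

theorem coe_relLength {A B : Submodule R N} (h : B ≤ A) :
    (relLength A B : WithBot ℕ∞) = Order.krullDim (Set.Icc B A) := by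
  rw [relLength, Module.coe_length, Order.krullDim_eq_of_orderIso (quotientSubmoduleOrderIso h)]

theorem relLength_add {A B C : Submodule R N} (hCB : C ≤ B) (hBA : B ≤ A) :
    relLength A C = relLength B C + relLength A B := by
  have hle : C.submoduleOf A ≤ B.submoduleOf A := Submodule.comap_mono hCB
  refine Module.length_eq_add_of_exact
    (Submodule.mapQ (C.submoduleOf B) (C.submoduleOf A) (Submodule.inclusion hBA) (fun x hx => hx))
    (Submodule.factor hle) ?_ (Submodule.factor_surjective hle) ?_
  · rw [injective_iff_map_eq_zero]
    intro x hx
    obtain ⟨x, rfl⟩ := Submodule.Quotient.mk_surjective _ x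
    have hx' : Submodule.inclusion hBA x ∈ C.submoduleOf A :=
      (Submodule.Quotient.mk_eq_zero _).mp hx
    exact (Submodule.Quotient.mk_eq_zero _).mpr hx'
  · rw [LinearMap.exact_iff]
    ext x
    obtain ⟨x, rfl⟩ := Submodule.Quotient.mk_surjective _ x
    constructor
    · intro hx
      have hx' : x ∈ B.submoduleOf A := (Submodule.Quotient.mk_eq_zero _).mp hx
      exact ⟨Submodule.Quotient.mk ⟨x.1, hx'⟩, rfl⟩
    · rintro ⟨y, hy⟩
      obtain ⟨y, rfl⟩ := Submodule.Quotient.mk_surjective _ y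
      rw [← hy]
      exact (Submodule.Quotient.mk_eq_zero _).mpr y.2

theorem relLength_self (A : Submodule R N) : relLength A A = 0 := by
  rw [relLength, Module.length_eq_zero_iff, Submodule.Quotient.subsingleton_iff,
    Submodule.submoduleOf_self]

theorem le_of_relLength_eq_zero {A B : Submodule R N} (h : relLength A B = 0) : A ≤ B := by
  rwa [relLength, Module.length_eq_zero_iff, Submodule.Quotient.subsingleton_iff,
    Submodule.submoduleOf_eq_top] at h

end RelativeLength

section Diagonal

variable {OL : Type*} [CommRing OL] [IsDomain OL] [IsDiscreteValuationRing OL]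
  {ϖ : OL} [hϖ : Fact (Irreducible ϖ)] {N : Type*} [AddCommGroup N] [Module OL N]

/-- The length of `OL ^ ι` modulo the submodule with elementary divisors `ϖ ^ a i`. -/
theorem relLength_span_pow_smul {ι : Type*} [Fintype ι] {e : ι → N} (he : LinearIndependent OL e)
    (a : ι → ℕ) :
    relLength (Submodule.span OL (Set.range e))
        (Submodule.span OL (Set.range fun i => ϖ ^ a i • e i)) = ((∑ i, a i : ℕ) : ℕ∞) := by
  classical
  have key : (Submodule.span OL (Set.range fun i => ϖ ^ a i • e i)).submoduleOf
      (Submodule.span OL (Set.range e)) =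
      (Submodule.pi Set.univ (fun i => Ideal.span {ϖ ^ a i})).map
        ((Module.Basis.span he).equivFun.symm : (ι → OL) →ₗ[OL] _) := by
    ext x
    have hx : x.1 = ∑ i, (Module.Basis.span he).equivFun x i • e i := by
      conv_lhs => rw [← (Module.Basis.span he).sum_equivFun x]
      simp [Module.Basis.span_apply]
    rw [Submodule.mem_map_equiv, LinearEquiv.symm_symm,
      Submodule.mem_pi, Submodule.submoduleOf, Submodule.mem_comap, Submodule.subtype_apply,
      Submodule.mem_span_range_iff_exists_fun]
    constructor
    · rintro ⟨c, hc⟩ i -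
      rw [hx] at hc
      simp only [smul_smul] at hc
      rw [Fintype.linearIndependent_iffₛ.mp he _ _ hc.symm i]
      exact Ideal.mem_span_singleton'.mpr ⟨_, rfl⟩
    · intro h
      choose c hc using fun i => Ideal.mem_span_singleton'.mp (h i trivial)
      refine ⟨c, ?_⟩
      rw [hx]
      simp_rw [← hc, smul_smul]
  rw [relLength, (Submodule.Quotient.equiv _ _ _ key.symm).symm.length_eq,
    (Submodule.quotientPi _).length_eq, Module.length_pi_of_fintype]
  push_cast
  refine Finset.sum_congr rfl fun i _ => ?_
  rw [← Ideal.span_singleton_pow, ← hϖ.out.maximalIdeal_eq,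
    IsDiscreteValuationRing.length_quotient_pow_maximalIdeal]

end Diagonal

section Index

variable {OL : Type*} [CommRing OL] [IsDomain OL] [IsDiscreteValuationRing OL]
  {ϖ : OL} [hϖ : Fact (Irreducible ϖ)]
  {L N : Type*} [Field L] [Algebra OL L] [IsFractionRing OL L] [AddCommGroup N] [Module L N]
  [Module OL N] [IsScalarTower OL L N]

open SemilinearGroup

/-- The index `[A : B]` of two lattices, i.e. `length (A / B)` if `B ≤ A`. Both lengths are finite
for lattices, so nothing is lost in `toNat`. -/
noncomputable def latticeIndex (A B : Submodule OL N) : ℤ :=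
  (relLength A (A ⊓ B)).toNat - (relLength B (A ⊓ B)).toNat

variable (OL N) in
/-- A lattice has a basis of `N` as an `OL`-basis. -/
theorem exists_basis_of_isLattice [FiniteDimensional L N] {M : Submodule OL N}
    (hM : M.IsLattice L) :
    ∃ b : Module.Basis (Fin (Module.finrank L N)) L N, M = Submodule.span OL (Set.range b) := by
  have : Module.IsTorsionFree OL L := inferInstance
  have : Module.Free OL M := Submodule.IsLattice.free (K := L) M
  have : Module.Finite OL M := Submodule.IsLattice.finite L M
  let b' := Module.Free.chooseBasis OL M
  let b := b'.extendOfIsLattice L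
  have hb : ∀ i, b i = b' i := fun i => by simp [b]
  have e := Fintype.equivFinOfCardEq (Module.finrank_eq_card_basis b).symm
  refine ⟨b.reindex e, ?_⟩
  rw [Module.Basis.range_reindex]
  have : Set.range b = M.subtype '' Set.range b' := by
    rw [← Set.range_comp]
    exact congrArg Set.range (funext hb)
  rw [this, ← Submodule.map_span, b'.span_eq, Submodule.map_top, Submodule.range_subtype]

theorem isLattice_span_basis {ι : Type*} [Finite ι] (b : Module.Basis ι L N) :
    (Submodule.span OL (Set.range b)).IsLattice L :=
  ⟨Submodule.fg_span (Set.finite_range b), by rw [Submodule.span_span_of_tower, b.span_eq]⟩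

variable [FiniteDimensional L N]

theorem relLength_pow_uniformizerMul_smul {M : Submodule OL N} (hM : M.IsLattice L) (k : ℕ) :
    relLength M (uniformizerMul ϖ L N ^ k • M) = ((Module.finrank L N * k : ℕ) : ℕ∞) := by
  obtain ⟨b, rfl⟩ := exists_basis_of_isLattice OL N hM
  have hb := b.linearIndependent.restrict_scalars (R := OL) (by
    intro x y hxy
    simpa [Algebra.smul_def] using hxy)
  have := relLength_span_pow_smul (ϖ := ϖ) hb fun _ => k
  have hcomp : (uniformizerMul ϖ L N ^ k • ·) ∘ b = fun i => ϖ ^ k • b i :=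
    funext fun i => pow_uniformizerMul_smul k (b i)
  rw [smul_span, ← Set.range_comp, hcomp, this]
  simp

theorem relLength_ne_top {A B : Submodule OL N} (hA : A.IsLattice L) (hB : B.IsLattice L)
    (h : B ≤ A) : relLength A B ≠ ⊤ := by
  obtain ⟨ϖ, hϖ⟩ := IsDiscreteValuationRing.exists_irreducible OL
  have : Fact (Irreducible ϖ) := ⟨hϖ⟩
  obtain ⟨k, hk⟩ := exists_pow_smul_le_of_isLattice (ϖ := ϖ) hA.fg hB
  intro htop
  have := relLength_pow_uniformizerMul_smul (ϖ := ϖ) hA k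
  rw [relLength_add hk h, htop, add_top] at this
  exact ENat.top_ne_natCast _ this

theorem isLattice_inf {A B : Submodule OL N} (hA : A.IsLattice L) (hB : B.IsLattice L) :
    (A ⊓ B).IsLattice L := Submodule.IsLattice.inf L A B

theorem isLattice_of_le_of_le {A B C : Submodule OL N} (hA : A.IsLattice L) (hC : C.IsLattice L)
    (hAB : A ≤ B) (hBC : B ≤ C) : B.IsLattice L := by
  have : Module.Finite OL C := Module.Finite.iff_fg.mpr hC.fg
  have : IsNoetherian OL B := isNoetherian_of_le hBC
  exact Submodule.IsLattice.of_le_of_isLattice_of_fg L hAB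
    (Module.Finite.iff_fg.mp inferInstance)

theorem latticeIndex_eq {A B C : Submodule OL N} (hA : A.IsLattice L) (hB : B.IsLattice L)
    (hC : C.IsLattice L) (hCA : C ≤ A) (hCB : C ≤ B) :
    latticeIndex A B = (relLength A C).toNat - (relLength B C).toNat := by
  have hI := isLattice_inf hA hB
  have h := le_inf hCA hCB
  rw [latticeIndex, relLength_add h inf_le_left, relLength_add h inf_le_right,
    ENat.toNat_add (relLength_ne_top hI hC h) (relLength_ne_top hA hI inf_le_left),
    ENat.toNat_add (relLength_ne_top hI hC h) (relLength_ne_top hB hI inf_le_right)]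
  push_cast
  ring

theorem latticeIndex_add {A B C : Submodule OL N} (hA : A.IsLattice L) (hB : B.IsLattice L)
    (hC : C.IsLattice L) : latticeIndex A B + latticeIndex B C = latticeIndex A C := by
  have hD := isLattice_inf (isLattice_inf hA hB) hC
  have h1 : A ⊓ B ⊓ C ≤ A := inf_le_left.trans inf_le_left
  have h2 : A ⊓ B ⊓ C ≤ B := inf_le_left.trans inf_le_right
  have h3 : A ⊓ B ⊓ C ≤ C := inf_le_right
  rw [latticeIndex_eq hA hB hD h1 h2, latticeIndex_eq hB hC hD h2 h3,
    latticeIndex_eq hA hC hD h1 h3]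
  ring

theorem latticeIndex_self (A : Submodule OL N) : latticeIndex A A = 0 := sub_self _

theorem latticeIndex_symm (A B : Submodule OL N) : latticeIndex A B = -latticeIndex B A := by
  rw [latticeIndex, latticeIndex, inf_comm B A]
  ring

theorem latticeIndex_of_le {A B : Submodule OL N} (h : B ≤ A) :
    latticeIndex A B = (relLength A B).toNat := by
  rw [latticeIndex, inf_eq_right.mpr h, relLength_self]
  simp

theorem relLength_eq_latticeIndex {A B : Submodule OL N} (hA : A.IsLattice L)
    (hB : B.IsLattice L) (h : B ≤ A) : relLength A B = ((latticeIndex A B).toNat : ℕ∞) := by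
  rw [latticeIndex_of_le h, Int.toNat_natCast, ENat.natCast_toNat (relLength_ne_top hA hB h)]

theorem latticeIndex_nonneg {A B : Submodule OL N} (h : B ≤ A) : 0 ≤ latticeIndex A B := by
  rw [latticeIndex_of_le h]
  positivity

theorem eq_of_latticeIndex_eq_zero {A B : Submodule OL N} (hA : A.IsLattice L)
    (hB : B.IsLattice L) (h : B ≤ A) (h0 : latticeIndex A B = 0) : A = B := by
  refine le_antisymm (le_of_relLength_eq_zero ?_) h
  rw [relLength_eq_latticeIndex hA hB h, h0]
  simp

theorem latticeIndex_uniformizerMul {M : Submodule OL N} (hM : M.IsLattice L) :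
    latticeIndex M (uniformizerMul ϖ L N • M) = Module.finrank L N := by
  have := relLength_pow_uniformizerMul_smul (ϖ := ϖ) hM 1
  rw [pow_one] at this
  rw [latticeIndex_of_le (uniformizerMul_smul_le M), this]
  simp

theorem relLength_smul (g : SemilinearGroup ϖ L N) {A B : Submodule OL N} (h : B ≤ A) :
    relLength (g • A) (g • B) = relLength A B := by
  have e : Set.Icc B A ≃o Set.Icc (g • B) (g • A) :=
    { toFun := fun C => ⟨g • C.1, smul_mono g C.2.1, smul_mono g C.2.2⟩
      invFun := fun C => ⟨g⁻¹ • C.1, by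
        rw [← smul_le_iff]; exact C.2.1, by rw [smul_le_iff, inv_inv]; exact C.2.2⟩
      left_inv := fun C => by simp
      right_inv := fun C => by simp
      map_rel_iff' := fun {C D} => smul_le_smul_iff }
  have := coe_relLength (smul_mono g h)
  rw [← Order.krullDim_eq_of_orderIso e, ← coe_relLength h] at this
  exact_mod_cast this

theorem latticeIndex_smul (g : SemilinearGroup ϖ L N) (A B : Submodule OL N) :
    latticeIndex (g • A) (g • B) = latticeIndex A B := by
  rw [latticeIndex, latticeIndex, ← smul_inf, relLength_smul g inf_le_left,
    relLength_smul g inf_le_right]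

/-- The index of `g • M` in `M` does not depend on the lattice `M`. -/
theorem latticeIndex_smul_eq (g : SemilinearGroup ϖ L N) {A B : Submodule OL N}
    (hA : A.IsLattice L) (hB : B.IsLattice L) :
    latticeIndex A (g • A) = latticeIndex B (g • B) := by
  have h1 := latticeIndex_add hA hB (smul_isLattice g hB)
  have h2 := latticeIndex_add hA (smul_isLattice g hA) (smul_isLattice g hB)
  rw [latticeIndex_smul] at h2
  linarith

theorem latticeIndex_pow_smul (g : SemilinearGroup ϖ L N) {A : Submodule OL N}
    (hA : A.IsLattice L) (k : ℕ) : latticeIndex A (g ^ k • A) = k * latticeIndex A (g • A) := by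
  induction k with
  | zero => simp [latticeIndex_self]
  | succ k ih =>
    rw [← latticeIndex_add hA (smul_isLattice (g ^ k) hA) (smul_isLattice _ hA), ih, pow_succ,
      mul_smul, latticeIndex_smul]
    push_cast
    ring

theorem latticeIndex_zpow_uniformizerMul {M : Submodule OL N} (hM : M.IsLattice L) (k : ℤ) :
    latticeIndex M (uniformizerMul ϖ L N ^ k • M) = k * Module.finrank L N := by
  obtain ⟨m, rfl | rfl⟩ := k.eq_nat_or_neg
  · rw [zpow_natCast, latticeIndex_pow_smul _ hM, latticeIndex_uniformizerMul hM]
  · rw [latticeIndex_symm, ← latticeIndex_smul (uniformizerMul ϖ L N ^ m)]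
    rw [zpow_neg, zpow_natCast, smul_inv_smul, latticeIndex_pow_smul _ hM,
      latticeIndex_uniformizerMul hM]
    ring

end Index

/-! ### Eigenvectors of Frobenius-semilinear maps -/

section Equations

open Polynomial

variable {k : Type*} [Field k] [IsAlgClosed k]

/-- The equations for the coordinates `y` of a fixed vector of an operator that is semilinear for
`x ↦ x ^ q`, in a cyclic basis in which its last column is `β`. Eliminating all coordinates but the
last one leaves a polynomial equation for the latter. -/
theorem exists_ne_zero_of_frobenius_recursion {q : ℕ} (hq : 2 ≤ q) (m : ℕ) (β : ℕ → k)
    (hβ : β 0 ≠ 0) :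
    ∃ y : ℕ → k, y m ≠ 0 ∧ y 0 = y m ^ q * β 0 ∧
      ∀ j < m, y (j + 1) = y j ^ q + y m ^ q * β (j + 1) := by
  let P : ℕ → k[X] := fun j =>
    Nat.rec (C (β 0) * X ^ q) (fun j p => p ^ q + C (β (j + 1)) * X ^ q) j
  have hP0 : P 0 = C (β 0) * X ^ q := rfl
  have hPs : ∀ j, P (j + 1) = P j ^ q + C (β (j + 1)) * X ^ q := fun j => rfl
  have hdeg : ∀ j, (P j).natDegree = q ^ (j + 1) := by
    intro j
    induction j with
    | zero => rw [hP0, natDegree_C_mul_X_pow _ _ hβ]; simp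
    | succ j ih =>
      have h1 : (P j ^ q).natDegree = q ^ (j + 2) := by rw [natDegree_pow, ih]; ring
      rw [hPs, natDegree_add_eq_left_of_natDegree_lt, h1]
      rw [h1]
      refine lt_of_le_of_lt (natDegree_C_mul_X_pow_le _ _) ?_
      calc q = q ^ 1 := (pow_one q).symm
        _ < q ^ (j + 2) := Nat.pow_lt_pow_right (by omega) (by omega)
  have hX : ∀ j, X ^ 2 ∣ P j := by
    intro j
    have hXq : (X : k[X]) ^ 2 ∣ X ^ q := pow_dvd_pow _ hq
    induction j with
    | zero => exact Dvd.dvd.mul_left hXq _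
    | succ j ih =>
      exact dvd_add (dvd_pow ih (by omega)) (Dvd.dvd.mul_left hXq _)
  obtain ⟨Q, hQ⟩ := hX m
  have hPm0 : P m ≠ 0 := by
    intro h
    have := hdeg m
    rw [h, natDegree_zero] at this
    exact absurd this.symm (by positivity)
  have hdegQ : (X * Q - 1 : k[X]).degree ≠ 0 := by
    have hXQ : (X * Q).natDegree = q ^ (m + 1) - 1 := by
      have h1 : P m = X * (X * Q) := by rw [hQ]; ring
      have h2 : X * Q ≠ 0 := fun h => hPm0 (by rw [h1, h, mul_zero])
      have := hdeg m
      rw [h1, natDegree_mul X_ne_zero h2, natDegree_X] at this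
      omega
    have hlt : 2 ≤ q ^ (m + 1) := hq.trans (Nat.le_self_pow (by omega) q)
    have h3 : (X * Q - 1 : k[X]).natDegree = q ^ (m + 1) - 1 := by
      rw [natDegree_sub_eq_left_of_natDegree_lt, hXQ]
      rw [hXQ, natDegree_one]
      omega
    intro h0
    have := natDegree_eq_of_degree_eq_some (n := 0) (by simpa using h0)
    omega
  obtain ⟨z, hz⟩ := IsAlgClosed.exists_root _ hdegQ
  have hz1 : z * Q.eval z = 1 := by
    have : z * Q.eval z - 1 = 0 := by simpa using hz
    linear_combination this
  have hPz : (P m).eval z = z := by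
    rw [hQ]
    simp only [eval_mul, eval_pow, eval_X]
    linear_combination z * hz1
  refine ⟨fun j => (P j).eval z, ?_, ?_, fun j _ => ?_⟩
  · simp only [hPz]
    rintro rfl
    simp at hz1
  · dsimp only
    rw [hPz, hP0, eval_mul, eval_C, eval_pow, eval_X, mul_comm]
  · dsimp only
    rw [hPz, hPs, eval_add, eval_mul, eval_C, eval_pow, eval_pow, eval_X, mul_comm (β _)]

/-- The analogous equations for an operator that is semilinear for the inverse of `x ↦ x ^ q`; the
coordinates of the fixed vector are `c j ^ q`. -/
theorem exists_ne_zero_of_inverse_frobenius_recursion {q : ℕ} (hq : 2 ≤ q) (m : ℕ) (β : ℕ → k)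
    (hβ : β 0 ≠ 0) :
    ∃ c : ℕ → k, c m ≠ 0 ∧ c 0 ^ q = c m * β 0 ∧
      ∀ j < m, c (j + 1) ^ q = c j + c m * β (j + 1) := by
  let D : ℕ → k[X] := fun i => Nat.rec X (fun i p => p ^ q - C (β (m - i)) * X) i
  have hD0 : D 0 = X := rfl
  have hDs : ∀ i, D (i + 1) = D i ^ q - C (β (m - i)) * X := fun i => rfl
  have hdeg : ∀ i, (D i).natDegree = q ^ i := by
    intro i
    induction i with
    | zero => simp [hD0]
    | succ i ih =>
      have h1 : (D i ^ q).natDegree = q ^ (i + 1) := by rw [natDegree_pow, ih]; ring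
      rw [hDs, natDegree_sub_eq_left_of_natDegree_lt, h1]
      rw [h1]
      refine lt_of_le_of_lt (natDegree_C_mul_le _ _) ?_
      rw [natDegree_X]
      exact Nat.one_lt_pow (by omega) (by omega)
  have hX : ∀ i, X ∣ D i := by
    intro i
    induction i with
    | zero => exact dvd_rfl
    | succ i ih => exact dvd_sub (dvd_pow ih (by omega)) (Dvd.intro_left _ rfl)
  obtain ⟨Q, hQ⟩ : X ^ 2 ∣ D m ^ q := (pow_dvd_pow _ hq).trans (pow_dvd_pow_of_dvd (hX m) q)
  have hdegD : (D m ^ q).natDegree = q ^ (m + 1) := by rw [natDegree_pow, hdeg]; ring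
  have hlt : 2 ≤ q ^ (m + 1) := hq.trans (Nat.le_self_pow (by omega) q)
  have hdegQ : (X * Q - C (β 0) : k[X]).degree ≠ 0 := by
    have hXQ : (X * Q).natDegree = q ^ (m + 1) - 1 := by
      have h1 : D m ^ q = X * (X * Q) := by rw [hQ]; ring
      have h2 : X * Q ≠ 0 := fun h => by
        rw [h1, h, mul_zero, natDegree_zero] at hdegD
        omega
      rw [h1, natDegree_mul X_ne_zero h2, natDegree_X] at hdegD
      omega
    have h3 : (X * Q - C (β 0) : k[X]).natDegree = q ^ (m + 1) - 1 := by
      rw [natDegree_sub_C, hXQ]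
    intro h0
    have := natDegree_eq_of_degree_eq_some (n := 0) (by simpa using h0)
    omega
  obtain ⟨z, hz⟩ := IsAlgClosed.exists_root _ hdegQ
  have hz1 : z * Q.eval z = β 0 := by
    have : z * Q.eval z - β 0 = 0 := by simpa using hz
    linear_combination this
  have hDz : (D m).eval z ^ q = z * β 0 := by
    rw [← eval_pow, hQ]
    simp only [eval_mul, eval_pow, eval_X]
    linear_combination z * hz1
  refine ⟨fun j => (D (m - j)).eval z, ?_, ?_, fun j hj => ?_⟩
  · simp only [Nat.sub_self, hD0, eval_X]
    rintro rfl
    exact hβ (by simpa using hz1.symm)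
  · simpa [hD0] using hDz
  · have h1 : m - j = (m - (j + 1)) + 1 := by omega
    have h2 : m - (m - (j + 1)) = j + 1 := by omega
    simp only [h1, hDs, h2, Nat.sub_self, hD0]
    simp only [eval_sub, eval_pow, eval_mul, eval_C, eval_X]
    ring

end Equations

section Eigenvector

theorem mem_span_image_range_iff {R M : Type*} [Semiring R] [AddCommMonoid M] [Module R M]
    {v : ℕ → M} {m : ℕ} {x : M} :
    x ∈ Submodule.span R (v '' (Finset.range m : Set ℕ)) ↔
      ∃ b : ℕ → R, x = ∑ j ∈ Finset.range m, b j • v j := by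
  constructor
  · intro hx
    obtain ⟨b, rfl⟩ := (Submodule.mem_span_image_finset_iff_exists_fun R).mp hx
    refine ⟨fun j => if h : j ∈ Finset.range m then b ⟨j, h⟩ else 0, ?_⟩
    rw [← Finset.sum_coe_sort (Finset.range m)]
    exact Finset.sum_congr rfl fun j _ => by dsimp only; rw [dif_pos j.2]
  · rintro ⟨b, rfl⟩
    exact sum_mem fun j hj => Submodule.smul_mem _ _ (Submodule.subset_span ⟨j, hj, rfl⟩)

variable {OL : Type*} [CommRing OL] [IsDomain OL] [IsDiscreteValuationRing OL]
  {ϖ : OL} [hϖ : Fact (Irreducible ϖ)]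
  {L N : Type*} [Field L] [Algebra OL L] [IsFractionRing OL L] [AddCommGroup N] [Module L N]
  [Module OL N] [IsScalarTower OL L N]

open SemilinearGroup IsLocalRing

theorem smul_mem_of_residue_eq_zero {A X : Submodule OL N} (h : uniformizerMul ϖ L N • A ≤ X)
    {a : OL} (ha : residue OL a = 0) {x : N} (hx : x ∈ A) : a • x ∈ X := by
  rw [residue_eq_zero_iff, hϖ.out.maximalIdeal_eq, Ideal.mem_span_singleton'] at ha
  obtain ⟨b, rfl⟩ := ha
  rw [mul_smul, ← uniformizerMul_smul_eq_smul (ϖ := ϖ) (L := L)]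
  exact X.smul_mem _ (h (smul_mem_smul.mpr hx))

/-- A semilinear operator on `A / X`, a vector space over the residue field, that is injective has
a nonzero fixed vector, provided that the equations for the coordinates of a fixed vector in a
cyclic subspace can be solved in the residue field. The relation `ρ` holds between `y` and its
image under the automorphism of the residue field. -/
theorem exists_fixed_vector (g : SemilinearGroup ϖ L N)
    (ρ : ResidueField OL → ResidueField OL → Prop)
    (hρ : ∀ y c, ρ y c → ∃ a b : OL, residue OL a = y ∧ residue OL b = c ∧
      ∀ x : N, g • (a • x) = b • g • x)
    (hsolve : ∀ (m : ℕ) (β : ℕ → ResidueField OL), β 0 ≠ 0 →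
      ∃ y c : ℕ → ResidueField OL, y m ≠ 0 ∧ (∀ j, ρ (y j) (c j)) ∧ y 0 = c m * β 0 ∧
        ∀ j < m, y (j + 1) = c j + c m * β (j + 1))
    {A X : Submodule OL N} (hA : A.FG) (hXA : X < A) (hϖA : uniformizerMul ϖ L N • A ≤ X)
    (hgA : g • A ≤ A) (hinj : ∀ x ∈ A, g • x ∈ X → x ∈ X) :
    ∃ y ∈ A, y ∉ X ∧ g • y - y ∈ X := by
  obtain ⟨y₀, hy₀A, hy₀X⟩ := SetLike.exists_of_lt hXA
  have hgA' : ∀ x ∈ A, g • x ∈ A := smul_le_iff_forall.mp hgA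
  let v : ℕ → N := fun j => g ^ j • y₀
  have hvs : ∀ j, g • v j = v (j + 1) := fun j => by simp only [v, pow_succ', mul_smul]
  have hvA : ∀ j, v j ∈ A := by
    intro j
    induction j with
    | zero => simpa [v] using hy₀A
    | succ j ih => rw [← hvs]; exact hgA' _ ih
  have hex : ∃ M, ∃ b : ℕ → OL, v M - ∑ j ∈ Finset.range M, b j • v j ∈ X := by
    have : Module.Finite OL A := Module.Finite.iff_fg.mpr hA
    let S : ℕ →o Submodule OL A :=
      ⟨fun M => (X ⊔ Submodule.span OL (v '' (Finset.range M : Set ℕ))).submoduleOf A, by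
        intro i j hij
        refine Submodule.comap_mono (sup_le_sup_left (Submodule.span_mono ?_) _)
        exact Set.image_mono (by simpa using hij)⟩
    obtain ⟨M, hM⟩ := monotone_stabilizes_iff_noetherian.mpr (inferInstance : IsNoetherian OL A) S
    have h1 : (⟨v M, hvA M⟩ : A) ∈ S (M + 1) := by
      refine Submodule.mem_sup_right (Submodule.subset_span ⟨M, ?_, rfl⟩)
      simp
    rw [← hM (M + 1) (Nat.le_succ M)] at h1
    obtain ⟨x, hx, z, hz, hxz⟩ := Submodule.mem_sup.mp
      (show v M ∈ X ⊔ Submodule.span OL (v '' (Finset.range M : Set ℕ)) from h1)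
    obtain ⟨b, rfl⟩ := mem_span_image_range_iff.mp hz
    exact ⟨M, b, by rwa [← hxz, add_sub_cancel_right]⟩
  classical
  obtain ⟨M, hM, hmin⟩ : ∃ M, (∃ b : ℕ → OL, v M - ∑ j ∈ Finset.range M, b j • v j ∈ X) ∧
      ∀ M' < M, ¬ ∃ b : ℕ → OL, v M' - ∑ j ∈ Finset.range M', b j • v j ∈ X :=
    ⟨Nat.find hex, Nat.find_spec hex, fun _ h => Nat.find_min hex h⟩
  obtain ⟨b, hb⟩ := hM
  rcases M with _ | m
  · exact absurd (by simpa [v] using hb) hy₀X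
  have hm := hmin m (Nat.lt_succ_self m)
  -- the constant coefficient is a unit, because `g` is injective on `A / X`
  have hb0 : residue OL (b 0) ≠ 0 := by
    intro h0
    apply hm
    choose b' hb' using fun j => (exists_integral_smul g⁻¹ (b (j + 1)) : _)
    refine ⟨b', hinj _ (sub_mem (hvA m) (sum_mem fun j _ => A.smul_mem _ (hvA j))) ?_⟩
    have hterm : ∀ j, g • (b' j • v j) = b (j + 1) • v (j + 1) := by
      intro j
      have := hb' j (v (j + 1))
      rw [← hvs, inv_smul_smul, inv_smul_eq_iff] at this
      rw [← this, hvs]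
    rw [smul_sub, hvs, Finset.smul_sum, Finset.sum_congr rfl fun j _ => hterm j]
    rw [Finset.sum_range_succ'] at hb
    have := X.add_mem hb (smul_mem_of_residue_eq_zero hϖA h0 (hvA 0))
    convert this using 1
    abel
  obtain ⟨y, c, hym, hyc, hy0, hys⟩ := hsolve m (fun j => residue OL (b j)) hb0
  choose a c' ha hc' hac using fun j => hρ _ _ (hyc j)
  refine ⟨∑ j ∈ Finset.range (m + 1), a j • v j, sum_mem fun j _ => A.smul_mem _ (hvA j), ?_, ?_⟩
  · intro hX
    apply hm
    obtain ⟨u, hu⟩ : IsUnit (a m) := by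
      by_contra h
      exact hym (by rw [← ha, residue_eq_zero_iff]; exact h)
    refine ⟨fun j => -((↑u⁻¹ : OL) * a j), ?_⟩
    have := X.smul_mem (↑u⁻¹ : OL) hX
    rw [Finset.sum_range_succ, smul_add, ← hu, smul_smul, Units.inv_mul, one_smul,
      Finset.smul_sum] at this
    simp only [neg_smul, Finset.sum_neg_distrib, sub_neg_eq_add, mul_smul]
    rwa [add_comm]
  · have h1 : g • ∑ j ∈ Finset.range (m + 1), a j • v j =
        ∑ j ∈ Finset.range (m + 1), c' j • v (j + 1) := by
      rw [Finset.smul_sum]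
      exact Finset.sum_congr rfl fun j _ => by rw [hac, hvs]
    have h2 : g • ∑ j ∈ Finset.range (m + 1), a j • v j - ∑ j ∈ Finset.range (m + 1), a j • v j =
        c' m • (v (m + 1) - ∑ j ∈ Finset.range (m + 1), b j • v j) + (c' m * b 0 - a 0) • v 0 +
          ∑ j ∈ Finset.range m, (c' j + c' m * b (j + 1) - a (j + 1)) • v (j + 1) := by
      rw [h1, Finset.sum_range_succ (fun j => c' j • v (j + 1)),
        Finset.sum_range_succ' (fun j => a j • v j),
        Finset.sum_range_succ' (fun j => b j • v j)]
      simp only [sub_smul, add_smul, Finset.sum_sub_distrib, Finset.sum_add_distrib, mul_smul,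
        smul_sub, smul_add, Finset.smul_sum]
      abel
    rw [h2]
    refine add_mem (add_mem (X.smul_mem _ hb) ?_) (sum_mem fun j hj => ?_)
    · refine smul_mem_of_residue_eq_zero hϖA ?_ (hvA 0)
      rw [map_sub, map_mul, ha, hc', hy0, sub_self]
    · refine smul_mem_of_residue_eq_zero hϖA ?_ (hvA _)
      rw [map_sub, map_add, map_mul, ha, hc', hc', hys j (Finset.mem_range.mp hj), sub_self]

end Eigenvector

/-! ### Stable lattices -/

section Stable

variable {OL : Type*} [CommRing OL] [IsDomain OL] [IsDiscreteValuationRing OL]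
  {ϖ : OL} [hϖ : Fact (Irreducible ϖ)]
  {L N : Type*} [Field L] [Algebra OL L] [IsFractionRing OL L] [AddCommGroup N] [Module L N]
  [Module OL N] [IsScalarTower OL L N]

open SemilinearGroup IsLocalRing

/-- A lattice stable under `f` and under `ϖ f⁻¹`. -/
structure IsStableLattice (f : SemilinearGroup ϖ L N) (M : Submodule OL N) : Prop where
  isLattice : M.IsLattice L
  uniformizerMul_smul_le : uniformizerMul ϖ L N • M ≤ f • M
  smul_le : f • M ≤ M

/-- `f` induces `x ↦ x ^ q` on the residue field. -/
def IsFrobeniusSemilinear (q : ℕ) (f : SemilinearGroup ϖ L N) : Prop :=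
  ∀ a : OL, ∃ b : OL, residue OL b = residue OL a ^ q ∧ ∀ x : N, f • (a • x) = b • f • x

/-- If `y` spans a line in `M / X` stable under `f` and `ϖ f⁻¹`, then `X + OL y` is stable. -/
theorem IsStableLattice.sup_span_singleton {f : SemilinearGroup ϖ L N} {X : Submodule OL N}
    (hX : IsStableLattice f X) {y : N} (h1 : f • y ∈ X ⊔ Submodule.span OL {y})
    (h2 : uniformizerMul ϖ L N • f⁻¹ • y ∈ X ⊔ Submodule.span OL {y}) :
    IsStableLattice f (X ⊔ Submodule.span OL {y}) := by
  have := hX.isLattice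
  refine ⟨Submodule.IsLattice.of_le_of_isLattice_of_fg L le_sup_left
    (hX.isLattice.fg.sup (Submodule.fg_span_singleton y)), ?_, ?_⟩
  · rw [smul_sup, sup_le_iff]
    refine ⟨hX.uniformizerMul_smul_le.trans (smul_mono _ le_sup_left), ?_⟩
    rw [smul_span, Set.image_singleton, Submodule.span_singleton_le_iff_mem, mem_smul,
      smul_uniformizerMul_smul]
    exact h2
  · rw [smul_sup, sup_le_iff]
    refine ⟨hX.smul_le.trans le_sup_left, ?_⟩
    rwa [smul_span, Set.image_singleton, Submodule.span_singleton_le_iff_mem]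

/-- If `X < Y` are stable lattices, then `Y / X` contains a stable line over the residue field:
a line killed by `f` and by `v = ϖ f⁻¹`, or the line of an eigenvector of `f`, or that of an
eigenvector of `v`. -/
theorem exists_stable_line [IsAlgClosed (ResidueField OL)] {q : ℕ} (hq : 2 ≤ q)
    {f : SemilinearGroup ϖ L N} (hf : IsFrobeniusSemilinear q f) {X Y : Submodule OL N}
    (hX : IsStableLattice f X) (hY : IsStableLattice f Y) (hXY : X < Y) :
    ∃ y ∈ Y, y ∉ X ∧ ϖ • y ∈ X ∧ IsStableLattice f (X ⊔ Submodule.span OL {y}) := by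
  have : Module.Finite OL Y := Module.Finite.iff_fg.mpr hY.isLattice.fg
  have hfg : ∀ Z ≤ Y, Z.FG := fun Z hZ => by
    have : IsNoetherian OL Z := isNoetherian_of_le hZ
    exact Module.Finite.iff_fg.mp inferInstance
  let s := uniformizerMul ϖ L N
  have hmem : ∀ Z : Submodule OL N, ∀ x, s • x ∈ Z ↔ x ∈ s⁻¹ • Z := fun Z x => by
    rw [mem_smul, inv_inv]
  have hfX : ∀ x ∈ X, f • x ∈ X := smul_le_iff_forall.mp hX.smul_le
  have hfY : ∀ x ∈ Y, f • x ∈ Y := smul_le_iff_forall.mp hY.smul_le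
  have hvX : ∀ x ∈ X, (s * f⁻¹) • x ∈ X := fun x hx => by
    have := hX.uniformizerMul_smul_le (smul_mem_smul.mpr hx)
    rwa [mem_smul, smul_uniformizerMul_smul, ← mul_smul] at this
  have hvY : ∀ x ∈ Y, (s * f⁻¹) • x ∈ Y := fun x hx => by
    have := hY.uniformizerMul_smul_le (smul_mem_smul.mpr hx)
    rwa [mem_smul, smul_uniformizerMul_smul, ← mul_smul] at this
  have hfv : ∀ x : N, f • (s * f⁻¹) • x = s • x := fun x => by
    rw [mul_smul, smul_uniformizerMul_smul, smul_inv_smul]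
  have hvf : ∀ x : N, (s * f⁻¹) • f • x = s • x := fun x => by rw [mul_smul, inv_smul_smul]
  have hsf : ∀ x : N, s • f • x = f • s • x := fun x => (smul_uniformizerMul_smul f x).symm
  have hsv : ∀ x : N, s • (s * f⁻¹) • x = (s * f⁻¹) • s • x := fun x =>
    (smul_uniformizerMul_smul (s * f⁻¹) x).symm
  have hs : ∀ x : N, s • x = ϖ • x := uniformizerMul_smul_eq_smul
  have hXs : ∀ x ∈ X, s • x ∈ X := fun x hx => by rw [hs]; exact X.smul_mem _ hx
  let Y₁ : Submodule OL N := Y ⊓ s⁻¹ • X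
  have hXY₁ : X < Y₁ := by
    refine lt_of_le_of_ne (le_inf hXY.le fun x hx => (hmem _ _).mp (hXs x hx)) fun h => ?_
    obtain ⟨k, hk⟩ := exists_pow_smul_le_of_isLattice (ϖ := ϖ) hY.isLattice.fg hX.isLattice
    have : ∀ j : ℕ, ∀ x ∈ Y, s ^ j • x ∈ X → x ∈ X := by
      intro j
      induction j with
      | zero => intro x _ hx; simpa using hx
      | succ j ih =>
        intro x hx hxj
        have h1 : s • x ∈ X := by
          refine ih _ (by rw [hs]; exact Y.smul_mem _ hx) ?_
          rwa [← mul_smul, ← pow_succ]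
        rw [h]
        exact ⟨hx, (hmem _ _).mp h1⟩
    exact not_le_of_gt hXY fun x hx => this k x hx (hk (smul_mem_smul.mpr hx))
  have hfinish : ∀ y ∈ Y₁, y ∉ X → f • y ∈ X ⊔ Submodule.span OL {y} →
      (s * f⁻¹) • y ∈ X ⊔ Submodule.span OL {y} →
      ∃ y ∈ Y, y ∉ X ∧ ϖ • y ∈ X ∧ IsStableLattice f (X ⊔ Submodule.span OL {y}) := by
    intro y hy hyX h1 h2
    refine ⟨y, hy.1, hyX, ?_, hX.sup_span_singleton h1 (by rwa [mul_smul] at h2)⟩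
    rw [← hs, hmem]
    exact hy.2
  have hsubX : ∀ y z : N, z - y ∈ X → z ∈ X ⊔ Submodule.span OL {y} := fun y z h => by
    rw [show z = (z - y) + y by abel]
    exact add_mem (Submodule.mem_sup_left h)
      (Submodule.mem_sup_right (Submodule.mem_span_singleton_self y))
  -- the kernel of `f` on `Y₁ / X`
  let A : Submodule OL N := Y₁ ⊓ f⁻¹ • X
  have hA : ∀ x, x ∈ A ↔ x ∈ Y₁ ∧ f • x ∈ X := fun x => by
    rw [Submodule.mem_inf, mem_smul, inv_inv]
  have hY₁ : ∀ x, x ∈ Y₁ ↔ x ∈ Y ∧ s • x ∈ X := fun x => by rw [hmem]; rfl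
  have hXA : X ≤ A := fun x hx => (hA x).mpr ⟨hXY₁.le hx, hfX x hx⟩
  rcases eq_or_lt_of_le hXA with hAX | hAX
  · -- `f` is injective on `Y₁ / X`
    obtain ⟨y, hyY, hyX, hfix⟩ := exists_fixed_vector f (fun y c => c = y ^ q)
      (fun y c hyc => by
        obtain ⟨a, rfl⟩ := residue_surjective y
        obtain ⟨b, hb, h⟩ := hf a
        exact ⟨a, b, rfl, hb.trans hyc.symm, h⟩)
      (fun m β hβ => by
        obtain ⟨y, h1, h2, h3⟩ := exists_ne_zero_of_frobenius_recursion hq m β hβ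
        exact ⟨y, fun j => y j ^ q, h1, fun _ => rfl, h2, h3⟩)
      (hfg Y₁ inf_le_left) hXY₁
      (smul_le_iff_forall.mpr fun x hx => ((hY₁ x).mp hx).2)
      (smul_le_iff_forall.mpr fun x hx => (hY₁ _).mpr
        ⟨hfY x ((hY₁ x).mp hx).1, by rw [hsf]; exact hfX _ ((hY₁ x).mp hx).2⟩)
      (fun x hx hfx => by rw [hAX]; exact (hA x).mpr ⟨hx, hfx⟩)
    refine hfinish y hyY hyX (hsubX _ _ hfix) (Submodule.mem_sup_left ?_)
    -- `f y` is congruent to `y` and `v f = ϖ` kills `Y₁ / X`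
    have h1 := hvX _ hfix
    rw [smul_sub, hvf] at h1
    simpa using X.sub_mem ((hY₁ y).mp hyY).2 h1
  · by_cases hker : ∃ y ∈ A, y ∉ X ∧ (s * f⁻¹) • y ∈ X
    · obtain ⟨y, hyA, hyX, hvy⟩ := hker
      exact hfinish y ((hA y).mp hyA).1 hyX (Submodule.mem_sup_left ((hA y).mp hyA).2)
        (Submodule.mem_sup_left hvy)
    push Not at hker
    obtain ⟨y, hyA, hyX, hfix⟩ := exists_fixed_vector (s * f⁻¹) (fun y c => y = c ^ q)
      (fun y c hyc => by
        obtain ⟨b, rfl⟩ := residue_surjective c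
        obtain ⟨a, ha, h⟩ := hf b
        refine ⟨a, b, ha.trans hyc.symm, rfl, fun x => ?_⟩
        have := h (f⁻¹ • x)
        rw [smul_inv_smul] at this
        rw [← this, hvf, mul_smul, hs, hs, smul_comm])
      (fun m β hβ => by
        obtain ⟨c, h1, h2, h3⟩ := exists_ne_zero_of_inverse_frobenius_recursion hq m β hβ
        exact ⟨fun j => c j ^ q, c, pow_ne_zero _ h1, fun _ => rfl, h2, h3⟩)
      (hfg A (inf_le_left.trans inf_le_left)) hAX
      (smul_le_iff_forall.mpr fun x hx => ((hY₁ x).mp ((hA x).mp hx).1).2)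
      (smul_le_iff_forall.mpr fun x hx => by
        have h1 := ((hA x).mp hx).1
        have h2 := (hY₁ x).mp h1
        refine (hA _).mpr ⟨(hY₁ _).mpr ⟨hvY x h2.1, ?_⟩, ?_⟩
        · rw [hsv]; exact hvX _ h2.2
        · rw [hfv]; exact h2.2)
      (fun x hx hvx => by_contra fun hxX => hker x hx hxX hvx)
    exact hfinish y ((hA y).mp hyA).1 hyX (Submodule.mem_sup_left ((hA y).mp hyA).2)
      (hsubX _ _ hfix)

theorem relLength_sup_span_singleton {X : Submodule OL N} {y : N} (hy : y ∉ X)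
    (hϖy : ϖ • y ∈ X) : relLength (X ⊔ Submodule.span OL {y}) X = 1 := by
  rw [relLength, Module.length_eq_one_iff, Submodule.submoduleOf,
    ← covBy_iff_quot_is_simple le_sup_left]
  have hyS : y ∈ X ⊔ Submodule.span OL {y} :=
    Submodule.mem_sup_right (Submodule.mem_span_singleton_self y)
  refine ⟨lt_of_le_of_ne le_sup_left fun h => hy (by rw [h]; exact hyS), fun C hXC hC => ?_⟩
  obtain ⟨z, hzC, hzX⟩ := SetLike.exists_of_lt hXC
  obtain ⟨x, hx, w, hw, rfl⟩ := Submodule.mem_sup.mp (hC.le hzC)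
  obtain ⟨a, rfl⟩ := Submodule.mem_span_singleton.mp hw
  have hay : a • y ∈ C := by
    have := C.sub_mem hzC (hXC.le hx)
    simpa using this
  have hu : IsUnit a := by
    by_contra h
    rw [← mem_nonunits_iff, ← mem_maximalIdeal, hϖ.out.maximalIdeal_eq,
      Ideal.mem_span_singleton'] at h
    obtain ⟨b, rfl⟩ := h
    exact hzX (X.add_mem hx (by rw [mul_smul]; exact X.smul_mem _ hϖy))
  obtain ⟨u, rfl⟩ := hu
  have hyC : y ∈ C := by
    have := C.smul_mem (↑u⁻¹ : OL) hay
    rwa [smul_smul, Units.inv_mul, one_smul] at this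
  exact hC.not_ge (sup_le hXC.le ((Submodule.span_singleton_le_iff_mem _ _).mpr hyC))

end Stable

/-! ### Dual lattices -/

section Dual

variable {OL : Type*} [CommRing OL] [IsDomain OL] [IsDiscreteValuationRing OL]
  {ϖ : OL} [hϖ : Fact (Irreducible ϖ)]
  {L N : Type*} [Field L] [Algebra OL L] [IsFractionRing OL L] [AddCommGroup N] [Module L N]
  [Module OL N] [IsScalarTower OL L N] {B : LinearMap.BilinForm L N}

open SemilinearGroup

theorem mem_one_mul_unit_iff (u : OLˣ) (x : L) :
    algebraMap OL L u * x ∈ (1 : Submodule OL L) ↔ x ∈ (1 : Submodule OL L) := by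
  rw [← Algebra.smul_def]
  exact Submodule.smul_mem_iff_of_isUnit _ u.isUnit

theorem dualSubmodule_zpow_smul (k : ℤ) (M : Submodule OL N) :
    B.dualSubmodule (uniformizerMul ϖ L N ^ k • M) =
      uniformizerMul ϖ L N ^ (-k) • B.dualSubmodule M := by
  ext x
  rw [mem_zpow_uniformizerMul_smul, neg_neg, LinearMap.BilinForm.mem_dualSubmodule,
    LinearMap.BilinForm.mem_dualSubmodule]
  constructor
  · intro h y hy
    have := h _ (smul_mem_smul.mpr hy)
    rw [zpow_uniformizerMul_smul] at this
    simpa using this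
  · intro h y hy
    have := h _ hy
    rw [← zpow_neg, zpow_uniformizerMul_smul] at this
    have h0 := algebraMap_uniformizer_ne_zero (ϖ := ϖ) L
    simpa [← mul_assoc, inv_mul_cancel₀ (zpow_ne_zero k h0)] using this

/-- A similitude maps dual lattices to dual lattices, up to a power of `ϖ` given by the valuation
`w` of the similitude factor. -/
theorem exists_dualSubmodule_smul (f : SemilinearGroup ϖ L N) {τ : L → L}
    (hτ : ∀ x, τ x ∈ (1 : Submodule OL L) ↔ x ∈ (1 : Submodule OL L)) {c : L} (hc : c ≠ 0)
    (h : ∀ x y, B (f • x) (f • y) = c * τ (B x y)) :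
    ∃ w : ℤ, ∀ M : Submodule OL N,
      B.dualSubmodule (f • M) = uniformizerMul ϖ L N ^ (-w) • f • B.dualSubmodule M := by
  have h0 := algebraMap_uniformizer_ne_zero (ϖ := ϖ) L
  obtain ⟨w, u, rfl⟩ := exists_eq_zpow_mul (ϖ := ϖ) hc
  refine ⟨w, fun M => ?_⟩
  have key : ∀ x y : N, B (uniformizerMul ϖ L N ^ (-w) • f • x) (f • y) ∈ (1 : Submodule OL L) ↔
      B x y ∈ (1 : Submodule OL L) := by
    intro x y
    rw [zpow_uniformizerMul_smul, LinearMap.BilinForm.smul_left, h, ← hτ (B x y),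
      ← mem_one_mul_unit_iff u (τ (B x y)), ← mul_assoc, ← mul_assoc, ← zpow_add₀ h0]
    simp
  ext x
  obtain ⟨x, rfl⟩ : ∃ x', x = uniformizerMul ϖ L N ^ (-w) • f • x' :=
    ⟨f⁻¹ • (uniformizerMul ϖ L N ^ (-w))⁻¹ • x, by rw [smul_inv_smul, smul_inv_smul]⟩
  rw [smul_mem_smul, smul_mem_smul, LinearMap.BilinForm.mem_dualSubmodule,
    LinearMap.BilinForm.mem_dualSubmodule]
  constructor
  · intro hx y hy
    exact (key x y).mp (hx _ (smul_mem_smul.mpr hy))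
  · intro hx y hy
    rw [← smul_inv_smul f y, key]
    exact hx _ hy

theorem dualSubmodule_anti {M M' : Submodule OL N} (h : M ≤ M') :
    B.dualSubmodule M' ≤ B.dualSubmodule M := fun _ hx y hy => hx y (h hy)

theorem le_dualSubmodule_comm (hB : B.IsAlt) {M M' : Submodule OL N} :
    M ≤ B.dualSubmodule M' ↔ M' ≤ B.dualSubmodule M := by
  have : ∀ {M M' : Submodule OL N}, M ≤ B.dualSubmodule M' → M' ≤ B.dualSubmodule M := by
    intro M M' h x hx y hy
    rw [← hB.neg_eq y x]
    exact neg_mem (h hy x hx)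
  exact ⟨this, this⟩

theorem le_zpow_smul_dualSubmodule_comm (hB : B.IsAlt) {M M' : Submodule OL N} (k : ℤ) :
    M ≤ uniformizerMul ϖ L N ^ k • B.dualSubmodule M' ↔
      M' ≤ uniformizerMul ϖ L N ^ k • B.dualSubmodule M := by
  have h := dualSubmodule_zpow_smul (ϖ := ϖ) (B := B) (-k) M'
  rw [neg_neg] at h
  rw [← h, le_dualSubmodule_comm hB, smul_le_iff, ← zpow_neg, neg_neg]

variable [FiniteDimensional L N]

theorem dualSubmodule_isLattice (hB : B.Nondegenerate) {M : Submodule OL N}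
    (hM : M.IsLattice L) : (B.dualSubmodule M).IsLattice L := by
  classical
  obtain ⟨b, rfl⟩ := exists_basis_of_isLattice OL N hM
  rw [LinearMap.BilinForm.dualSubmodule_span_of_basis B hB]
  exact isLattice_span_basis _

theorem dualSubmodule_dualSubmodule (hB : B.Nondegenerate) (hB' : B.IsAlt) {M : Submodule OL N}
    (hM : M.IsLattice L) : B.dualSubmodule (B.dualSubmodule M) = M := by
  classical
  obtain ⟨b, rfl⟩ := exists_basis_of_isLattice OL N hM
  have hflip : ∀ M : Submodule OL N, B.flip.dualSubmodule M = B.dualSubmodule M := by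
    intro M
    ext x
    refine forall₂_congr fun y _ => ?_
    rw [LinearMap.BilinForm.flip_apply, ← hB'.neg_eq x y, neg_mem_iff]
  conv_lhs => rw [← hflip]
  exact LinearMap.BilinForm.dualSubmodule_flip_dualSubmodule_of_basis B hB b

theorem relLength_dualSubmodule (hB : B.Nondegenerate) (hB' : B.IsAlt) {M M' : Submodule OL N}
    (hM : M.IsLattice L) (hM' : M'.IsLattice L) (h : M ≤ M') :
    relLength (B.dualSubmodule M) (B.dualSubmodule M') = relLength M' M := by
  have hdd := fun {C : Submodule OL N} (hC : C.IsLattice L) =>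
    dualSubmodule_dualSubmodule hB hB' hC
  have hC1 : ∀ C : Set.Icc M M', C.1.IsLattice L :=
    fun C => isLattice_of_le_of_le hM hM' C.2.1 C.2.2
  have hC2 : ∀ C : Set.Icc (B.dualSubmodule M') (B.dualSubmodule M), C.1.IsLattice L :=
    fun C => isLattice_of_le_of_le (dualSubmodule_isLattice hB hM') (dualSubmodule_isLattice hB hM)
      C.2.1 C.2.2
  let e : Set.Icc M M' ≃o (Set.Icc (B.dualSubmodule M') (B.dualSubmodule M))ᵒᵈ :=
    { toFun := fun C => OrderDual.toDual
        ⟨B.dualSubmodule C.1, dualSubmodule_anti C.2.2, dualSubmodule_anti C.2.1⟩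
      invFun := fun C => ⟨B.dualSubmodule (OrderDual.ofDual C).1, by
        conv_lhs => rw [← hdd hM]
        exact dualSubmodule_anti (OrderDual.ofDual C).2.2, by
        conv_rhs => rw [← hdd hM']
        exact dualSubmodule_anti (OrderDual.ofDual C).2.1⟩
      left_inv := fun C => Subtype.ext (hdd (hC1 C))
      right_inv := fun C => Subtype.ext (hdd (hC2 (OrderDual.ofDual C)))
      map_rel_iff' := fun {C D} => by
        refine ⟨fun hCD => ?_, fun hCD => dualSubmodule_anti hCD⟩
        have := dualSubmodule_anti (B := B) hCD
        change B.dualSubmodule (B.dualSubmodule C.1) ≤ B.dualSubmodule (B.dualSubmodule D.1) at this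
        rwa [hdd (hC1 C), hdd (hC1 D)] at this }
  have := coe_relLength (dualSubmodule_anti (B := B) h)
  rw [← Order.krullDim_orderDual, ← Order.krullDim_eq_of_orderIso e, ← coe_relLength h] at this
  exact_mod_cast this

theorem latticeIndex_dualSubmodule (hB : B.Nondegenerate) (hB' : B.IsAlt) {M M' : Submodule OL N}
    (hM : M.IsLattice L) (hM' : M'.IsLattice L) :
    latticeIndex (B.dualSubmodule M) (B.dualSubmodule M') = latticeIndex M' M := by
  have hC := isLattice_inf hM hM'
  have hle : ∀ {A C : Submodule OL N}, A.IsLattice L → C.IsLattice L → C ≤ A →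
      latticeIndex (B.dualSubmodule C) (B.dualSubmodule A) = latticeIndex A C := by
    intro A C hA hC h
    rw [latticeIndex_of_le (dualSubmodule_anti h), latticeIndex_of_le h,
      relLength_dualSubmodule hB hB' hC hA h]
  have h1 := hle hM hC inf_le_left
  have h2 := hle hM' hC inf_le_right
  have h3 := latticeIndex_add (dualSubmodule_isLattice hB hM) (dualSubmodule_isLattice hB hC)
    (dualSubmodule_isLattice hB hM')
  have h4 := latticeIndex_add hM' hC hM
  rw [latticeIndex_symm (B.dualSubmodule M)] at h3
  rw [latticeIndex_symm (M ⊓ M')] at h4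
  linarith

/-- The dual of a stable lattice is stable. If the similitude factor has valuation `1`, this is
clear. Comparing indices shows that otherwise `f` preserves all stable lattices, or `f` and `ϖ`
have the same effect on all stable lattices. -/
theorem IsStableLattice.dualSubmodule (hB : B.Nondegenerate) (hB' : B.IsAlt)
    (hpos : 0 < Module.finrank L N) {f : SemilinearGroup ϖ L N} {w : ℤ}
    (hw : ∀ M : Submodule OL N,
      B.dualSubmodule (f • M) = uniformizerMul ϖ L N ^ (-w) • f • B.dualSubmodule M)
    {M : Submodule OL N} (hM : IsStableLattice f M) : IsStableLattice f (B.dualSubmodule M) := by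
  have hMl := hM.isLattice
  have hD := dualSubmodule_isLattice hB hMl
  have hfM := smul_isLattice f hMl
  have hsM := smul_isLattice (uniformizerMul ϖ L N) hMl
  have hfD := smul_isLattice f hD
  have h1 := latticeIndex_dualSubmodule hB hB' hfM hMl
  rw [hw] at h1
  have h2 := latticeIndex_smul_eq f hMl hD
  have h3 := latticeIndex_zpow_uniformizerMul (ϖ := ϖ) hfD (-w)
  have h4 := latticeIndex_add (smul_isLattice (uniformizerMul ϖ L N ^ (-w)) hfD) hD hfD
  rw [latticeIndex_symm (uniformizerMul ϖ L N ^ (-w) • f • B.dualSubmodule M)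
    (f • B.dualSubmodule M), h3] at h4
  have h5 := latticeIndex_nonneg hM.smul_le
  have h6 := latticeIndex_nonneg hM.uniformizerMul_smul_le
  have h7 := latticeIndex_add hMl hfM hsM
  rw [latticeIndex_uniformizerMul hMl] at h7
  -- `[M : f M]` is `w / 2` times the dimension, and it lies between `0` and the dimension
  have hw2 : 2 * latticeIndex M (f • M) = w * Module.finrank L N := by linarith
  have hpos' : (0 : ℤ) < Module.finrank L N := by exact_mod_cast hpos
  have hw0 : 0 ≤ w := by
    by_contra h
    nlinarith
  have hw3 : w ≤ 2 := by
    by_contra h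
    nlinarith
  have hdual : B.dualSubmodule (uniformizerMul ϖ L N • M) =
      uniformizerMul ϖ L N ^ (-1 : ℤ) • B.dualSubmodule M := by
    simpa using dualSubmodule_zpow_smul (ϖ := ϖ) (B := B) 1 M
  have hsD := _root_.uniformizerMul_smul_le (ϖ := ϖ) (L := L) (B.dualSubmodule M)
  refine ⟨hD, ?_, ?_⟩
  all_goals obtain rfl | rfl | rfl : w = 0 ∨ w = 1 ∨ w = 2 := by omega
  · have heq := eq_of_latticeIndex_eq_zero hMl hfM hM.smul_le (by linarith)
    have := hw M
    rw [← heq, neg_zero, zpow_zero, one_smul] at this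
    rwa [← this]
  · have := dualSubmodule_anti (B := B) hM.smul_le
    rwa [hw, zpow_neg_one, ← smul_le_iff] at this
  · have heq := eq_of_latticeIndex_eq_zero hfM hsM hM.uniformizerMul_smul_le (by linarith)
    have := hw M
    rw [heq, hdual, show (-2 : ℤ) = -1 + -1 by norm_num, zpow_add, mul_smul, smul_left_cancel_iff,
      zpow_neg_one, eq_inv_smul_iff] at this
    rw [this]
  · have heq := eq_of_latticeIndex_eq_zero hMl hfM hM.smul_le (by linarith)
    have := hw M
    rw [← heq, neg_zero, zpow_zero, one_smul] at this
    rw [← this]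
  · have := dualSubmodule_anti (B := B) hM.uniformizerMul_smul_le
    rwa [hw, hdual, smul_le_smul_iff] at this
  · have heq := eq_of_latticeIndex_eq_zero hfM hsM hM.uniformizerMul_smul_le (by linarith)
    have := hw M
    rw [heq, hdual, show (-2 : ℤ) = -1 + -1 by norm_num, zpow_add, mul_smul, smul_left_cancel_iff,
      zpow_neg_one, eq_inv_smul_iff] at this
    rw [← this]
    exact hsD

end Dual

/-! ### Selfdual families of stable lattices -/

section Family

variable {OL : Type*} [CommRing OL] [IsDomain OL] [IsDiscreteValuationRing OL]
  {ϖ : OL} [hϖ : Fact (Irreducible ϖ)]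
  {L N : Type*} [Field L] [Algebra OL L] [IsFractionRing OL L] [AddCommGroup N] [Module L N]
  [Module OL N] [IsScalarTower OL L N]

open SemilinearGroup IsLocalRing

/-- A totally ordered set of stable lattices that is closed under duality and under multiplication
by powers of `ϖ`, i.e. the set of members of a selfdual periodic lattice chain without its
indexing. -/
structure IsSelfdualFamily (f : SemilinearGroup ϖ L N) (B : LinearMap.BilinForm L N)
    (S : Set (Submodule OL N)) : Prop where
  stable : ∀ M ∈ S, IsStableLattice f M
  total : ∀ M ∈ S, ∀ M' ∈ S, M ≤ M' ∨ M' ≤ M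
  zpow_smul : ∀ M ∈ S, ∀ k : ℤ, uniformizerMul ϖ L N ^ k • M ∈ S
  dual : ∀ M ∈ S, B.dualSubmodule M ∈ S

variable {B : LinearMap.BilinForm L N} {f : SemilinearGroup ϖ L N}

/-- Zorn's lemma: the union of a chain of selfdual families is a selfdual family. -/
theorem IsSelfdualFamily.exists_maximal {S : Set (Submodule OL N)} (hS : IsSelfdualFamily f B S) :
    ∃ T, S ⊆ T ∧ Maximal (IsSelfdualFamily f B) T := by
  refine zorn_subset_nonempty {T | IsSelfdualFamily f B T} (fun c hc hchain _ => ?_) S hS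
  refine ⟨⋃₀ c, ⟨?_, ?_, ?_, ?_⟩, fun s hs => Set.subset_sUnion_of_mem hs⟩
  · rintro M ⟨T, hT, hM⟩
    exact (hc hT).stable M hM
  · rintro M ⟨T, hT, hM⟩ M' ⟨T', hT', hM'⟩
    rcases hchain.total hT hT' with h | h
    · exact (hc hT').total M (h hM) M' hM'
    · exact (hc hT).total M hM M' (h hM')
  · rintro M ⟨T, hT, hM⟩ k
    exact ⟨T, hT, (hc hT).zpow_smul M hM k⟩
  · rintro M ⟨T, hT, hM⟩
    exact ⟨T, hT, (hc hT).dual M hM⟩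

variable [FiniteDimensional L N]

theorem IsStableLattice.zpow_smul {M : Submodule OL N} (hM : IsStableLattice f M) (k : ℤ) :
    IsStableLattice f (uniformizerMul ϖ L N ^ k • M) := by
  refine ⟨smul_isLattice _ hM.isLattice, ?_, ?_⟩
  · rw [smul_zpow_uniformizerMul_smul, smul_zpow_uniformizerMul_smul, smul_le_smul_iff]
    exact hM.uniformizerMul_smul_le
  · rw [smul_zpow_uniformizerMul_smul, smul_le_smul_iff]
    exact hM.smul_le

theorem eq_of_total_of_latticeIndex_eq {A A' M : Submodule OL N} (hA : A.IsLattice L)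
    (hA' : A'.IsLattice L) (hM : M.IsLattice L) (h : A ≤ A' ∨ A' ≤ A)
    (heq : latticeIndex A M = latticeIndex A' M) : A = A' := by
  have h1 := latticeIndex_add hA hA' hM
  rcases h with h | h
  · refine (eq_of_latticeIndex_eq_zero hA' hA h ?_).symm
    rw [latticeIndex_symm]
    linarith
  · exact eq_of_latticeIndex_eq_zero hA hA' h (by linarith)

/-- A maximal selfdual family has no gaps: otherwise, a stable line in the gap, together with its
dual, would enlarge the family. -/
theorem IsSelfdualFamily.exists_latticeIndex_eq_one [IsAlgClosed (ResidueField OL)] {q : ℕ}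
    (hq : 2 ≤ q) (hf : IsFrobeniusSemilinear q f) (hB : B.Nondegenerate) (hB' : B.IsAlt)
    (hpos : 0 < Module.finrank L N) {w : ℤ}
    (hw : ∀ M : Submodule OL N,
      B.dualSubmodule (f • M) = uniformizerMul ϖ L N ^ (-w) • f • B.dualSubmodule M)
    {S : Set (Submodule OL N)} (hS : Maximal (IsSelfdualFamily f B) S) {X : Submodule OL N}
    (hX : X ∈ S) : ∃ X' ∈ S, latticeIndex X' X = 1 := by
  by_contra! hno
  have hSf := hS.prop
  have hXl := (hSf.stable X hX).isLattice
  -- `Y` is the successor of `X` in `S`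
  obtain ⟨Y, hYS, hXY, hYmin⟩ : ∃ Y ∈ S, X < Y ∧ ∀ Z ∈ S, Z ≤ X ∨ Y ≤ Z := by
    have hex : ∃ d : ℕ, ∃ Y ∈ S, X < Y ∧ latticeIndex Y X = d := by
      refine ⟨Module.finrank L N, uniformizerMul ϖ L N ^ (-1 : ℤ) • X, hSf.zpow_smul X hX _, ?_, ?_⟩
      · have hidx := latticeIndex_zpow_uniformizerMul (ϖ := ϖ) hXl (-1)
        have hle := zpow_uniformizerMul_smul_anti (ϖ := ϖ) (L := L)
          (show (-1 : ℤ) ≤ 0 by norm_num) X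
        rw [zpow_zero, one_smul] at hle
        refine lt_of_le_of_ne hle fun h => ?_
        rw [← h, latticeIndex_self] at hidx
        have : (0 : ℤ) < Module.finrank L N := by exact_mod_cast hpos
        linarith
      · rw [latticeIndex_symm, latticeIndex_zpow_uniformizerMul hXl]
        ring
    classical
    obtain ⟨Y, hYS, hXY, hYd⟩ := Nat.find_spec hex
    refine ⟨Y, hYS, hXY, fun Z hZ => ?_⟩
    rcases hSf.total Z hZ X hX with h | hXZ
    · exact Or.inl h
    rcases hXZ.eq_or_lt with h | hXZ
    · exact Or.inl h.ge
    have hZl := (hSf.stable Z hZ).isLattice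
    have hYl := (hSf.stable Y hYS).isLattice
    rcases hSf.total Z hZ Y hYS with h | h
    · right
      have h1 : Nat.find hex ≤ (latticeIndex Z X).toNat :=
        Nat.find_min' hex ⟨Z, hZ, hXZ, (Int.toNat_of_nonneg (latticeIndex_nonneg hXZ.le)).symm⟩
      have h2 := latticeIndex_nonneg hXZ.le
      have h3 := latticeIndex_nonneg h
      have h4 := latticeIndex_add hYl hZl hXl
      exact (eq_of_latticeIndex_eq_zero hYl hZl h (by omega)).le
    · exact Or.inr h
  obtain ⟨y, hyY, hyX, hϖy, hst⟩ :=
    exists_stable_line hq hf (hSf.stable X hX) (hSf.stable Y hYS) hXY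
  have hX'Y : X ⊔ Submodule.span OL {y} ≤ Y :=
    sup_le hXY.le ((Submodule.span_singleton_le_iff_mem _ _).mpr hyY)
  have hidx : latticeIndex (X ⊔ Submodule.span OL {y}) X = 1 := by
    rw [latticeIndex_of_le le_sup_left, relLength_sup_span_singleton hyX hϖy]
    rfl
  have hXX' : X ≤ X ⊔ Submodule.span OL {y} := le_sup_left
  have hyX' : ∀ x ∈ X ⊔ Submodule.span OL {y}, ∃ z ∈ X, ∃ a : OL, x = z + a • y := by
    intro x hx
    obtain ⟨z, hz, t, ht, rfl⟩ := Submodule.mem_sup.mp hx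
    obtain ⟨a, rfl⟩ := Submodule.mem_span_singleton.mp ht
    exact ⟨z, hz, a, rfl⟩
  have hyself : y ∈ X ⊔ Submodule.span OL {y} :=
    Submodule.mem_sup_right (Submodule.mem_span_singleton_self y)
  generalize hX'def : X ⊔ Submodule.span OL {y} = X' at *
  have hX'l := hst.isLattice
  have hdst := hst.dualSubmodule hB hB' hpos hw
  have hdd := dualSubmodule_dualSubmodule hB hB' hX'l
  have hcomp1 : ∀ Z ∈ S, X' ≤ Z ∨ Z ≤ X' := fun Z hZ =>
    (hYmin Z hZ).elim (fun h => Or.inr (h.trans hXX')) (fun h => Or.inl (hX'Y.trans h))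
  have hcomp2 : ∀ Z ∈ S, B.dualSubmodule X' ≤ Z ∨ Z ≤ B.dualSubmodule X' := fun Z hZ => by
    rw [← dualSubmodule_dualSubmodule hB hB' (hSf.stable Z hZ).isLattice]
    exact (hcomp1 _ (hSf.dual Z hZ)).symm.imp dualSubmodule_anti dualSubmodule_anti
  have hcomp3 : ∀ l : ℤ, X' ≤ uniformizerMul ϖ L N ^ l • B.dualSubmodule X' ∨
      uniformizerMul ϖ L N ^ l • B.dualSubmodule X' ≤ X' := by
    intro l
    rcases hYmin _ (hSf.zpow_smul _ (hSf.dual X hX) l) with h | h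
    · exact Or.inr (((smul_mono _ (dualSubmodule_anti hXX')).trans h).trans hXX')
    · left
      have h1 := (le_zpow_smul_dualSubmodule_comm hB' l).mp (hX'Y.trans h)
      rw [← hX'def, sup_le_iff, Submodule.span_singleton_le_iff_mem, hX'def]
      refine ⟨h1, ?_⟩
      -- the line spanned by `y` is isotropic since the form is alternating
      rw [mem_zpow_uniformizerMul_smul]
      intro x hx
      obtain ⟨z, hz, a, rfl⟩ := hyX' x hx
      have hyz := mem_zpow_uniformizerMul_smul.mp (h hyY) z hz
      rw [map_smul, LinearMap.smul_apply, map_add, LinearMap.map_smul_of_tower, hB' y,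
        smul_zero, add_zero, ← LinearMap.smul_apply, ← map_smul]
      exact hyz
  have hSS' : IsSelfdualFamily f B (S ∪ {Z | ∃ k : ℤ, Z = uniformizerMul ϖ L N ^ k • X' ∨
      Z = uniformizerMul ϖ L N ^ k • B.dualSubmodule X'}) := by
    have hshift : ∀ (k l : ℤ) {A C : Submodule OL N},
        (A ≤ uniformizerMul ϖ L N ^ (l - k) • C ∨ uniformizerMul ϖ L N ^ (l - k) • C ≤ A) →
        (uniformizerMul ϖ L N ^ k • A ≤ uniformizerMul ϖ L N ^ l • C ∨
          uniformizerMul ϖ L N ^ l • C ≤ uniformizerMul ϖ L N ^ k • A) := by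
      intro k l A C h
      rw [show uniformizerMul ϖ L N ^ l = uniformizerMul ϖ L N ^ k * uniformizerMul ϖ L N ^ (l - k)
        by rw [← zpow_add]; congr 1; ring, mul_smul, smul_le_smul_iff, smul_le_smul_iff]
      exact h
    have hself : ∀ (k l : ℤ) (A : Submodule OL N),
        uniformizerMul ϖ L N ^ k • A ≤ uniformizerMul ϖ L N ^ l • A ∨
          uniformizerMul ϖ L N ^ l • A ≤ uniformizerMul ϖ L N ^ k • A := fun k l A =>
      (le_total l k).imp (fun h => zpow_uniformizerMul_smul_anti h A)
        (fun h => zpow_uniformizerMul_smul_anti h A)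
    have hmixed : ∀ Z ∈ S, ∀ k : ℤ, ∀ A : Submodule OL N, (∀ Z ∈ S, A ≤ Z ∨ Z ≤ A) →
        uniformizerMul ϖ L N ^ k • A ≤ Z ∨ Z ≤ uniformizerMul ϖ L N ^ k • A := by
      intro Z hZ k A hA
      have := hshift k 0 (hA _ (hSf.zpow_smul Z hZ (0 - k)))
      rwa [zpow_zero, one_smul] at this
    refine ⟨?_, ?_, ?_, ?_⟩
    · rintro M (hM | ⟨k, rfl | rfl⟩)
      · exact hSf.stable M hM
      · exact hst.zpow_smul k
      · exact hdst.zpow_smul k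
    · rintro M (hM | ⟨k, rfl | rfl⟩) M' (hM' | ⟨l, rfl | rfl⟩)
      · exact hSf.total M hM M' hM'
      · exact (hmixed M hM l _ hcomp1).symm
      · exact (hmixed M hM l _ hcomp2).symm
      · exact hmixed M' hM' k _ hcomp1
      · exact hself k l _
      · exact hshift k l (hcomp3 _)
      · exact hmixed M' hM' k _ hcomp2
      · exact (hshift l k (hcomp3 _)).symm
      · exact hself k l _
    · rintro M (hM | ⟨k, rfl | rfl⟩) l
      · exact Or.inl (hSf.zpow_smul M hM l)
      · exact Or.inr ⟨l + k, Or.inl (by rw [zpow_add, mul_smul])⟩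
      · exact Or.inr ⟨l + k, Or.inr (by rw [zpow_add, mul_smul])⟩
    · rintro M (hM | ⟨k, rfl | rfl⟩)
      · exact Or.inl (hSf.dual M hM)
      · exact Or.inr ⟨-k, Or.inr (dualSubmodule_zpow_smul k X')⟩
      · exact Or.inr ⟨-k, Or.inl (by rw [dualSubmodule_zpow_smul, hdd])⟩
  have hmem : X' ∈ S := hS.le_of_ge hSS' Set.subset_union_left
    (Or.inr ⟨0, Or.inl (by rw [zpow_zero, one_smul])⟩)
  exact hno X' hmem hidx

/-- Every selfdual family of stable lattices is contained in one with members of all indices. -/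
theorem IsSelfdualFamily.exists_full [IsAlgClosed (ResidueField OL)] {q : ℕ}
    (hq : 2 ≤ q) (hf : IsFrobeniusSemilinear q f) (hB : B.Nondegenerate) (hB' : B.IsAlt)
    (hpos : 0 < Module.finrank L N) {w : ℤ}
    (hw : ∀ M : Submodule OL N,
      B.dualSubmodule (f • M) = uniformizerMul ϖ L N ^ (-w) • f • B.dualSubmodule M)
    {S : Set (Submodule OL N)} (hS : IsSelfdualFamily f B S) {M₀ : Submodule OL N} (hM₀ : M₀ ∈ S) :
    ∃ T, S ⊆ T ∧ IsSelfdualFamily f B T ∧ ∀ k : ℤ, ∃ M ∈ T, latticeIndex M M₀ = k := by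
  obtain ⟨T, hST, hT⟩ := hS.exists_maximal
  refine ⟨T, hST, hT.prop, ?_⟩
  have hl : ∀ {M}, M ∈ T → M.IsLattice L := fun hM => (hT.prop.stable _ hM).isLattice
  have hup : ∀ (d : ℕ), ∀ M ∈ T, ∃ M' ∈ T, latticeIndex M' M = d := by
    intro d
    induction d with
    | zero => exact fun M hM => ⟨M, hM, latticeIndex_self M⟩
    | succ d ih =>
      intro M hM
      obtain ⟨M', hM', h⟩ := ih M hM
      obtain ⟨M'', hM'', h'⟩ :=
        IsSelfdualFamily.exists_latticeIndex_eq_one hq hf hB hB' hpos hw hT hM'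
      refine ⟨M'', hM'', ?_⟩
      rw [← latticeIndex_add (hl hM'') (hl hM') (hl hM), h, h']
      push_cast
      ring
  intro k
  have hM₁ := hT.prop.zpow_smul M₀ (hST hM₀) k.natAbs
  have hidx := latticeIndex_zpow_uniformizerMul (ϖ := ϖ) (hl (hST hM₀)) k.natAbs
  rw [latticeIndex_symm] at hidx
  have hpos' : (1 : ℤ) ≤ Module.finrank L N := by exact_mod_cast hpos
  have hge : 0 ≤ k + k.natAbs * Module.finrank L N := by
    have h1 : (k.natAbs : ℤ) ≤ k.natAbs * Module.finrank L N := by nlinarith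
    omega
  obtain ⟨M, hM, h⟩ := hup (k + k.natAbs * Module.finrank L N).toNat _ hM₁
  rw [Int.toNat_of_nonneg hge] at h
  refine ⟨M, hM, ?_⟩
  rw [← latticeIndex_add (hl hM) (hl hM₁) (hl (hST hM₀)), h]
  linarith

end Family

/-! ### From families to periodic lattice chains -/

section Chains

variable {OL : Type*} [CommRing OL] [IsDomain OL] [IsDiscreteValuationRing OL]
  {ϖ : OL} [hϖ : Fact (Irreducible ϖ)]
  {L N : Type*} [Field L] [Algebra OL L] [IsFractionRing OL L] [AddCommGroup N] [Module L N]
  [Module OL N] [IsScalarTower OL L N]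

open SemilinearGroup IsLocalRing

theorem frobeniusImage_eq_smul {τ : L →+* L} {Φ : N →ₛₗ[τ] N} {f : SemilinearGroup ϖ L N}
    (hΦ : ∀ x, Φ x = f • x) (M : Submodule OL N) : frobeniusImage Φ M = f • M := by
  have : Φ '' (M : Set N) = ((f • M : Submodule OL N) : Set N) := by
    rw [coe_smul]
    exact Set.image_congr fun x _ => hΦ x
  rw [frobeniusImage, this, Submodule.span_eq]

theorem hasMinusculePosition_iff {τ : L →+* L} {Φ : N →ₛₗ[τ] N} {f : SemilinearGroup ϖ L N}
    (hΦ : ∀ x, Φ x = f • x) {r : ℕ} {M : Submodule OL N} :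
    HasMinusculePosition (algebraMap OL L ϖ) Φ r M ↔
      uniformizerMul ϖ L N • M ≤ f • M ∧ f • M ≤ M ∧ relLength M (f • M) = r := by
  have h := zpow_uniformizerMul_smul_eq (ϖ := ϖ) (L := L) 1 M
  rw [zpow_one, zpow_one] at h
  rw [HasMinusculePosition, frobeniusImage_eq_smul hΦ, h, relLength]

variable {B : LinearMap.BilinForm L N} {f : SemilinearGroup ϖ L N} [FiniteDimensional L N]

theorem IsStableLattice.hasMinusculePosition {τ : L →+* L} {Φ : N →ₛₗ[τ] N}
    (hΦ : ∀ x, Φ x = f • x) {r : ℕ} {M : Submodule OL N} (hM : IsStableLattice f M)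
    (hr : latticeIndex M (f • M) = r) : HasMinusculePosition (algebraMap OL L ϖ) Φ r M := by
  refine (hasMinusculePosition_iff hΦ).mpr ⟨hM.uniformizerMul_smul_le, hM.smul_le, ?_⟩
  rw [relLength_eq_latticeIndex hM.isLattice (smul_isLattice f hM.isLattice) hM.smul_le, hr]
  simp

theorem isStableLattice_of_hasMinusculePosition {τ : L →+* L} {Φ : N →ₛₗ[τ] N}
    (hΦ : ∀ x, Φ x = f • x) {r : ℕ} {M : Submodule OL N} (hl : M.IsLattice L)
    (hM : HasMinusculePosition (algebraMap OL L ϖ) Φ r M) :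
    IsStableLattice f M ∧ latticeIndex M (f • M) = r := by
  obtain ⟨h1, h2, h3⟩ := (hasMinusculePosition_iff hΦ).mp hM
  refine ⟨⟨hl, h1, h2⟩, ?_⟩
  rw [latticeIndex_of_le h2, h3]
  rfl

/-- In a selfdual family with members of all indices one finds a selfdual periodic lattice chain of
any type. It is pinned down by a member `M₀` and the place `i₀` that `M₀` is to have, which has to
be compatible with the index of `M₀` in its dual. -/
theorem IsSelfdualFamily.exists_chain {S : Set (Submodule OL N)} (hS : IsSelfdualFamily f B S)
    (hB : B.Nondegenerate) (hB' : B.IsAlt) {M₀ : Submodule OL N} (hM₀ : M₀ ∈ S)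
    (hfull : ∀ k : ℤ, ∃ M ∈ S, latticeIndex M M₀ = k) {m : ℕ} (hm : Module.finrank L N = m)
    {i₀ d : ℤ} (hd : latticeIndex (B.dualSubmodule M₀) M₀ = -2 * i₀ + d * m) (I : Set (ZMod m)) :
    ∃ M : typeIndex I → Submodule OL N, (∀ i, M i ∈ S ∧ latticeIndex (M i) M₀ = i - i₀) ∧
      IsPeriodicLatticeChain (algebraMap OL L ϖ) I M ∧ IsSelfdualChain B I M := by
  have hl : ∀ {M}, M ∈ S → M.IsLattice L := fun hM => (hS.stable _ hM).isLattice
  choose M hMS hM using fun i : typeIndex I => hfull (i - i₀)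
  have hunique : ∀ {A A'}, A ∈ S → A' ∈ S → latticeIndex A M₀ = latticeIndex A' M₀ → A = A' :=
    fun hA hA' h => eq_of_total_of_latticeIndex_eq (hl hA) (hl hA') (hl hM₀)
      (hS.total _ hA _ hA') h
  have hidx : ∀ i j, latticeIndex (M j) (M i) = (j : ℤ) - i := by
    intro i j
    have := latticeIndex_add (hl (hMS j)) (hl (hMS i)) (hl hM₀)
    rw [hM, hM] at this
    linarith
  have hle : ∀ i j, i < j → M i ≤ M j := by
    intro i j hij
    refine (hS.total _ (hMS i) _ (hMS j)).resolve_right fun h => ?_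
    have h1 := latticeIndex_nonneg h
    rw [hidx] at h1
    have : (i : ℤ) < j := hij
    omega
  refine ⟨M, fun i => ⟨hMS i, hM i⟩, ⟨fun i => hl (hMS i), hle, fun i j hij => ?_,
    fun i j hij => ?_⟩, d, fun i j hij => ?_⟩
  · have := relLength_eq_latticeIndex (hl (hMS j)) (hl (hMS i)) (hle i j hij)
    rwa [hidx] at this
  · rw [← zpow_neg_one, ← zpow_uniformizerMul_smul_eq]
    refine hunique (hMS j) (hS.zpow_smul _ (hMS i) _) ?_
    have h1 := latticeIndex_zpow_uniformizerMul (ϖ := ϖ) (hl (hMS i)) (-1)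
    have h2 := latticeIndex_add (hl (hMS i)) (hl (hS.zpow_smul _ (hMS i) (-1))) (hl hM₀)
    rw [hM] at h2 ⊢
    rw [hm] at h1
    linarith
  · refine hunique (hS.dual _ (hMS i)) (hMS j) ?_
    have h1 := latticeIndex_add (hl (hS.dual _ (hMS i))) (hl (hS.dual _ hM₀)) (hl hM₀)
    rw [latticeIndex_dualSubmodule hB hB' (hl (hMS i)) (hl hM₀), latticeIndex_symm, hM, hd] at h1
    rw [hM]
    linarith

theorem IsPeriodicLatticeChain.eq_zpow_smul {m : ℕ} {I : Set (ZMod m)}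
    {M : typeIndex I → Submodule OL N} (hM : IsPeriodicLatticeChain (algebraMap OL L ϖ) I M)
    (k : ℤ) (i j : typeIndex I) (hij : (j : ℤ) = i - k * m) :
    M j = uniformizerMul ϖ L N ^ k • M i := by
  have hstep : ∀ i j : typeIndex I, (j : ℤ) = i + m →
      M j = uniformizerMul ϖ L N ^ (-1 : ℤ) • M i := by
    intro i j h
    rw [hM.periodic i j h, zpow_uniformizerMul_smul_eq, zpow_neg_one]
  have hmem : ∀ (i : typeIndex I) (l : ℤ), (i : ℤ) + l * m ∈ typeIndex I := by
    intro i l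
    have := i.2
    simp only [typeIndex, Set.mem_ofPred_eq] at this ⊢
    push_cast
    simpa using this
  induction k using Int.induction_on generalizing j with
  | zero =>
    have : j = i := Subtype.ext (by simpa using hij)
    rw [this, zpow_zero, one_smul]
  | succ k ih =>
    have h1 := hstep j ⟨j + 1 * m, hmem j 1⟩ (by simp)
    rw [ih ⟨j + 1 * m, hmem j 1⟩ (by dsimp only; linarith), zpow_neg_one, eq_inv_smul_iff,
      smul_smul] at h1
    rw [← h1, zpow_add, zpow_one, ((Commute.refl _).zpow_left _).eq]
  | pred k ih =>
    have h1 := hstep ⟨j + (-1) * m, hmem j (-1)⟩ j (by simp)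
    rw [ih ⟨j + (-1) * m, hmem j (-1)⟩ (by dsimp only; linarith), smul_smul, ← zpow_add] at h1
    rw [h1]
    congr 2
    ring

theorem IsPeriodicLatticeChain.latticeIndex_eq {m : ℕ} {I : Set (ZMod m)}
    {M : typeIndex I → Submodule OL N} (hM : IsPeriodicLatticeChain (algebraMap OL L ϖ) I M)
    (i j : typeIndex I) : latticeIndex (M j) (M i) = (j : ℤ) - i := by
  have key : ∀ i j : typeIndex I, i < j → latticeIndex (M j) (M i) = (j : ℤ) - i := by
    intro i j hij
    have h1 : relLength (M j) (M i) = _ := hM.length_eq i j hij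
    have h2 : (i : ℤ) < j := hij
    rw [latticeIndex_of_le (hM.le i j hij), h1, ENat.toNat_natCast]
    omega
  rcases lt_trichotomy i j with h | rfl | h
  · exact key i j h
  · rw [latticeIndex_self, sub_self]
  · rw [latticeIndex_symm, key j i h]
    ring

/-- The members of a selfdual periodic lattice chain of minuscule position form a selfdual
family. -/
theorem isSelfdualFamily_range {τ : L →+* L} {Φ : N →ₛₗ[τ] N} (hΦ : ∀ x, Φ x = f • x) {r : ℕ}
    {m : ℕ} {I : Set (ZMod m)} (hI : IsSymmetricType I) {M : typeIndex I → Submodule OL N}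
    (hM : M ∈ selfdualMinusculeChains OL (algebraMap OL L ϖ) Φ B r I) :
    IsSelfdualFamily f B (Set.range M) := by
  obtain ⟨hc, ⟨d, hd⟩, hpos⟩ := hM
  have hle : ∀ i j, i ≤ j → M i ≤ M j := fun i j hij =>
    hij.eq_or_lt.elim (fun h => by rw [h]) (hc.le i j)
  refine ⟨?_, ?_, ?_, ?_⟩
  · rintro _ ⟨i, rfl⟩
    exact (isStableLattice_of_hasMinusculePosition hΦ (hc.isLattice i) (hpos i)).1
  · rintro _ ⟨i, rfl⟩ _ ⟨j, rfl⟩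
    exact (le_total i j).imp (hle i j) (hle j i)
  · rintro _ ⟨i, rfl⟩ k
    refine ⟨⟨i - k * m, ?_⟩, hc.eq_zpow_smul k _ _ rfl⟩
    have := i.2
    simp only [typeIndex, Set.mem_ofPred_eq] at this ⊢
    push_cast
    simpa using this
  · rintro _ ⟨i, rfl⟩
    refine ⟨⟨-i + d * m, ?_⟩, (hd i _ rfl).symm⟩
    have := hI _ i.2
    simp only [typeIndex, Set.mem_ofPred_eq] at this ⊢
    push_cast
    simpa using this

/-- The members of a chain of type `J` are part of a selfdual family with members of all indices,
from which the missing members of a chain of type `I` are taken. -/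
theorem forgetChain_surjective [IsAlgClosed (ResidueField OL)] {q : ℕ}
    (hq : 2 ≤ q) (hf : IsFrobeniusSemilinear q f) (hB : B.Nondegenerate) (hB' : B.IsAlt)
    {m : ℕ} (hm : Module.finrank L N = m) (hpos : 0 < m) {w : ℤ}
    (hw : ∀ M : Submodule OL N,
      B.dualSubmodule (f • M) = uniformizerMul ϖ L N ^ (-w) • f • B.dualSubmodule M)
    {τ : L →+* L} {Φ : N →ₛₗ[τ] N} (hΦ : ∀ x, Φ x = f • x) (r : ℕ) {I J : Set (ZMod m)}
    (hJ : J.Nonempty) (hJs : IsSymmetricType J) (h : J ⊆ I) :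
    Function.Surjective (forgetChain OL (algebraMap OL L ϖ) Φ B r h) := by
  rintro ⟨M, hM⟩
  have hc := hM.1
  obtain ⟨d, hd⟩ := hM.2.1
  obtain ⟨j, hj⟩ := hJ
  obtain ⟨i₀, rfl⟩ := ZMod.intCast_surjective j
  let i₀' : typeIndex J := ⟨i₀, hj⟩
  obtain ⟨S, hMS, hS, hfull⟩ := (isSelfdualFamily_range hΦ hJs hM).exists_full hq hf hB hB'
    (hm ▸ hpos) hw ⟨i₀', rfl⟩
  have hMS' : ∀ i, M i ∈ S := fun i => hMS ⟨i, rfl⟩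
  have hd' : latticeIndex (B.dualSubmodule (M i₀')) (M i₀') = -2 * i₀ + d * m := by
    have hmem : -i₀ + d * m ∈ typeIndex J := by
      have := hJs _ hj
      simp only [typeIndex, Set.mem_ofPred_eq]
      push_cast
      simpa using this
    rw [hd i₀' ⟨_, hmem⟩ rfl, hc.latticeIndex_eq]
    simp only [i₀']
    ring
  obtain ⟨M', hM'S, hM'c, hM'd⟩ := hS.exists_chain hB hB' (hMS' i₀') hfull hm hd' I
  have hr : ∀ A ∈ S, latticeIndex A (f • A) = r := by
    intro A hA
    rw [latticeIndex_smul_eq f (hS.stable A hA).isLattice (hc.isLattice i₀')]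
    exact (isStableLattice_of_hasMinusculePosition hΦ (hc.isLattice i₀') (hM.2.2 i₀')).2
  refine ⟨⟨M', hM'c, hM'd, fun i =>
    (hS.stable _ (hM'S i).1).hasMinusculePosition hΦ (hr _ (hM'S i).1)⟩, ?_⟩
  apply Subtype.ext
  funext j
  have hjI := hM'S ⟨j.1, h j.2⟩
  refine eq_of_total_of_latticeIndex_eq (hM'c.isLattice _) (hc.isLattice j) (hc.isLattice i₀')
    (hS.total _ hjI.1 _ (hMS' j)) ?_
  exact hjI.2.trans (hc.latticeIndex_eq i₀' j).symm

/-! ### Selfdual stable lattices -/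

/-- If there is a stable lattice, there is a selfdual one: a stable lattice `M` with `M ≤ M^⊥`
that is maximal with this property is selfdual, because `M + OL y` has the same property if `y`
spans a stable line in `M^⊥ / M`. -/
theorem exists_selfdual_stableLattice [IsAlgClosed (ResidueField OL)] {q : ℕ}
    (hq : 2 ≤ q) (hf : IsFrobeniusSemilinear q f) (hB : B.Nondegenerate) (hB' : B.IsAlt)
    (hpos : 0 < Module.finrank L N) {w : ℤ}
    (hw : ∀ M : Submodule OL N,
      B.dualSubmodule (f • M) = uniformizerMul ϖ L N ^ (-w) • f • B.dualSubmodule M)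
    {M : Submodule OL N} (hM : IsStableLattice f M) :
    ∃ M', IsStableLattice f M' ∧ B.dualSubmodule M' = M' := by
  obtain ⟨k, hk⟩ := exists_pow_smul_le_of_isLattice (ϖ := ϖ) hM.isLattice.fg
    (dualSubmodule_isLattice hB hM.isLattice)
  let M₁ := uniformizerMul ϖ L N ^ (k : ℤ) • M
  have hM₁ : IsStableLattice f M₁ := hM.zpow_smul k
  have hM₁d : M₁ ≤ B.dualSubmodule M₁ := by
    have h1 : M₁ ≤ B.dualSubmodule M := by simpa [M₁] using hk
    refine h1.trans (dualSubmodule_anti ?_)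
    simpa [M₁] using pow_uniformizerMul_smul_le (ϖ := ϖ) (L := L) k M
  have hD := dualSubmodule_isLattice hB hM₁.isLattice
  have : Module.Finite OL (B.dualSubmodule M₁) := Module.Finite.iff_fg.mpr hD.fg
  let T : Set (Submodule OL (B.dualSubmodule M₁)) :=
    {C | M₁ ≤ C.map (B.dualSubmodule M₁).subtype ∧
      IsStableLattice f (C.map (B.dualSubmodule M₁).subtype) ∧
      C.map (B.dualSubmodule M₁).subtype ≤ B.dualSubmodule (C.map (B.dualSubmodule M₁).subtype)}
  have hmap : ∀ C ≤ B.dualSubmodule M₁,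
      (C.submoduleOf (B.dualSubmodule M₁)).map (B.dualSubmodule M₁).subtype = C := fun C hC => by
    rw [Submodule.submoduleOf, Submodule.map_comap_subtype, inf_eq_right.mpr hC]
  have hT : T.Nonempty := ⟨M₁.submoduleOf _, by
    simp only [T, Set.mem_ofPred_eq, hmap _ hM₁d]
    exact ⟨le_rfl, hM₁, hM₁d⟩⟩
  obtain ⟨C, ⟨hC1, hC2, hC3⟩, hCmax⟩ := set_has_maximal_iff_noetherian.mpr
    (inferInstance : IsNoetherian OL (B.dualSubmodule M₁)) T hT
  refine ⟨_, hC2, ?_⟩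
  generalize hA : C.map (B.dualSubmodule M₁).subtype = A at *
  by_contra hne
  obtain ⟨y, hyD, hyA, -, hst⟩ := exists_stable_line hq hf hC2
    (hC2.dualSubmodule hB hB' hpos hw) (lt_of_le_of_ne hC3 fun h => hne h.symm)
  have hAy : A ≤ A ⊔ Submodule.span OL {y} := le_sup_left
  have hisot : A ⊔ Submodule.span OL {y} ≤ B.dualSubmodule (A ⊔ Submodule.span OL {y}) := by
    have h1 : A ≤ B.dualSubmodule (A ⊔ Submodule.span OL {y}) := by
      rw [le_dualSubmodule_comm hB', sup_le_iff, Submodule.span_singleton_le_iff_mem]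
      exact ⟨hC3, hyD⟩
    rw [sup_le_iff, Submodule.span_singleton_le_iff_mem]
    refine ⟨h1, fun x hx => ?_⟩
    obtain ⟨z, hz, t, ht, rfl⟩ := Submodule.mem_sup.mp hx
    obtain ⟨a, rfl⟩ := Submodule.mem_span_singleton.mp ht
    rw [map_add, LinearMap.map_smul_of_tower, hB' y, smul_zero, add_zero]
    exact hyD z hz
  have hle : A ⊔ Submodule.span OL {y} ≤ B.dualSubmodule M₁ :=
    hisot.trans (dualSubmodule_anti (hC1.trans hAy))
  refine hCmax ((A ⊔ Submodule.span OL {y}).submoduleOf _) ?_ ?_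
  · simp only [T, Set.mem_ofPred_eq, hmap _ hle]
    exact ⟨hC1.trans hAy, hst, hisot⟩
  · refine lt_of_le_of_ne (fun x hx => ?_) fun h => hyA ?_
    · have : (x : N) ∈ A := by rw [← hA]; exact ⟨x, hx, rfl⟩
      exact hAy this
    · rw [← hA, h, hmap _ hle]
      exact Submodule.mem_sup_right (Submodule.mem_span_singleton_self y)

/-- If there is a stable lattice, then there are selfdual chains of all types. -/
theorem selfdualMinusculeChains_nonempty [IsAlgClosed (ResidueField OL)] {q : ℕ}
    (hq : 2 ≤ q) (hf : IsFrobeniusSemilinear q f) (hB : B.Nondegenerate) (hB' : B.IsAlt)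
    {m : ℕ} (hm : Module.finrank L N = m) (hpos : 0 < m) {w : ℤ}
    (hw : ∀ M : Submodule OL N,
      B.dualSubmodule (f • M) = uniformizerMul ϖ L N ^ (-w) • f • B.dualSubmodule M)
    {τ : L →+* L} {Φ : N →ₛₗ[τ] N} (hΦ : ∀ x, Φ x = f • x) {r : ℕ} (I : Set (ZMod m))
    {M : Submodule OL N} (hM : IsStableLattice f M) (hr : latticeIndex M (f • M) = r) :
    (selfdualMinusculeChains OL (algebraMap OL L ϖ) Φ B r I).Nonempty := by
  obtain ⟨M₀, hM₀, hdual⟩ := exists_selfdual_stableLattice hq hf hB hB' (hm ▸ hpos) hw hM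
  have hfam : IsSelfdualFamily f B {A | ∃ k : ℤ, A = uniformizerMul ϖ L N ^ k • M₀} := by
    refine ⟨?_, ?_, ?_, ?_⟩
    · rintro _ ⟨k, rfl⟩
      exact hM₀.zpow_smul k
    · rintro _ ⟨k, rfl⟩ _ ⟨l, rfl⟩
      exact (le_total l k).imp (fun h => zpow_uniformizerMul_smul_anti h M₀)
        (fun h => zpow_uniformizerMul_smul_anti h M₀)
    · rintro _ ⟨k, rfl⟩ l
      exact ⟨l + k, by rw [zpow_add, mul_smul]⟩
    · rintro _ ⟨k, rfl⟩
      exact ⟨-k, by rw [dualSubmodule_zpow_smul, hdual]⟩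
  obtain ⟨S, hMS, hS, hfull⟩ := hfam.exists_full hq hf hB hB' (hm ▸ hpos) hw
    (show M₀ ∈ _ from ⟨0, by simp⟩)
  obtain ⟨M', hM'S, hM'c, hM'd⟩ := hS.exists_chain hB hB' (hMS ⟨0, by simp⟩) hfull hm
    (i₀ := 0) (d := 0) (by rw [hdual, latticeIndex_self]; ring) I
  refine ⟨M', hM'c, hM'd, fun i => (hS.stable _ (hM'S i).1).hasMinusculePosition hΦ ?_⟩
  rw [← hr]
  exact latticeIndex_smul_eq f (hS.stable _ (hM'S i).1).isLattice hM.isLattice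

end Chains

/-! ### The Fitting decomposition of a semilinear operator -/

section Fitting

variable {OL : Type*} [CommRing OL] [IsDomain OL] [IsDiscreteValuationRing OL]
  {ϖ : OL} [hϖ : Fact (Irreducible ϖ)]
  {L N : Type*} [Field L] [Algebra OL L] [IsFractionRing OL L] [AddCommGroup N] [Module L N]
  [Module OL N] [IsScalarTower OL L N]

open SemilinearGroup IsLocalRing

theorem mem_pow_smul_of_le {M : Submodule OL N} {k l : ℕ} (h : k ≤ l) {x : N}
    (hx : x ∈ uniformizerMul ϖ L N ^ l • M) : x ∈ uniformizerMul ϖ L N ^ k • M := by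
  have := zpow_uniformizerMul_smul_anti (ϖ := ϖ) (L := L) (Int.ofNat_le.mpr h) M
  simp only [zpow_natCast] at this
  exact this hx

/-- Finitely generated modules over a complete discrete valuation ring are complete. -/
theorem exists_limit [hc : IsAdicComplete (maximalIdeal OL) OL] {M : Submodule OL N} (hM : M.FG)
    {x : ℕ → N} (hx0 : x 0 ∈ M)
    (hx : ∀ n, x (n + 1) - x n ∈ uniformizerMul ϖ L N ^ n • M) :
    ∃ z ∈ M, ∀ n, z - x n ∈ uniformizerMul ϖ L N ^ n • M := by
  have hmax : ∀ n (a : OL), a ∈ (maximalIdeal OL ^ n • ⊤ : Ideal OL) ↔ ∃ b, a = ϖ ^ n * b := by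
    intro n a
    rw [hϖ.out.maximalIdeal_eq, Ideal.span_singleton_pow, smul_eq_mul, Ideal.mul_top,
      Ideal.mem_span_singleton]
    rfl
  obtain ⟨s, rfl⟩ := hM
  choose y hy hxy using fun n => mem_pow_uniformizerMul_smul.mp (hx n)
  have hspan : ∀ y ∈ Submodule.span OL (s : Set N), ∃ a : s → OL, y = ∑ i, a i • (i : N) := by
    intro y hy
    have : (s : Set N) = id '' (s : Set N) := by simp
    rw [this] at hy
    obtain ⟨a, ha⟩ := (Submodule.mem_span_image_finset_iff_exists_fun OL).mp hy
    exact ⟨a, ha.symm⟩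
  choose a ha using fun n => hspan (y n) (hy n)
  have hlim : ∀ i : s, ∃ A : OL, ∀ n, ∃ b, A - ∑ j ∈ Finset.range n, ϖ ^ j * a j i = ϖ ^ n * b := by
    intro i
    obtain ⟨A, hA⟩ := hc.toIsPrecomplete.prec' (fun n => ∑ j ∈ Finset.range n, ϖ ^ j * a j i) (by
      intro m n hmn
      rw [SModEq.comm, SModEq.sub_mem, hmax, ← Finset.sum_range_add_sum_Ico _ hmn,
          add_sub_cancel_left]
      refine ⟨∑ j ∈ Finset.Ico m n, ϖ ^ (j - m) * a j i, ?_⟩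
      rw [Finset.mul_sum]
      refine Finset.sum_congr rfl fun j hj => ?_
      rw [← mul_assoc, ← pow_add, Nat.add_sub_cancel' (Finset.mem_Ico.mp hj).1])
    refine ⟨A, fun n => ?_⟩
    have := hA n
    rwa [SModEq.comm, SModEq.sub_mem, hmax] at this
  choose A hA using hlim
  choose b hb using hA
  have hxn : ∀ n, x n = x 0 + ∑ i : s, (∑ j ∈ Finset.range n, ϖ ^ j * a j i) • (i : N) := by
    intro n
    induction n with
    | zero => simp
    | succ n ih =>
      have h1 : x (n + 1) = x n + ϖ ^ n • y n := by rw [← hxy]; abel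
      rw [h1, ih, ha n, Finset.smul_sum, add_assoc, ← Finset.sum_add_distrib]
      congr 1
      refine Finset.sum_congr rfl fun i _ => ?_
      rw [Finset.sum_range_succ, add_smul, mul_smul]
  refine ⟨x 0 + ∑ i : s, A i • (i : N), add_mem hx0 (sum_mem fun i _ =>
    Submodule.smul_mem _ _ (Submodule.subset_span i.2)), fun n => ?_⟩
  rw [mem_pow_uniformizerMul_smul]
  refine ⟨∑ i : s, b i n • (i : N), sum_mem fun i _ =>
    Submodule.smul_mem _ _ (Submodule.subset_span i.2), ?_⟩
  rw [hxn n, add_sub_add_left_eq_sub, ← Finset.sum_sub_distrib, Finset.smul_sum]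
  refine Finset.sum_congr rfl fun i _ => ?_
  rw [← sub_smul, hb, mul_smul]

theorem relLength_pow_smul_ne_top {M : Submodule OL N} (hM : M.FG) (k : ℕ) :
    relLength M (uniformizerMul ϖ L N ^ k • M) ≠ ⊤ := by
  have : Module.IsTorsionFree OL N := Module.IsTorsionFree.trans_faithfulSMul OL L N
  have : Module.Finite OL M := Module.Finite.iff_fg.mpr hM
  have : Module.Free OL M := inferInstance
  let b := Module.Free.chooseBasis OL M
  have hb : LinearIndependent OL (fun i => (b i : N)) :=
    b.linearIndependent.map' M.subtype (Submodule.ker_subtype M)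
  have hspan : M = Submodule.span OL (Set.range fun i => (b i : N)) := by
    have : Set.range (fun i => (b i : N)) = M.subtype '' Set.range b := by
      rw [← Set.range_comp]
      rfl
    rw [this, ← Submodule.map_span, b.span_eq, Submodule.map_top, Submodule.range_subtype]
  have := relLength_span_pow_smul (ϖ := ϖ) hb fun _ => k
  have hsmul : uniformizerMul ϖ L N ^ k • Submodule.span OL (Set.range fun i => (b i : N)) =
      Submodule.span OL (Set.range fun i => ϖ ^ k • (b i : N)) := by
    rw [smul_span, ← Set.range_comp]
    congr 2
    exact funext fun i => pow_uniformizerMul_smul k _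
  rw [hspan, hsmul, this]
  exact ENat.natCast_ne_top _

theorem pow_smul_anti {ψ : SemilinearGroup ϖ L N} {M : Submodule OL N} (h : ψ • M ≤ M) {k l : ℕ}
    (hkl : k ≤ l) : ψ ^ l • M ≤ ψ ^ k • M := by
  induction l, hkl using Nat.le_induction with
  | base => exact le_rfl
  | succ l _ ih =>
    rw [pow_succ, mul_smul]
    exact (smul_mono _ h).trans ih

/-- Chevalley's theorem for the descending chain `ψ ^ k M`. The sums `ψ ^ k M + ϖ ^ i M` become
stationary in `k`, and an element of all of them is approximated by a limit in `⋂ ψ ^ k M`. -/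
theorem exists_pow_smul_le_iInf_sup [IsAdicComplete (maximalIdeal OL) OL]
    {M : Submodule OL N} (hM : M.FG) {ψ : SemilinearGroup ϖ L N} (hψ : ψ • M ≤ M)
    (hspan : ∀ k : ℕ, (M : Set N) ⊆ Submodule.span L ((ψ ^ k • M : Submodule OL N) : Set N))
    (i : ℕ) :
    ∃ k : ℕ, ψ ^ k • M ≤ (⨅ j : ℕ, ψ ^ j • M) ⊔ uniformizerMul ϖ L N ^ i • M := by
  have hstab : ∀ i : ℕ, ∃ k : ℕ, ∀ l ≥ k, ψ ^ l • M ⊔ uniformizerMul ϖ L N ^ i • M =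
      ψ ^ k • M ⊔ uniformizerMul ϖ L N ^ i • M := by
    intro i
    have hle : uniformizerMul ϖ L N ^ i • M ≤ M := pow_uniformizerMul_smul_le i M
    have hfl := Module.length_ne_top_iff.mp (relLength_pow_smul_ne_top (ϖ := ϖ) (L := L) hM i)
    have hart := (isFiniteLength_iff_isNoetherian_isArtinian.mp hfl).2
    have hψk : ∀ k : ℕ, ψ ^ k • M ≤ M := fun k => by
      simpa using pow_smul_anti hψ (Nat.zero_le k)
    let X : ℕ →o (Submodule OL (M ⧸ (uniformizerMul ϖ L N ^ i • M).submoduleOf M))ᵒᵈ :=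
      ⟨fun k => OrderDual.toDual ((quotientSubmoduleOrderIso hle).symm
        ⟨ψ ^ k • M ⊔ uniformizerMul ϖ L N ^ i • M, le_sup_right, sup_le (hψk k) hle⟩), by
        intro k l hkl
        refine OrderDual.toDual_le_toDual.mpr ((quotientSubmoduleOrderIso hle).symm.monotone ?_)
        exact sup_le_sup_right (pow_smul_anti hψ hkl) _⟩
    obtain ⟨k, hk⟩ := IsArtinian.monotone_stabilizes X
    refine ⟨k, fun l hl => ?_⟩
    have := (quotientSubmoduleOrderIso hle).symm.injective (OrderDual.toDual.injective (hk l hl))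
    exact (congrArg Subtype.val this).symm
  choose k hk using hstab
  refine ⟨k i, fun x hx => ?_⟩
  -- the stationary values
  let I : ℕ → Submodule OL N := fun n => ψ ^ k n • M ⊔ uniformizerMul ϖ L N ^ n • M
  have hI : ∀ n l, I n ≤ ψ ^ l • M ⊔ uniformizerMul ϖ L N ^ n • M := by
    intro n l
    rcases le_total l (k n) with h | h
    · exact sup_le_sup_right (pow_smul_anti hψ h) _
    · exact (hk n l h).ge
  have hnext : ∀ n, ∀ y ∈ I n, ∃ y' ∈ I (n + 1), y' - y ∈ uniformizerMul ϖ L N ^ n • M := by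
    intro n y hy
    obtain ⟨u, hu, v, hv, rfl⟩ := Submodule.mem_sup.mp (hI n (k (n + 1)) hy)
    exact ⟨u, Submodule.mem_sup_left hu, by simpa using hv⟩
  choose! F hF1 hF2 using hnext
  let y : ℕ → N := fun n => Nat.rec x (fun n y => F (i + n) y) n
  have hys : ∀ n, y (n + 1) = F (i + n) (y n) := fun n => rfl
  have hyI : ∀ n, y n ∈ I (i + n) := by
    intro n
    induction n with
    | zero => exact Submodule.mem_sup_left hx
    | succ n ih => exact hF1 _ _ ih
  have hM' : (uniformizerMul ϖ L N ^ i • M).FG := smul_fg _ hM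
  obtain ⟨z, hz, hzlim⟩ := exists_limit (ϖ := ϖ) (L := L) hM' (x := fun n => y n - x)
    (by simp [y]) (fun n => by
      rw [sub_sub_sub_cancel_right, hys, ← mul_smul, ← pow_add, add_comm n i]
      exact hF2 _ _ (hyI n))
  have hzmem : z + x ∈ ⨅ j : ℕ, ψ ^ j • M := by
    rw [Submodule.mem_iInf]
    intro j
    obtain ⟨e, he⟩ := exists_pow_smul_le (ϖ := ϖ) hM (hspan j)
    have h1 : z + x - y e ∈ uniformizerMul ϖ L N ^ e • M := by
      have := hzlim e
      rw [← mul_smul, ← pow_add] at this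
      rw [show z + x - y e = z - (y e - x) by abel]
      exact mem_pow_smul_of_le (by omega) this
    have hie : uniformizerMul ϖ L N ^ (i + e) • M ≤ uniformizerMul ϖ L N ^ e • M :=
      fun w hw => mem_pow_smul_of_le (by omega) hw
    have h2 : y e ∈ ψ ^ j • M ⊔ uniformizerMul ϖ L N ^ e • M :=
      sup_le_sup_left hie _ (hI (i + e) j (hyI e))
    rw [sup_eq_left.mpr he] at h2
    rw [show z + x = (z + x - y e) + y e by abel]
    exact add_mem (he h1) h2
  rw [show x = (z + x) - z by abel]
  exact sub_mem (Submodule.mem_sup_left hzmem) (Submodule.mem_sup_right hz)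

variable [FiniteDimensional L N]

/-- Over `L`, stability of a subspace under `g` implies stability under `g⁻¹`. -/
theorem inv_smul_mem_of_forall_smul_mem {g : SemilinearGroup ϖ L N} {U : Submodule L N}
    (h : ∀ x ∈ U, g • x ∈ U) : ∀ x ∈ U, g⁻¹ • x ∈ U := by
  -- the images of `U` under the powers of `g` form a descending chain of subspaces
  let X : ℕ →o (Submodule L N)ᵒᵈ :=
    ⟨fun k => OrderDual.toDual
      { carrier := {x | (g ^ k)⁻¹ • x ∈ U}
        add_mem' := fun {x y} hx hy => by
          simp only [Set.mem_ofPred_eq, smul_add] at *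
          exact add_mem hx hy
        zero_mem' := by simp
        smul_mem' := fun c x hx => by
          obtain ⟨τ, -, -, hτ⟩ := exists_ringEquiv (g ^ k)⁻¹
          simp only [Set.mem_ofPred_eq, hτ] at *
          exact U.smul_mem _ hx }, by
      refine monotone_nat_of_le_succ fun k => OrderDual.toDual_le_toDual.mpr fun x hx => ?_
      have := h _ hx
      rwa [pow_succ, mul_inv_rev, mul_smul, smul_inv_smul] at this⟩
  obtain ⟨k, hk⟩ := IsArtinian.monotone_stabilizes X
  intro x hx
  have h1 : g ^ k • x ∈ OrderDual.ofDual (X k) := by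
    change (g ^ k)⁻¹ • g ^ k • x ∈ U
    rwa [inv_smul_smul]
  rw [hk (k + 1) (Nat.le_succ k)] at h1
  change (g ^ (k + 1))⁻¹ • g ^ k • x ∈ U at h1
  rwa [pow_succ, mul_inv_rev, mul_smul, inv_smul_smul] at h1

/-- The Fitting decomposition of the span of `M` with respect to `ψ`: the sum of a subspace with a
lattice `K = ψ K` and a subspace on which `ψ` is topologically nilpotent. -/
theorem exists_fitting [IsAdicComplete (maximalIdeal OL) OL]
    {M : Submodule OL N} (hM : M.FG) {ψ : SemilinearGroup ϖ L N} (hψ : ψ • M ≤ M)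
    {U : Submodule L N} (hU : Submodule.span L (M : Set N) = U) {f : SemilinearGroup ϖ L N}
    (hf : ∀ x ∈ U, f • x ∈ U) (hψU : ∀ x ∈ U, ψ • x ∈ U) (hcomm : Commute ψ f)
    {y : N} (hy : y ∈ M) {i₀ : ℕ} (hyψ : ∀ k : ℕ, ψ ^ k • y ∉ uniformizerMul ϖ L N ^ i₀ • M) :
    ∃ W U' : Submodule L N, W ≠ ⊥ ∧ Disjoint W U' ∧ W ⊔ U' = U ∧ (∀ x ∈ W, f • x ∈ W) ∧
      (∀ x ∈ U', f • x ∈ U') ∧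
      ∃ K : Submodule OL N, K.FG ∧ Submodule.span L (K : Set N) = W ∧ ψ • K = K := by
  have hψkU : ∀ k : ℕ, ∀ x ∈ U, (ψ ^ k)⁻¹ • x ∈ U := by
    intro k
    refine inv_smul_mem_of_forall_smul_mem ?_
    induction k with
    | zero => simp
    | succ k ih => intro x hx; rw [pow_succ, mul_smul]; exact ih _ (hψU x hx)
  have hMU : ∀ x ∈ M, x ∈ U := fun x hx => hU ▸ Submodule.subset_span hx
  have hspan : ∀ k : ℕ, (M : Set N) ⊆ Submodule.span L ((ψ ^ k • M : Submodule OL N) : Set N) := by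
    intro k x hx
    have h1 := hψkU k x (hMU x hx)
    rw [← hU] at h1
    have h2 := smul_mem_span (ψ ^ k) h1
    rwa [smul_inv_smul, ← coe_smul] at h2
  have hchev := exists_pow_smul_le_iInf_sup (ϖ := ϖ) hM hψ hspan
  set K : Submodule OL N := ⨅ j : ℕ, ψ ^ j • M with hK
  have hKM : K ≤ M := (iInf_le _ 0).trans (by simp)
  have : Module.Finite OL M := Module.Finite.iff_fg.mpr hM
  have hfg : ∀ Z ≤ M, Z.FG := fun Z hZ => by
    have : IsNoetherian OL Z := isNoetherian_of_le hZ
    exact Module.Finite.iff_fg.mp inferInstance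
  have hψM : ∀ k : ℕ, ∀ x ∈ M, ψ ^ k • x ∈ M := fun k x hx => by
    have := pow_smul_anti hψ (Nat.zero_le k)
    rw [pow_zero, one_smul, smul_le_iff_forall] at this
    exact this x hx
  have hψK : ψ • K = K := by
    apply le_antisymm
    · rw [hK, le_iInf_iff]
      intro j
      rw [smul_le_iff_forall]
      intro x hx
      have h1 : ψ • x ∈ ψ • ψ ^ j • M := smul_mem_smul.mpr ((Submodule.mem_iInf _).mp hx j)
      rw [← mul_smul, ← pow_succ'] at h1
      exact pow_smul_anti hψ (Nat.le_succ j) h1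
    · intro x hx
      rw [mem_smul, hK, Submodule.mem_iInf]
      intro j
      have h1 := (Submodule.mem_iInf _).mp hx (j + 1)
      rwa [pow_succ', mul_smul, mem_smul] at h1
  have hψkK : ∀ k : ℕ, ψ ^ k • K = K := fun k => by
    induction k with
    | zero => simp
    | succ k ih => rw [pow_succ, mul_smul, hψK, ih]
  let W := Submodule.span L (K : Set N)
  -- the Artin-Rees constant
  obtain ⟨e, he⟩ : ∃ e : ℕ, ∀ i : ℕ, ∀ x ∈ K, x ∈ uniformizerMul ϖ L N ^ (i + e) • M →
      x ∈ uniformizerMul ϖ L N ^ i • K := by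
    obtain ⟨e, he⟩ := exists_pow_smul_le (ϖ := ϖ) (K := M ⊓ W.restrictScalars OL) (M := K)
      (hfg _ inf_le_left) (fun x hx => hx.2)
    refine ⟨e, fun i x hx hxM => ?_⟩
    obtain ⟨z, hz, rfl⟩ := mem_pow_uniformizerMul_smul.mp hxM
    rw [← pow_uniformizerMul_smul (L := L), pow_add, mul_smul, smul_mem_smul]
    refine he (smul_mem_smul.mpr ⟨hz, ?_⟩)
    have h1 : (algebraMap OL L ϖ ^ (i + e))⁻¹ • ϖ ^ (i + e) • z ∈ W :=
      W.smul_mem _ (Submodule.subset_span hx)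
    rwa [← algebraMap_smul L (ϖ ^ (i + e)) z, map_pow,
      inv_smul_smul₀ (pow_ne_zero _ (algebraMap_uniformizer_ne_zero (ϖ := ϖ) L))] at h1
  -- a power of `ϖ` that makes `f` integral on `M`
  obtain ⟨c, hcf⟩ : ∃ c : ℕ, uniformizerMul ϖ L N ^ c • f • M ≤ M := by
    refine exists_pow_smul_le (smul_fg f hM) ?_
    rw [coe_smul, hU]
    rintro _ ⟨x, hx, rfl⟩
    exact hf x (hMU x hx)
  have hcf' : ∀ (i : ℕ) (x : N), x ∈ uniformizerMul ϖ L N ^ (i + c) • M →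
      f • x ∈ uniformizerMul ϖ L N ^ i • M := by
    intro i x hx
    obtain ⟨z, hz, rfl⟩ := mem_pow_uniformizerMul_smul.mp hx
    rw [← pow_uniformizerMul_smul (L := L), pow_add, ← zpow_natCast _ i, ← zpow_natCast _ c,
      mul_smul, smul_zpow_uniformizerMul_smul, smul_zpow_uniformizerMul_smul, smul_mem_smul,
      zpow_natCast]
    exact hcf (smul_mem_smul.mpr (smul_mem_smul.mpr hz))
  have hsmul_mem : ∀ (g : SemilinearGroup ϖ L N) (i : ℕ) (x : N), (∀ z ∈ M, g • z ∈ M) →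
      x ∈ uniformizerMul ϖ L N ^ i • M → g • x ∈ uniformizerMul ϖ L N ^ i • M := by
    intro g i x hg hx
    rw [← smul_inv_smul (uniformizerMul ϖ L N ^ i) x, ← zpow_natCast,
      smul_zpow_uniformizerMul_smul, smul_mem_smul, zpow_natCast]
    exact hg _ hx
  -- the subspace on which `ψ` is topologically nilpotent
  let U' : Submodule L N :=
    { carrier := {x | x ∈ U ∧ ∀ i : ℕ, ∃ k : ℕ, ψ ^ k • x ∈ uniformizerMul ϖ L N ^ i • M}
      add_mem' := by
        rintro x y ⟨hx, hx'⟩ ⟨hy, hy'⟩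
        refine ⟨add_mem hx hy, fun i => ?_⟩
        obtain ⟨k, hk⟩ := hx' i
        obtain ⟨l, hl⟩ := hy' i
        refine ⟨k + l, ?_⟩
        rw [smul_add]
        refine add_mem ?_ ?_
        · rw [add_comm k l, pow_add, mul_smul]
          exact hsmul_mem _ i _ (hψM l) hk
        · rw [pow_add, mul_smul]
          exact hsmul_mem _ i _ (hψM k) hl
      zero_mem' := ⟨zero_mem _, fun i => ⟨0, by simp⟩⟩
      smul_mem' := by
        rintro a x ⟨hx, hx'⟩
        refine ⟨U.smul_mem a hx, fun i => ?_⟩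
        rcases eq_or_ne a 0 with rfl | ha
        · exact ⟨0, by simp⟩
        obtain ⟨m, u, rfl⟩ := exists_eq_zpow_mul (ϖ := ϖ) ha
        obtain ⟨k, hk⟩ := hx' (i + m.natAbs)
        refine ⟨k, ?_⟩
        rw [mul_smul, ← zpow_uniformizerMul_smul, smul_zpow_uniformizerMul_smul, algebraMap_smul]
        obtain ⟨b, hb⟩ := exists_integral_smul (ψ ^ k) (u : OL)
        rw [hb]
        have h1 := zpow_uniformizerMul_smul_anti (ϖ := ϖ) (L := L)
          (show -m + i ≤ ((i + m.natAbs : ℕ) : ℤ) by omega) M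
        rw [zpow_natCast] at h1
        have h2 := smul_mem_smul (g := uniformizerMul ϖ L N ^ m).mpr
          (Submodule.smul_mem _ b (h1 hk))
        rwa [← mul_smul, ← zpow_add, ← add_assoc, add_neg_cancel, zero_add, zpow_natCast] at h2 }
  have hKU : K ≤ U.restrictScalars OL := fun x hx => hMU x (hKM hx)
  have hWU : W ≤ U := Submodule.span_le.mpr hKU
  have hM_le : ∀ x ∈ M, x ∈ W ⊔ U' := by
    intro x hx
    have happrox : ∀ i : ℕ, ∃ (k : ℕ) (y : N), y ∈ K ∧
        ψ ^ k • (x - y) ∈ uniformizerMul ϖ L N ^ (i + e) • M := by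
      intro i
      obtain ⟨k, hk⟩ := hchev (i + e)
      obtain ⟨m, hm, z, hz, hmz⟩ := Submodule.mem_sup.mp (hk (smul_mem_smul.mpr hx))
      refine ⟨k, (ψ ^ k)⁻¹ • m, ?_, ?_⟩
      · rwa [← mem_smul, hψkK]
      · rw [smul_sub, smul_inv_smul, ← hmz, add_sub_cancel_left]
        exact hz
    choose k y hyK hy using happrox
    obtain ⟨z, hzK, hz⟩ := exists_limit (ϖ := ϖ) (L := L) (hfg K hKM) (hyK 0) (fun i => by
      have h1 : ψ ^ (k i + k (i + 1)) • (y (i + 1) - y i) ∈ uniformizerMul ϖ L N ^ (i + e) • M := by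
        rw [show y (i + 1) - y i = (x - y i) - (x - y (i + 1)) by abel, smul_sub]
        refine sub_mem ?_ ?_
        · rw [add_comm (k i), pow_add ψ, mul_smul]
          exact hsmul_mem _ _ _ (hψM _) (hy i)
        · rw [pow_add ψ, mul_smul]
          exact hsmul_mem _ _ _ (hψM _) (mem_pow_smul_of_le (by omega) (hy (i + 1)))
      have h2 := he i _ (by
        rw [← hψkK (k i + k (i + 1)), smul_mem_smul]
        exact sub_mem (hyK _) (hyK _)) h1
      rw [← hψkK (k i + k (i + 1)), ← zpow_natCast (uniformizerMul ϖ L N) i,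
        ← smul_zpow_uniformizerMul_smul, smul_mem_smul, zpow_natCast] at h2
      exact h2)
    rw [show x = z + (x - z) by abel]
    refine add_mem (Submodule.mem_sup_left (Submodule.subset_span hzK))
      (Submodule.mem_sup_right ⟨sub_mem (hMU x hx) (hMU z (hKM hzK)), fun i => ⟨k i, ?_⟩⟩)
    rw [show x - z = (x - y i) - (z - y i) by abel, smul_sub]
    exact sub_mem (mem_pow_smul_of_le (by omega) (hy i))
      (hsmul_mem _ _ _ (hψM _) (smul_mono _ hKM (hz i)))
  have hdisj : ∀ x ∈ K, x ∈ U' → x = 0 := by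
    intro x hx hxU
    refine eq_zero_of_forall_mem_pow_smul (ϖ := ϖ) (L := L) (hfg K hKM) fun i => ?_
    obtain ⟨k, hk⟩ := hxU.2 (i + e)
    have h2 := he i _ (by rw [← hψkK k, smul_mem_smul]; exact hx) hk
    rwa [← hψkK k, ← zpow_natCast (uniformizerMul ϖ L N) i, ← smul_zpow_uniformizerMul_smul,
      smul_mem_smul, zpow_natCast] at h2
  have hcommk : ∀ (k : ℕ) (x : N), ψ ^ k • f • x = f • ψ ^ k • x := fun k x => by
    rw [smul_smul, smul_smul, (hcomm.pow_left k).eq]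
  refine ⟨W, U', ?_, ?_, ?_, ?_, ?_, K, hfg K hKM, rfl, hψK⟩
  · intro hW
    have hKbot : K = ⊥ := by
      rw [eq_bot_iff]
      intro x hx
      have : x ∈ W := Submodule.subset_span hx
      rwa [hW, Submodule.mem_bot] at this
    obtain ⟨k, hk⟩ := hchev i₀
    rw [hKbot, bot_sup_eq] at hk
    exact hyψ k (hk (smul_mem_smul.mpr hy))
  · rw [Submodule.disjoint_def]
    intro x hxW hxU
    obtain ⟨k, hk⟩ := exists_pow_smul_mem_of_mem_span (ϖ := ϖ) hxW
    have h1 : uniformizerMul ϖ L N ^ k • x ∈ U' := by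
      rw [← zpow_natCast, zpow_uniformizerMul_smul]
      exact U'.smul_mem _ hxU
    have h2 := hdisj _ hk h1
    rwa [smul_eq_zero_iff_eq] at h2
  · refine le_antisymm (sup_le hWU fun x hx => hx.1) ?_
    rw [← hU, Submodule.span_le]
    exact hM_le
  · intro x hx
    have h1 : f • x ∈ Submodule.span L ((f • ·) '' (K : Set N)) := smul_mem_span f hx
    refine Submodule.span_le.mpr ?_ h1
    rintro _ ⟨z, hz, rfl⟩
    have h2 : uniformizerMul ϖ L N ^ c • f • z ∈ K := by
      rw [hK, Submodule.mem_iInf]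
      intro j
      have h3 := (Submodule.mem_iInf _).mp hz j
      rw [mem_smul, smul_smul, smul_smul, ((uniformizerMul_comm (ψ ^ j)⁻¹).pow_left c).symm.eq,
        mul_assoc, (hcomm.pow_left j).inv_left.eq, ← mul_assoc, mul_smul, mul_smul]
      exact hcf (smul_mem_smul.mpr (smul_mem_smul.mpr h3))
    have h4 : (algebraMap OL L ϖ ^ (c : ℤ))⁻¹ • uniformizerMul ϖ L N ^ c • f • z ∈ W :=
      W.smul_mem _ (Submodule.subset_span h2)
    rwa [← zpow_neg, ← zpow_uniformizerMul_smul, zpow_neg, zpow_natCast, inv_smul_smul] at h4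
  · rintro x ⟨hx, hx'⟩
    refine ⟨hf x hx, fun i => ?_⟩
    obtain ⟨k, hk⟩ := hx' (i + c)
    exact ⟨k, by rw [hcommk]; exact hcf' i _ hk⟩

end Fitting

/-! ### The smallest slope of a cyclic isocrystal -/

section OrderBound

variable {OL : Type*} [CommRing OL] [IsDomain OL] [IsDiscreteValuationRing OL]
  {ϖ : OL} [hϖ : Fact (Irreducible ϖ)] {L : Type*} [Field L] [Algebra OL L] [IsFractionRing OL L]

/-- The valuation of `c` is at least the rational number `u / t` (where `t > 0`); this includes
`c = 0`. -/
def HasOrderGe (ϖ : OL) {L : Type*} [Field L] [Algebra OL L] (t : ℕ) (u : ℤ) (c : L) : Prop :=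
  ∃ (k : ℤ) (o : OL), u ≤ t * k ∧ c = algebraMap OL L ϖ ^ k * algebraMap OL L o

namespace HasOrderGe

variable {t : ℕ} {u u' : ℤ} {c c' : L}

theorem zero (ht : 0 < t) (u : ℤ) : HasOrderGe ϖ t u (0 : L) :=
  ⟨|u|, 0, by
    have : (1 : ℤ) ≤ t := by exact_mod_cast ht
    nlinarith [le_abs_self u, abs_nonneg u], by simp⟩

theorem mono (h : HasOrderGe ϖ t u c) (hu : u' ≤ u) : HasOrderGe ϖ t u' c := by
  obtain ⟨k, o, h1, h2⟩ := h
  exact ⟨k, o, hu.trans h1, h2⟩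

theorem add (h : HasOrderGe ϖ t u c) (h' : HasOrderGe ϖ t u c') : HasOrderGe ϖ t u (c + c') := by
  have h0 := algebraMap_uniformizer_ne_zero (ϖ := ϖ) L
  have key : ∀ (k l : ℤ) (o o' : OL), k ≤ l → u ≤ t * k → HasOrderGe ϖ t u
      (algebraMap OL L ϖ ^ k * algebraMap OL L o + algebraMap OL L ϖ ^ l * algebraMap OL L o') := by
    intro k l o o' hkl hk
    obtain ⟨n, rfl⟩ := Int.le.dest hkl
    refine ⟨k, o + ϖ ^ n * o', hk, ?_⟩
    rw [zpow_add₀ h0, zpow_natCast, map_add, map_mul, map_pow]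
    ring
  obtain ⟨k, o, h1, rfl⟩ := h
  obtain ⟨l, o', h2, rfl⟩ := h'
  rcases le_total k l with hkl | hkl
  · exact key k l o o' hkl h1
  · rw [add_comm]
    exact key l k o' o hkl h2

theorem mul (h : HasOrderGe ϖ t u c) (h' : HasOrderGe ϖ t u' c') :
    HasOrderGe ϖ t (u + u') (c * c') := by
  have h0 := algebraMap_uniformizer_ne_zero (ϖ := ϖ) L
  obtain ⟨k, o, h1, rfl⟩ := h
  obtain ⟨l, o', h2, rfl⟩ := h'
  refine ⟨k + l, o * o', by rw [mul_add]; exact add_le_add h1 h2, ?_⟩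
  rw [zpow_add₀ h0, map_mul]
  ring

theorem neg (h : HasOrderGe ϖ t u c) : HasOrderGe ϖ t u (-c) := by
  obtain ⟨k, o, h1, rfl⟩ := h
  exact ⟨k, -o, h1, by rw [map_neg, mul_neg]⟩

theorem zpow_mul (k : ℤ) (h : HasOrderGe ϖ t u c) :
    HasOrderGe ϖ t (u + t * k) (algebraMap OL L ϖ ^ k * c) := by
  have : HasOrderGe ϖ t (t * k) (algebraMap OL L ϖ ^ k) := ⟨k, 1, le_rfl, by simp⟩
  rw [add_comm]
  exact this.mul h

theorem unit (v : OLˣ) : HasOrderGe ϖ t 0 (algebraMap OL L v) := ⟨0, v, by simp, by simp⟩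

theorem of_mul (k : ℤ) (v : OLˣ)
    (h : HasOrderGe ϖ t u (c * (algebraMap OL L ϖ ^ k * algebraMap OL L v))) :
    HasOrderGe ϖ t (u - t * k) c := by
  have h0 := algebraMap_uniformizer_ne_zero (ϖ := ϖ) L
  have hv : algebraMap OL L v * algebraMap OL L ((v⁻¹ : OLˣ) : OL) = 1 := by
    rw [← map_mul]
    simp
  have := (zpow_mul (-k) h).mul (unit v⁻¹)
  rw [add_zero, mul_neg, ← sub_eq_add_neg] at this
  convert this using 1
  rw [zpow_neg]
  field_simp
  linear_combination -c * hv

theorem map {τ : L ≃+* L} (h1 : τ (algebraMap OL L ϖ) = algebraMap OL L ϖ)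
    (h2 : ∀ x, τ x ∈ (1 : Submodule OL L) ↔ x ∈ (1 : Submodule OL L)) (h : HasOrderGe ϖ t u c) :
    HasOrderGe ϖ t u (τ c) := by
  obtain ⟨k, o, hk, rfl⟩ := h
  obtain ⟨o', ho'⟩ := Submodule.mem_one.mp
    ((h2 (algebraMap OL L o)).mpr (Submodule.mem_one.mpr ⟨o, rfl⟩))
  exact ⟨k, o', hk, by rw [map_mul, map_zpow₀, h1, ho']⟩

theorem integral_smul (a : OL) (h : HasOrderGe ϖ t u c) :
    HasOrderGe ϖ t u (algebraMap OL L a * c) := by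
  have : HasOrderGe ϖ t 0 (algebraMap OL L a) := ⟨0, a, by simp, by simp⟩
  simpa using this.mul h

end HasOrderGe

/-- The Newton polygon of the polynomial `X ^ m - ∑ b j X ^ j`: its smallest slope is `a / t`, and
`j₀` is the first breakpoint. -/
theorem exists_min_slope (m : ℕ) (hm : 0 < m) (b : ℕ → L) (hb : b 0 ≠ 0) :
    ∃ (j₀ t : ℕ) (a : ℤ), j₀ + t = m ∧ 0 < t ∧
      (∀ j < m, HasOrderGe ϖ t ((m - j) * a) (b j)) ∧
      (∀ j < j₀, HasOrderGe ϖ t ((m - j) * a + 1) (b j)) ∧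
      ∃ u : OLˣ, b j₀ = algebraMap OL L ϖ ^ a * algebraMap OL L u := by
  classical
  have hex : ∀ j, ∃ k : ℤ, b j ≠ 0 →
      ∃ u : OLˣ, b j = algebraMap OL L ϖ ^ k * algebraMap OL L u := by
    intro j
    by_cases h : b j = 0
    · exact ⟨0, fun h' => absurd h h'⟩
    · obtain ⟨k, hk⟩ := exists_eq_zpow_mul (ϖ := ϖ) h
      exact ⟨k, fun _ => hk⟩
  choose k hk using hex
  let s := (Finset.range m).filter fun j => b j ≠ 0
  let q : ℕ → ℚ := fun j => (k j : ℚ) / ((m : ℚ) - j)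
  obtain ⟨j₁, hj₁, hmin⟩ := s.exists_min_image q ⟨0, by simp [s, hb, hm]⟩
  let s' := s.filter fun j => q j = q j₁
  have hs' : s'.Nonempty := ⟨j₁, by simp [s', hj₁]⟩
  let j₀ := s'.min' hs'
  have hj₀ : j₀ ∈ s' := s'.min'_mem hs'
  obtain ⟨hj₀s, hqj₀⟩ := Finset.mem_filter.mp hj₀
  obtain ⟨hj₀m, hbj₀⟩ := Finset.mem_filter.mp hj₀s
  rw [Finset.mem_range] at hj₀m
  have hpos : ∀ j < m, (0 : ℚ) < (m : ℚ) - j := fun j hj => by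
    have : (j : ℚ) < m := by exact_mod_cast hj
    linarith
  have ht : ((m - j₀ : ℕ) : ℤ) = (m : ℤ) - j₀ := by omega
  refine ⟨j₀, m - j₀, k j₀, by omega, by omega, fun j hj => ?_, fun j hj => ?_, hk j₀ hbj₀⟩
  · by_cases hbj : b j = 0
    · rw [hbj]; exact HasOrderGe.zero (by omega) _
    obtain ⟨u, hu⟩ := hk j hbj
    refine ⟨k j, u, ?_, hu⟩
    have h1 := hmin j (by simp [s, hj, hbj])
    rw [← hqj₀, div_le_div_iff₀ (hpos j₀ hj₀m) (hpos j hj)] at h1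
    rw [ht]
    have h2 : k j₀ * ((m : ℤ) - j) ≤ k j * ((m : ℤ) - j₀) := by exact_mod_cast h1
    linarith
  · have hjm : j < m := hj.trans hj₀m
    by_cases hbj : b j = 0
    · rw [hbj]; exact HasOrderGe.zero (by omega) _
    obtain ⟨u, hu⟩ := hk j hbj
    refine ⟨k j, u, ?_, hu⟩
    have hjs : j ∈ s := by simp [s, hjm, hbj]
    have h1 : q j₀ < q j := by
      rw [hqj₀]
      refine lt_of_le_of_ne (hmin j hjs) fun h => ?_
      have := s'.min'_le j (Finset.mem_filter.mpr ⟨hjs, h.symm⟩)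
      exact absurd hj (not_lt.mpr this)
    rw [div_lt_div_iff₀ (hpos j₀ hj₀m) (hpos j hjm)] at h1
    rw [ht]
    have h2 : k j₀ * ((m : ℤ) - j) < k j * ((m : ℤ) - j₀) := by exact_mod_cast h1
    linarith

end OrderBound

section Cyclic

variable {OL : Type*} [CommRing OL] [IsDomain OL] [IsDiscreteValuationRing OL]
  {ϖ : OL} [hϖ : Fact (Irreducible ϖ)]
  {L N : Type*} [Field L] [Algebra OL L] [IsFractionRing OL L] [AddCommGroup N] [Module L N]
  [Module OL N] [IsScalarTower OL L N] [FiniteDimensional L N]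

open SemilinearGroup IsLocalRing

/-- `f` has a smallest slope `a / t` on `U`: there is a lattice of `U` stable under
`ψ = ϖ ^ (-a) f ^ t` on which `ψ` is not topologically nilpotent. -/
def HasMinSlope (f : SemilinearGroup ϖ L N) (U : Submodule L N) (t : ℕ) (a : ℤ) : Prop :=
  0 < t ∧ ∃ M : Submodule OL N, M.FG ∧ Submodule.span L (M : Set N) = U ∧
    f ^ t • M ≤ uniformizerMul ϖ L N ^ a • M ∧
    ∃ y ∈ M, ∃ i : ℕ, ∀ k : ℕ, (f ^ t) ^ k • y ∉ uniformizerMul ϖ L N ^ (a * k + i) • M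

/-- In terms of the basis `x, f x, …, f ^ (m - 1) x`, the operator `f` is a companion matrix. Its
coefficients satisfy the inequalities of a Newton polygon of smallest slope `a / t`, so `f` raises
the gauge `min_j (v (x_j) + j a / t)` by at least `a / t`. It raises it by exactly `a / t` on
vectors for which the minimum is attained only at places `j ≥ j₀`. -/
theorem exists_hasMinSlope_cyclic (f : SemilinearGroup ϖ L N) {x : N} (hx : x ≠ 0) :
    ∃ t a, HasMinSlope (OL := OL) f (Submodule.span L (Set.range fun j : ℕ => f ^ j • x)) t a := by
  classical
  obtain ⟨τ, hτϖ, hτO, hτ⟩ := exists_ringEquiv f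
  have hϖ0 := algebraMap_uniformizer_ne_zero (ϖ := ϖ) L
  let v : ℕ → N := fun j => f ^ j • x
  have hvs : ∀ j, f • v j = v (j + 1) := fun j => by simp only [v, pow_succ', mul_smul]
  have hex : ∃ m, ∃ b : ℕ → L, v m = ∑ j ∈ Finset.range m, b j • v j := by
    let S : ℕ →o Submodule L N :=
      ⟨fun m => Submodule.span L (v '' (Finset.range m : Set ℕ)), fun i j hij =>
        Submodule.span_mono (Set.image_mono (by simpa using hij))⟩
    obtain ⟨m, hm⟩ := monotone_stabilizes_iff_noetherian.mpr (inferInstance : IsNoetherian L N) S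
    have h1 : v m ∈ S (m + 1) := Submodule.subset_span ⟨m, by simp, rfl⟩
    rw [← hm (m + 1) (Nat.le_succ m)] at h1
    exact ⟨m, mem_span_image_range_iff.mp h1⟩
  obtain ⟨M, hM, hmin⟩ : ∃ m, (∃ b : ℕ → L, v m = ∑ j ∈ Finset.range m, b j • v j) ∧
      ∀ m' < m, ¬ ∃ b : ℕ → L, v m' = ∑ j ∈ Finset.range m', b j • v j :=
    ⟨Nat.find hex, Nat.find_spec hex, fun _ h => Nat.find_min hex h⟩
  obtain ⟨b, hb⟩ := hM
  rcases M with _ | m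
  · exact absurd (by simpa [v] using hb) hx
  have hli : ∀ n ≤ m + 1, ∀ c : ℕ → L, ∑ j ∈ Finset.range n, c j • v j = 0 → ∀ j < n, c j = 0 := by
    intro n
    induction n with
    | zero => intro _ _ _ j hj; omega
    | succ n ih =>
      intro hn c hc
      rw [Finset.sum_range_succ] at hc
      have hcn : c n = 0 := by
        by_contra hne
        refine hmin n (by omega) ⟨fun j => -((c n)⁻¹ * c j), ?_⟩
        have h1 : v n = (c n)⁻¹ • (c n • v n) := by rw [smul_smul, inv_mul_cancel₀ hne, one_smul]
        rw [h1, eq_neg_of_add_eq_zero_right hc, smul_neg, Finset.smul_sum, ← Finset.sum_neg_distrib]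
        exact Finset.sum_congr rfl fun j _ => by rw [neg_smul, mul_smul]
      rw [hcn, zero_smul, add_zero] at hc
      intro j hj
      rcases Nat.lt_succ_iff_lt_or_eq.mp hj with h | rfl
      · exact ih (by omega) c hc j h
      · exact hcn
  have huniq : ∀ c c' : ℕ → L, ∑ j ∈ Finset.range (m + 1), c j • v j =
      ∑ j ∈ Finset.range (m + 1), c' j • v j → ∀ j < m + 1, c j = c' j := by
    intro c c' h j hj
    refine sub_eq_zero.mp (hli (m + 1) le_rfl (fun j => c j - c' j) ?_ j hj)
    simp only [sub_smul, Finset.sum_sub_distrib, h, sub_self]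
  -- the coordinates of `f y` in terms of those of `y`
  let F : (ℕ → L) → ℕ → L := fun c j =>
    (if j = 0 then 0 else τ (c (j - 1))) + τ (c m) * b j
  have hF : ∀ c : ℕ → L, f • ∑ j ∈ Finset.range (m + 1), c j • v j =
      ∑ j ∈ Finset.range (m + 1), F c j • v j := by
    intro c
    rw [Finset.smul_sum, Finset.sum_congr rfl fun j _ => by rw [hτ, hvs], Finset.sum_range_succ, hb,
      Finset.smul_sum]
    simp only [F, add_smul, Finset.sum_add_distrib, mul_smul]
    congr 1
    rw [Finset.sum_range_succ' (fun j => (if j = 0 then 0 else τ (c (j - 1))) • v j)]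
    simp
  have hb0 : b 0 ≠ 0 := by
    intro h0
    refine hmin m (Nat.lt_succ_self m) ⟨fun j => τ.symm (b (j + 1)), ?_⟩
    apply MulAction.injective f
    dsimp only
    rw [hvs, hb, Finset.sum_range_succ', h0, zero_smul, add_zero, Finset.smul_sum]
    exact Finset.sum_congr rfl fun j _ => by rw [hτ, hvs, RingEquiv.apply_symm_apply]
  obtain ⟨j₀, t, a, hjt, ht, hslope, hstrict, u₀, hu₀⟩ :=
    exists_min_slope (ϖ := ϖ) (m + 1) (Nat.succ_pos m) b hb0
  have hj₀ : j₀ < m + 1 := by omega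
  have hFge : ∀ (u : ℤ) (c : ℕ → L), (∀ j < m + 1, HasOrderGe ϖ t (u - j * a) (c j)) →
      ∀ j < m + 1, HasOrderGe ϖ t (u + a - j * a) (F c j) := by
    intro u c hc j hj
    refine HasOrderGe.add ?_ ?_
    · split_ifs with h
      · exact HasOrderGe.zero ht _
      · refine ((hc (j - 1) (by omega)).map hτϖ hτO).mono (le_of_eq ?_)
        obtain ⟨i, rfl⟩ := Nat.exists_eq_succ_of_ne_zero h
        push_cast [Nat.succ_sub_one]
        ring
    · refine (((hc m (by omega)).map hτϖ hτO).mul (hslope j hj)).mono (le_of_eq ?_)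
      push_cast
      ring
  -- the lattice of the vectors of gauge at least `u / t`
  let Λ : ℤ → Submodule OL N := fun u =>
    { carrier := {y | ∃ c : ℕ → L, (∀ j < m + 1, HasOrderGe ϖ t (u - j * a) (c j)) ∧
        y = ∑ j ∈ Finset.range (m + 1), c j • v j}
      add_mem' := by
        rintro _ _ ⟨c, hc, rfl⟩ ⟨c', hc', rfl⟩
        exact ⟨fun j => c j + c' j, fun j hj => (hc j hj).add (hc' j hj), by
          simp only [add_smul, Finset.sum_add_distrib]⟩
      zero_mem' := ⟨0, fun j _ => HasOrderGe.zero ht _, by simp⟩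
      smul_mem' := by
        rintro o _ ⟨c, hc, rfl⟩
        refine ⟨fun j => algebraMap OL L o * c j, fun j hj => (hc j hj).integral_smul o, ?_⟩
        simp only [mul_smul, ← Finset.smul_sum, algebraMap_smul] }
  have hΛf : ∀ u, ∀ y ∈ Λ u, f • y ∈ Λ (u + a) := by
    rintro u _ ⟨c, hc, rfl⟩
    exact ⟨F c, hFge u c hc, hF c⟩
  have hΛs : ∀ (u k : ℤ), ∀ y, uniformizerMul ϖ L N ^ k • y ∈ Λ (u + t * k) ↔ y ∈ Λ u := by
    have key : ∀ (u k : ℤ), ∀ y ∈ Λ u, uniformizerMul ϖ L N ^ k • y ∈ Λ (u + t * k) := by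
      rintro u k _ ⟨c, hc, rfl⟩
      refine ⟨fun j => algebraMap OL L ϖ ^ k * c j, fun j hj =>
        ((hc j hj).zpow_mul k).mono (le_of_eq (by ring)), ?_⟩
      rw [zpow_uniformizerMul_smul, Finset.smul_sum]
      simp only [mul_smul]
    intro u k y
    refine ⟨fun h => ?_, key u k y⟩
    have := key _ (-k) _ h
    rwa [zpow_neg, inv_smul_smul, mul_neg, add_neg_cancel_right] at this
  have hvU : ∀ j < m + 1, ∀ u, ∃ k : ℕ, uniformizerMul ϖ L N ^ k • v j ∈ Λ u := by
    intro j hj u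
    refine ⟨(u - j * a).natAbs,
      fun i => if i = j then algebraMap OL L ϖ ^ (u - j * a).natAbs else 0,
      fun i _ => ?_, ?_⟩
    · dsimp only
      split_ifs with h
      · subst h
        refine ⟨(u - i * a).natAbs, 1, ?_, by rw [map_one, mul_one, zpow_natCast]⟩
        have h1 : (1 : ℤ) ≤ t := by exact_mod_cast ht
        have h2 := Int.natCast_natAbs (u - i * a)
        rw [h2]
        nlinarith [le_abs_self (u - i * a), abs_nonneg (u - i * a)]
      · exact HasOrderGe.zero ht _
    · simp only [ite_smul, zero_smul]
      rw [Finset.sum_ite_eq' (Finset.range (m + 1)) j, if_pos (Finset.mem_range.mpr hj),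
        pow_uniformizerMul_smul, ← map_pow, algebraMap_smul]
  have hfgΛ : ∀ u, (Λ u).FG := by
    intro u
    let k : ℕ := ∑ j ∈ Finset.range (m + 1), (u - j * a).natAbs
    let P : Submodule OL N := uniformizerMul ϖ L N ^ (-(k : ℤ)) •
      Submodule.span OL (v '' (Finset.range (m + 1) : Set ℕ))
    have hP : P.FG := smul_fg _ (Submodule.fg_span ((Finset.finite_toSet _).image v))
    have : Module.Finite OL P := Module.Finite.iff_fg.mpr hP
    have hle : Λ u ≤ P := by
      rintro _ ⟨c, hc, rfl⟩
      rw [mem_zpow_uniformizerMul_smul, neg_neg, Finset.smul_sum]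
      refine sum_mem fun j hj => ?_
      obtain ⟨l, o, hl, hcl⟩ := hc j (Finset.mem_range.mp hj)
      have hkl : 0 ≤ k + l := by
        have h1 : (u - j * a).natAbs ≤ k :=
          Finset.single_le_sum (f := fun j : ℕ => (u - j * a).natAbs) (fun _ _ => Nat.zero_le _) hj
        by_contra hneg
        have h2 : (1 : ℤ) ≤ t := by exact_mod_cast ht
        have h3 : (t : ℤ) * l ≤ l := by nlinarith
        omega
      obtain ⟨n, hn⟩ := Int.eq_ofNat_of_zero_le hkl
      rw [hcl, smul_smul, ← mul_assoc, ← zpow_add₀ hϖ0, hn, zpow_natCast, ← map_pow, ← map_mul,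
        algebraMap_smul]
      exact Submodule.smul_mem _ _ (Submodule.subset_span ⟨j, hj, rfl⟩)
    have : IsNoetherian OL (Λ u) := isNoetherian_of_le hle
    exact Module.Finite.iff_fg.mp inferInstance
  have hspan : Submodule.span L (v '' (Finset.range (m + 1) : Set ℕ)) =
      Submodule.span L (Set.range v) := by
    refine le_antisymm (Submodule.span_mono (Set.image_subset_range _ _)) ?_
    rw [Submodule.span_le]
    rintro _ ⟨j, rfl⟩
    induction j with
    | zero => exact Submodule.subset_span ⟨0, by simp, rfl⟩
    | succ j ih =>
      obtain ⟨c, hc⟩ := mem_span_image_range_iff.mp ih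
      rw [← hvs, hc, hF]
      exact mem_span_image_range_iff.mpr ⟨_, rfl⟩
  have hspanΛ : ∀ u, Submodule.span L ((Λ u : Submodule OL N) : Set N) =
      Submodule.span L (Set.range v) := by
    intro u
    rw [← hspan]
    apply le_antisymm
    · rw [Submodule.span_le]
      rintro _ ⟨c, -, rfl⟩
      exact mem_span_image_range_iff.mpr ⟨c, rfl⟩
    · rw [Submodule.span_le]
      rintro _ ⟨j, hj, rfl⟩
      obtain ⟨k, hk⟩ := hvU j (by simpa using hj) u
      have h1 := Submodule.smul_mem (Submodule.span L ((Λ u : Submodule OL N) : Set N))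
        (algebraMap OL L ϖ ^ (-(k : ℤ))) (Submodule.subset_span hk)
      rwa [← zpow_uniformizerMul_smul, zpow_neg, zpow_natCast, inv_smul_smul] at h1
  have hΛpow : ∀ (k : ℕ) u, ∀ y ∈ Λ u, f ^ k • y ∈ Λ (u + k * a) := by
    intro k
    induction k with
    | zero => intro u y hy; simpa using hy
    | succ k ih =>
      intro u y hy
      have := hΛf _ _ (ih u y hy)
      rw [← mul_smul, ← pow_succ'] at this
      rwa [show u + ((k + 1 : ℕ) : ℤ) * a = u + k * a + a by push_cast; ring]
  -- vectors whose gauge is exactly `u / t`, attained only at places `j ≥ j₀`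
  have hexact : ∀ k : ℕ, ∃ c : ℕ → L, f ^ k • v j₀ = ∑ j ∈ Finset.range (m + 1), c j • v j ∧
      (∀ j < m + 1, HasOrderGe ϖ t (j₀ * a + k * a - j * a) (c j)) ∧
      (∀ j < j₀, HasOrderGe ϖ t (j₀ * a + k * a - j * a + 1) (c j)) ∧
      ¬ ∀ j < m + 1, HasOrderGe ϖ t (j₀ * a + k * a - j * a + 1) (c j) := by
    intro k
    induction k with
    | zero =>
      refine ⟨fun j => if j = j₀ then 1 else 0, ?_, fun j _ => ?_, fun j hj => ?_, fun h => ?_⟩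
      · simp only [ite_smul, zero_smul]
        rw [Finset.sum_ite_eq' (Finset.range (m + 1)) j₀, if_pos (Finset.mem_range.mpr hj₀)]
        simp
      · dsimp only
        split_ifs with h
        · exact ⟨0, 1, by simp [h], by simp⟩
        · exact HasOrderGe.zero ht _
      · dsimp only
        rw [if_neg hj.ne]
        exact HasOrderGe.zero ht _
      · obtain ⟨l, o, hl, hlo⟩ := h j₀ hj₀
        dsimp only at hlo
        rw [if_pos rfl] at hlo
        have hl' : 0 < l := by
          by_contra hneg
          have h2 : (0 : ℤ) ≤ t := Int.natCast_nonneg t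
          push_cast at hl
          nlinarith
        obtain ⟨n, rfl⟩ := Int.eq_ofNat_of_zero_le hl'.le
        rw [zpow_natCast, ← map_pow, ← map_mul, ← map_one (algebraMap OL L)] at hlo
        have h3 := IsFractionRing.injective OL L hlo
        refine hϖ.out.not_isUnit (isUnit_of_dvd_one ?_)
        rw [h3]
        exact Dvd.dvd.mul_right (dvd_pow_self _ (by omega)) _
    | succ k ih =>
      obtain ⟨c, hc1, hc2, hc3, hc4⟩ := ih
      have hshift : ∀ j : ℕ, (j₀ : ℤ) * a + ((k + 1 : ℕ) : ℤ) * a - j * a =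
          j₀ * a + k * a + a - j * a := fun j => by push_cast; ring
      have hcm := (hc2 m (by omega)).map hτϖ hτO
      -- the two contributions to a coordinate of `f y`
      have hsh : ∀ j, j ≠ 0 → ∀ e,
          HasOrderGe ϖ t (j₀ * a + k * a - ((j - 1 : ℕ) : ℤ) * a + e) (c (j - 1)) →
          HasOrderGe ϖ t (j₀ * a + k * a + a - j * a + e) (if j = 0 then 0 else τ (c (j - 1))) := by
        intro j hj e h
        rw [if_neg hj]
        refine (h.map hτϖ hτO).mono (le_of_eq ?_)
        obtain ⟨i, rfl⟩ := Nat.exists_eq_succ_of_ne_zero hj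
        push_cast [Nat.succ_sub_one]
        ring
      refine ⟨F c, ?_, fun j hj => ?_, fun j hj => ?_, fun h => hc4 ?_⟩
      · rw [pow_succ', mul_smul, hc1, hF]
      · rw [hshift]
        exact hFge _ c hc2 j hj
      · rw [hshift]
        refine HasOrderGe.add ?_ ((hcm.mul (hstrict j hj)).mono (le_of_eq (by push_cast; ring)))
        rcases eq_or_ne j 0 with rfl | hj0
        · exact HasOrderGe.zero ht _
        · exact hsh j hj0 1 (hc3 (j - 1) (by omega))
      · -- at the place `j₀` one reads off that the last coordinate of `y` is small
        have hlast : HasOrderGe ϖ t (j₀ * a + k * a - m * a + 1) (c m) := by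
          have h1 := h j₀ hj₀
          rw [hshift] at h1
          have h2 : HasOrderGe ϖ t (j₀ * a + k * a + a - j₀ * a + 1)
              (if j₀ = 0 then 0 else τ (c (j₀ - 1))) := by
            rcases eq_or_ne j₀ 0 with hj0 | hj0
            · rw [if_pos hj0]
              exact HasOrderGe.zero ht _
            · exact hsh j₀ hj0 1 (hc3 (j₀ - 1) (by omega))
          have h3 := h1.add h2.neg
          simp only [F] at h3
          rw [add_neg_cancel_comm, hu₀] at h3
          have h4 := (h3.of_mul a u₀).map (τ := τ.symm)
            (by rw [RingEquiv.symm_apply_eq, hτϖ])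
            (fun z => by rw [← hτO, RingEquiv.apply_symm_apply])
          rw [RingEquiv.symm_apply_apply] at h4
          refine h4.mono (le_of_eq ?_)
          have : (m : ℤ) = j₀ + t - 1 := by omega
          rw [this]
          ring
        intro j hj
        rcases Nat.lt_succ_iff_lt_or_eq.mp hj with hjm | rfl
        · have h1 := h (j + 1) (by omega)
          rw [hshift] at h1
          have h2 := ((hlast.map hτϖ hτO).mul (hslope (j + 1) (by omega)))
          have h3 := h1.add (h2.mono (u' := j₀ * a + k * a + a - ((j + 1 : ℕ) : ℤ) * a + 1)
            (le_of_eq (by push_cast; ring))).neg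
          simp only [F, if_neg (Nat.succ_ne_zero j), Nat.add_sub_cancel] at h3
          rw [add_neg_cancel_right] at h3
          have h4 := h3.map (τ := τ.symm)
            (by rw [RingEquiv.symm_apply_eq, hτϖ])
            (fun z => by rw [← hτO, RingEquiv.apply_symm_apply])
          rw [RingEquiv.symm_apply_apply] at h4
          refine h4.mono (le_of_eq ?_)
          push_cast
          ring
        · exact hlast
  refine ⟨t, a, ht, Λ (j₀ * a), hfgΛ _, hspanΛ _, ?_, v j₀, ?_, 1, fun k hk => ?_⟩
  · rw [smul_le_iff_forall]
    intro y hy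
    have h1 := hΛpow t _ y hy
    rw [mem_smul, ← hΛs _ a, smul_inv_smul]
    exact h1
  · obtain ⟨c, hc1, hc2, -, -⟩ := hexact 0
    rw [pow_zero, one_smul] at hc1
    exact ⟨c, fun j hj => by simpa using hc2 j hj, hc1⟩
  · obtain ⟨c, hc1, -, -, hc4⟩ := hexact (t * k)
    rw [mem_smul, ← hΛs _ (a * k + (1 : ℕ)), smul_inv_smul, ← pow_mul] at hk
    obtain ⟨c', hc', hcc'⟩ := hk
    refine hc4 fun j hj => ?_
    rw [huniq c c' (hc1.symm.trans hcc') j hj]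
    refine (hc' j hj).mono ?_
    have : (1 : ℤ) ≤ t := by exact_mod_cast ht
    push_cast
    nlinarith

end Cyclic

/-! ### The slope decomposition -/

section Lattice

variable {α ι : Type*} [CompleteLattice α] [DecidableEq ι] {W : ι → α}

theorem iSup_update_sup (a : α) (i : ι) :
    ⨆ j, Function.update W i (W i ⊔ a) j = (⨆ j, W j) ⊔ a := by
  apply le_antisymm
  · refine iSup_le fun j => ?_
    rcases eq_or_ne j i with rfl | hj
    · rw [Function.update_self]
      exact sup_le_sup_right (le_iSup W j) a
    · rw [Function.update_of_ne hj]
      exact le_sup_of_le_left (le_iSup W j)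
  · refine sup_le (iSup_le fun j => le_iSup_of_le j ?_) (le_iSup_of_le i ?_)
    · rcases eq_or_ne j i with rfl | hj
      · rw [Function.update_self]
        exact le_sup_left
      · rw [Function.update_of_ne hj]
    · rw [Function.update_self]
      exact le_sup_right

theorem iSupIndep.update_sup [IsModularLattice α] (hW : iSupIndep W) {a : α}
    (h : Disjoint (⨆ j, W j) a) (i : ι) : iSupIndep (Function.update W i (W i ⊔ a)) := by
  intro j
  have hdisj : Disjoint (W j ⊔ ⨆ k, ⨆ _ : k ≠ j, W k) a :=
    h.mono_left (sup_le (le_iSup W j) (iSup₂_le fun k _ => le_iSup W k))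
  rcases eq_or_ne j i with rfl | hj
  · have heq : (⨆ k, ⨆ _ : k ≠ j, Function.update W j (W j ⊔ a) k) = ⨆ k, ⨆ _ : k ≠ j, W k :=
      iSup_congr fun k => iSup_congr fun hk => Function.update_of_ne hk _ _
    rw [Function.update_self, heq, sup_comm]
    exact (hW j).disjoint_sup_left_of_disjoint_sup_right hdisj.symm
  · rw [Function.update_of_ne hj]
    refine Disjoint.mono_right ?_ ((hW j).disjoint_sup_right_of_disjoint_sup_left hdisj)
    refine iSup₂_le fun k hk => ?_
    rcases eq_or_ne k i with rfl | hki
    · rw [Function.update_self]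
      exact sup_le_sup_right (le_iSup₂ (f := fun k (_ : k ≠ j) => W k) k hk) a
    · rw [Function.update_of_ne hki]
      exact le_sup_of_le_left (le_iSup₂ (f := fun k (_ : k ≠ j) => W k) k hk)

end Lattice

section SlopeDecomposition

variable {OL : Type*} [CommRing OL] [IsDomain OL] [IsDiscreteValuationRing OL]
  {ϖ : OL} [hϖ : Fact (Irreducible ϖ)]
  {L N : Type*} [Field L] [Algebra OL L] [IsFractionRing OL L] [AddCommGroup N] [Module L N]
  [Module OL N] [IsScalarTower OL L N]

open SemilinearGroup IsLocalRing

theorem pow_smul_le_zpow_smul {g : SemilinearGroup ϖ L N} {M : Submodule OL N} {a : ℤ}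
    (h : g • M ≤ uniformizerMul ϖ L N ^ a • M) (d : ℕ) :
    g ^ d • M ≤ uniformizerMul ϖ L N ^ (a * d) • M := by
  induction d with
  | zero => simp
  | succ d ih =>
    rw [pow_succ, mul_smul, Nat.cast_succ, mul_add, mul_one, add_comm, zpow_add, mul_smul]
    refine (smul_mono _ h).trans ?_
    rw [smul_zpow_uniformizerMul_smul]
    exact smul_mono _ ih

theorem pow_smul_eq_zpow_smul {g : SemilinearGroup ϖ L N} {M : Submodule OL N} {a : ℤ}
    (h : g • M = uniformizerMul ϖ L N ^ a • M) (d : ℕ) :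
    g ^ d • M = uniformizerMul ϖ L N ^ (a * d) • M := by
  induction d with
  | zero => simp
  | succ d ih =>
    rw [pow_succ, mul_smul, Nat.cast_succ, mul_add, mul_one, add_comm, zpow_add, mul_smul, h,
      smul_zpow_uniformizerMul_smul, ih]

theorem pow_smul_mem {f : SemilinearGroup ϖ L N} {U : Submodule L N} (h : ∀ x ∈ U, f • x ∈ U)
    (k : ℕ) : ∀ x ∈ U, f ^ k • x ∈ U := by
  induction k with
  | zero => simp
  | succ k ih => intro x hx; rw [pow_succ, mul_smul]; exact ih _ (h x hx)

theorem zpow_uniformizerMul_smul_mem {U : Submodule L N} (k : ℤ) {x : N} (hx : x ∈ U) :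
    uniformizerMul ϖ L N ^ k • x ∈ U := by
  rw [zpow_uniformizerMul_smul]
  exact U.smul_mem _ hx

/-- `U` is a sum of cyclic isocrystals, and its smallest slope is the minimum of theirs. -/
theorem exists_hasMinSlope [FiniteDimensional L N] (f : SemilinearGroup ϖ L N)
    {U : Submodule L N} (hU : U ≠ ⊥) (hf : ∀ x ∈ U, f • x ∈ U) :
    ∃ t a, HasMinSlope (OL := OL) f U t a := by
  classical
  obtain ⟨S, hS⟩ : ∃ S : Finset N, Submodule.span L (S : Set N) = U :=
    IsNoetherian.noetherian U
  have hS' : Submodule.span L ((S.erase 0 : Finset N) : Set N) = U := by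
    rw [Finset.coe_erase, Submodule.span_sdiff_singleton_zero, hS]
  have hSU : ∀ x ∈ S.erase 0, x ∈ U := fun x hx => hS' ▸ Submodule.subset_span hx
  have hne : Nonempty (S.erase 0) := by
    by_contra hempty
    rw [nonempty_subtype, not_exists] at hempty
    apply hU
    rw [← hS', Finset.eq_empty_of_forall_notMem hempty]
    simp
  let C : S.erase 0 → Submodule L N := fun i =>
    Submodule.span L (Set.range fun j : ℕ => f ^ j • (i : N))
  have hCU : ∀ i, C i ≤ U := by
    intro i
    rw [Submodule.span_le]
    rintro _ ⟨j, rfl⟩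
    exact pow_smul_mem hf j _ (hSU i i.2)
  have hiC : ∀ i : S.erase 0, (i : N) ∈ C i := fun i =>
    Submodule.subset_span ⟨0, by simp⟩
  have hCf : ∀ i, ∀ x ∈ C i, f • x ∈ C i := by
    intro i x hx
    refine Submodule.span_mono ?_ (smul_mem_span f hx)
    rintro _ ⟨_, ⟨j, rfl⟩, rfl⟩
    exact ⟨j + 1, by simp only [pow_succ', mul_smul]⟩
  have hex : ∀ i : S.erase 0, ∃ t a, HasMinSlope (OL := OL) f (C i) t a := fun i =>
    exists_hasMinSlope_cyclic f (Finset.ne_of_mem_erase i.2)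
  choose t a ht M hMfg hspan hle y hy e hye using hex
  obtain ⟨i₀, hmin⟩ := Finite.exists_min fun i => (a i : ℚ) / t i
  have hd : ∀ i, ∃ d : ℕ, ∏ j, t j = t i * d := fun i =>
    Finset.dvd_prod_of_mem t (Finset.mem_univ i)
  choose d hd using hd
  have hdpos : 0 < ∏ j, t j := Finset.prod_pos fun i _ => ht i
  have hA : ∀ i, a i₀ * d i₀ ≤ a i * d i := by
    intro i
    have hrew : ∀ i, ((a i * d i : ℤ) : ℚ) = (a i : ℚ) / t i * (∏ j, t j : ℕ) := by
      intro i
      have : (t i : ℚ) ≠ 0 := by exact_mod_cast (ht i).ne'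
      rw [hd i]
      push_cast
      field_simp
    have h1 := mul_le_mul_of_nonneg_right (hmin i) (Nat.cast_nonneg (α := ℚ) (∏ j, t j))
    rw [← hrew, ← hrew] at h1
    exact_mod_cast h1
  have hMC : ∀ i, ∀ x ∈ M i, x ∈ C i := fun i x hx => hspan i ▸ Submodule.subset_span hx
  have hsupfg : (⨆ i, M i).FG := Submodule.fg_iSup _ hMfg
  refine ⟨∏ j, t j, a i₀ * d i₀, hdpos, ⨆ i, M i, hsupfg, ?_, ?_, y i₀,
    Submodule.mem_iSup_of_mem i₀ (hy i₀), ?_⟩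
  · apply le_antisymm
    · have : (⨆ i, M i) ≤ U.restrictScalars OL := iSup_le fun i x hx => hCU i (hMC i x hx)
      exact Submodule.span_le.mpr this
    · rw [← hS', Submodule.span_le]
      intro x hx
      have h1 := hiC ⟨x, hx⟩
      rw [← hspan] at h1
      exact Submodule.span_mono (le_iSup M _) h1
  · rw [smul_iSup, smul_iSup]
    refine iSup_mono fun i => ?_
    rw [hd i, pow_mul]
    exact (pow_smul_le_zpow_smul (hle i) (d i)).trans (zpow_uniformizerMul_smul_anti (hA i) _)
  · have : Module.Finite OL (⨆ i, M i : Submodule OL N) := Module.Finite.iff_fg.mpr hsupfg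
    have hfg : ((⨆ i, M i) ⊓ (C i₀).restrictScalars OL).FG := by
      have : IsNoetherian OL ((⨆ i, M i) ⊓ (C i₀).restrictScalars OL : Submodule OL N) :=
        isNoetherian_of_le inf_le_left
      exact Module.Finite.iff_fg.mp inferInstance
    -- the sum of the lattices `M i` meets the cyclic space `C i₀` in a multiple of `M i₀` at most
    obtain ⟨l, hl⟩ := exists_pow_smul_le (ϖ := ϖ) (M := M i₀) (L := L) hfg (by
      rw [hspan]
      exact fun x hx => hx.2)
    refine ⟨e i₀ + l, fun k hk => hye i₀ (d i₀ * k) ?_⟩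
    rw [hd i₀, pow_mul, ← pow_mul _ (d i₀)] at hk
    rw [mem_smul] at hk ⊢
    have hC : (uniformizerMul ϖ L N ^ (a i₀ * d i₀ * k + (e i₀ + l : ℕ)))⁻¹ •
        (f ^ t i₀) ^ (d i₀ * k) • y i₀ ∈ C i₀ := by
      rw [← zpow_neg, ← pow_mul]
      exact zpow_uniformizerMul_smul_mem _ (pow_smul_mem (hCf i₀) _ _ (hMC i₀ _ (hy i₀)))
    have := hl (smul_mem_smul.mpr ⟨hk, hC⟩)
    rw [smul_smul, ← zpow_natCast, ← zpow_neg, ← zpow_add] at this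
    rw [← zpow_neg]
    convert this using 3
    push_cast
    ring

/-- `W` is stable under `f`, and `f ^ t` acts on some lattice of `W` as `ϖ ^ (t s)`. -/
def IsIsoclinicSubspace (f : SemilinearGroup ϖ L N) (W : Submodule L N) (s : ℚ) : Prop :=
  (∀ x ∈ W, f • x ∈ W) ∧ ∃ M : Submodule OL N, M.FG ∧ Submodule.span L (M : Set N) = W ∧
    ∃ t : ℕ, 0 < t ∧ ∃ a : ℤ, (a : ℚ) = t * s ∧ f ^ t • M = uniformizerMul ϖ L N ^ a • M

theorem smul_bot_submodule (g : SemilinearGroup ϖ L N) : g • (⊥ : Submodule OL N) = ⊥ :=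
  (orderIso g).map_bot

theorem isIsoclinicSubspace_bot (f : SemilinearGroup ϖ L N) (s : ℚ) :
    IsIsoclinicSubspace (OL := OL) f ⊥ s :=
  ⟨by simp, ⊥, Submodule.fg_bot, by simp, s.den, s.pos, s.num,
    by rw [Rat.den_mul_eq_num], by rw [smul_bot_submodule, smul_bot_submodule]⟩

theorem IsIsoclinicSubspace.sup {f : SemilinearGroup ϖ L N} {W W' : Submodule L N} {s : ℚ}
    (h : IsIsoclinicSubspace (OL := OL) f W s) (h' : IsIsoclinicSubspace (OL := OL) f W' s) :
    IsIsoclinicSubspace (OL := OL) f (W ⊔ W') s := by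
  obtain ⟨hf, M, hM, hspan, t, ht, a, ha, hMa⟩ := h
  obtain ⟨hf', M', hM', hspan', t', ht', a', ha', hMa'⟩ := h'
  refine ⟨fun x hx => ?_, M ⊔ M', hM.sup hM', ?_, t * t', Nat.mul_pos ht ht', a * t', ?_, ?_⟩
  · obtain ⟨y, hy, z, hz, rfl⟩ := Submodule.mem_sup.mp hx
    rw [smul_add]
    exact Submodule.add_mem_sup (hf y hy) (hf' z hz)
  · rw [← hspan, ← hspan']
    apply le_antisymm
    · rw [Submodule.span_le]
      intro x hx
      obtain ⟨y, hy, z, hz, rfl⟩ := Submodule.mem_sup.mp hx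
      exact Submodule.add_mem_sup (Submodule.subset_span hy) (Submodule.subset_span hz)
    · exact sup_le (Submodule.span_mono (le_sup_left (b := M')))
        (Submodule.span_mono (le_sup_right (a := M)))
  · push_cast
    rw [ha]
    ring
  · have haa : a * t' = a' * t := by
      have : ((a * t' : ℤ) : ℚ) = (a' * t : ℤ) := by
        push_cast
        rw [ha, ha']
        ring
      exact_mod_cast this
    rw [smul_sup, smul_sup]
    congr 1
    · rw [pow_mul]
      exact pow_smul_eq_zpow_smul hMa t'
    · rw [haa, mul_comm, pow_mul]
      exact pow_smul_eq_zpow_smul hMa' t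

/-- Dieudonné and Manin: a finite-dimensional isocrystal is the direct sum of isoclinic ones. The
Fitting decomposition for `ϖ ^ (-a) f ^ t` splits off the part whose slope `a / t` is smallest. -/
theorem exists_slope_decomposition [FiniteDimensional L N]
    [IsAdicComplete (maximalIdeal OL) OL] (f : SemilinearGroup ϖ L N) (U : Submodule L N)
    (hf : ∀ x ∈ U, f • x ∈ U) :
    ∃ W : ℚ → Submodule L N, iSupIndep W ∧ (⨆ s, W s) = U ∧
      ∀ s, IsIsoclinicSubspace (OL := OL) f (W s) s := by
  classical
  induction hn : Module.finrank L U using Nat.strong_induction_on generalizing U with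
  | _ n ih =>
  rcases eq_or_ne U ⊥ with rfl | hU
  · exact ⟨fun _ => ⊥, fun _ => disjoint_bot_left, by simp, fun s => isIsoclinicSubspace_bot f s⟩
  obtain ⟨t, a, ht, M, hM, hspan, hle, y, hy, i, hyi⟩ := exists_hasMinSlope (OL := OL) f hU hf
  let ψ : SemilinearGroup ϖ L N := (uniformizerMul ϖ L N ^ a)⁻¹ * f ^ t
  have hcomm : Commute (uniformizerMul ϖ L N ^ a) (f ^ t) :=
    (uniformizerMul_comm (f ^ t)).zpow_left a
  obtain ⟨W₁, U', hW₁, hdisj, hsup, hfW₁, hfU', K, hK, hspanK, hψK⟩ := exists_fitting (f := f) hM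
    (ψ := ψ) (by rw [mul_smul, smul_le_iff, inv_inv]; exact hle) hspan hf
    (fun x hx => by
      rw [mul_smul, ← zpow_neg]
      exact zpow_uniformizerMul_smul_mem _ (pow_smul_mem hf t x hx))
    (((uniformizerMul_comm f).zpow_left a).inv_left.mul_left (Commute.pow_self f t)) hy (i₀ := i)
    (fun k hk => hyi k (by
      rw [hcomm.inv_left.mul_pow, mul_smul, mem_smul, ← zpow_natCast, ← zpow_natCast, inv_zpow,
        ← zpow_neg, ← zpow_neg, ← zpow_mul, smul_smul, ← zpow_add] at hk
      rw [mem_smul, ← zpow_neg]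
      convert hk using 3
      ring))
  have hlt : U' < U := by
    refine lt_of_le_of_ne (hsup ▸ le_sup_right) fun h => hW₁ ?_
    rw [h, ← hsup] at hdisj
    exact le_bot_iff.mp (hdisj le_rfl le_sup_left)
  obtain ⟨W, hind, hW, hiso⟩ := ih _ (hn ▸ Submodule.finrank_lt_finrank_of_lt hlt) U' hfU' rfl
  have ht0 : (t : ℚ) ≠ 0 := by exact_mod_cast ht.ne'
  set s₀ : ℚ := a / t with hs₀
  have hiso₁ : IsIsoclinicSubspace (OL := OL) f W₁ s₀ :=
    ⟨hfW₁, K, hK, hspanK, t, ht, a, by rw [hs₀]; field_simp, by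
      rw [mul_smul] at hψK
      exact inv_smul_eq_iff.mp hψK⟩
  clear_value s₀
  refine ⟨Function.update W s₀ (W s₀ ⊔ W₁), hind.update_sup (hW ▸ hdisj.symm) s₀, ?_, fun s => ?_⟩
  · rw [iSup_update_sup, hW, sup_comm, hsup]
  · rcases eq_or_ne s s₀ with hs | hs
    · rw [hs, Function.update_self]
      exact (hiso s₀).sup hiso₁
    · rw [Function.update_of_ne hs]
      exact hiso s

end SlopeDecomposition

/-! ### Slopes and relative positions of lattices -/

section SlopesOfLattices

variable {OL : Type*} [CommRing OL] [IsDomain OL] [IsDiscreteValuationRing OL]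
  {ϖ : OL} [hϖ : Fact (Irreducible ϖ)]
  {L N : Type*} [Field L] [Algebra OL L] [IsFractionRing OL L] [AddCommGroup N] [Module L N]
  [Module OL N] [IsScalarTower OL L N] [FiniteDimensional L N]

open SemilinearGroup IsLocalRing

theorem pow_smul_eq_of_pow_smul_eq {f : SemilinearGroup ϖ L N} {K : Submodule OL N} {t : ℕ} {a : ℤ}
    (h : f ^ t • K = uniformizerMul ϖ L N ^ a • K) :
    (uniformizerMul ϖ L N * f⁻¹) ^ t • K = uniformizerMul ϖ L N ^ (t - a) • K := by
  rw [(uniformizerMul_comm f).inv_right.mul_pow, mul_smul, inv_pow, sub_eq_add_neg, zpow_add,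
    mul_smul, zpow_natCast]
  congr 1
  rw [inv_smul_eq_iff, smul_zpow_uniformizerMul_smul, h, smul_smul, ← zpow_add, neg_add_cancel,
    zpow_zero, one_smul]

/-- A lattice of the subspace `W` has a basis of `W` as an `OL`-basis. -/
theorem exists_basis_of_span_eq {W : Submodule L N} {K : Submodule OL N} (hK : K.FG)
    (hspan : Submodule.span L (K : Set N) = W) :
    ∃ b : Module.Basis (Fin (Module.finrank L W)) L W,
      K = Submodule.span OL (Set.range fun j => (b j : N)) := by
  let ι : W →ₗ[OL] N := W.subtype.restrictScalars OL
  have hι : Function.Injective ι := Subtype.val_injective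
  have hKW : K ≤ LinearMap.range ι := fun x hx =>
    ⟨⟨x, hspan ▸ Submodule.subset_span hx⟩, rfl⟩
  have hmap : (K.comap ι).map ι = K := Submodule.map_comap_eq_self hKW
  have hlat : (K.comap ι).IsLattice L := by
    refine ⟨Submodule.fg_of_fg_map_injective ι hι (by rwa [hmap]), ?_⟩
    apply Submodule.map_injective_of_injective W.injective_subtype
    rw [Submodule.map_top, Submodule.range_subtype, Submodule.map_span]
    refine Eq.trans ?_ hspan
    exact congrArg (fun M : Submodule OL N => Submodule.span L (M : Set N)) hmap
  obtain ⟨b, hb⟩ := exists_basis_of_isLattice OL W hlat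
  refine ⟨b, ?_⟩
  rw [← hmap, hb, Submodule.map_span, ← Set.range_comp]
  rfl

section Sum

variable {ι : Type*} [Finite ι] {W : ι → Submodule L N} {K : ι → Submodule OL N}

theorem isLattice_iSup (htop : ⨆ i, W i = ⊤) (hK : ∀ i, (K i).FG)
    (hspan : ∀ i, Submodule.span L (K i : Set N) = W i) : (⨆ i, K i).IsLattice L := by
  refine ⟨Submodule.fg_iSup _ hK, ?_⟩
  rw [eq_top_iff, ← htop]
  exact iSup_le fun i => hspan i ▸ Submodule.span_mono (le_iSup K i)

theorem latticeIndex_iSup_pow [Fintype ι] (hind : iSupIndep W) (htop : ⨆ i, W i = ⊤)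
    (hK : ∀ i, (K i).FG) (hspan : ∀ i, Submodule.span L (K i : Set N) = W i) (a : ι → ℕ) :
    latticeIndex (⨆ i, K i) (⨆ i, uniformizerMul ϖ L N ^ a i • K i) =
      ∑ i, (a i : ℤ) * Module.finrank L (W i) := by
  classical
  choose b hb using fun i => exists_basis_of_span_eq (hK i) (hspan i)
  let e := (DirectSum.isInternal_submodule_of_iSupIndep_of_iSup_eq_top hind htop).collectedBasis b
  have he : ∀ x, e x = (b x.1 x.2 : N) := fun x => by simp [e]
  have h1 : ⨆ i, K i = Submodule.span OL (Set.range e) := by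
    rw [Set.range_sigma_eq_iUnion_range, Submodule.span_iUnion]
    refine iSup_congr fun i => ?_
    rw [hb i]
    simp only [he]
  have h2 : ⨆ i, uniformizerMul ϖ L N ^ a i • K i =
      Submodule.span OL (Set.range fun x => ϖ ^ a x.1 • e x) := by
    rw [Set.range_sigma_eq_iUnion_range, Submodule.span_iUnion]
    refine iSup_congr fun i => ?_
    conv_lhs => rw [hb i, smul_span, ← Set.range_comp]
    congr 2
    funext j
    rw [Function.comp_apply, pow_uniformizerMul_smul, he]
  rw [latticeIndex_of_le (iSup_mono fun i => pow_uniformizerMul_smul_le _ _), h1, h2,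
    relLength_span_pow_smul]
  · rw [ENat.toNat_natCast, Fintype.sum_sigma]
    push_cast
    refine Finset.sum_congr rfl fun i _ => ?_
    simp [mul_comm]
  · exact e.linearIndependent.restrict_scalars (R := OL) (by
      intro x y hxy
      simpa [Algebra.smul_def] using hxy)

theorem sum_finrank_eq [Fintype ι] (hind : iSupIndep W) (htop : ⨆ i, W i = ⊤)
    (hK : ∀ i, (K i).FG) (hspan : ∀ i, Submodule.span L (K i : Set N) = W i) :
    ∑ i, Module.finrank L (W i) = Module.finrank L N := by
  obtain ⟨ϖ, hϖ⟩ := IsDiscreteValuationRing.exists_irreducible OL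
  have : Fact (Irreducible ϖ) := ⟨hϖ⟩
  have h := latticeIndex_iSup_pow (ϖ := ϖ) hind htop hK hspan fun _ => 1
  simp only [pow_one] at h
  rw [← smul_iSup, latticeIndex_uniformizerMul (isLattice_iSup htop hK hspan)] at h
  simp only [Nat.cast_one, one_mul] at h
  exact_mod_cast h.symm

/-- The case of arbitrary exponents follows from that of nonnegative ones by scaling with
`ϖ ^ k`. -/
theorem latticeIndex_iSup_zpow [Fintype ι] (hind : iSupIndep W) (htop : ⨆ i, W i = ⊤)
    (hK : ∀ i, (K i).FG) (hspan : ∀ i, Submodule.span L (K i : Set N) = W i) (a : ι → ℤ) :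
    latticeIndex (⨆ i, K i) (⨆ i, uniformizerMul ϖ L N ^ a i • K i) =
      ∑ i, a i * Module.finrank L (W i) := by
  obtain ⟨k, hk⟩ : ∃ k : ℕ, ∀ i, 0 ≤ a i + k := by
    refine ⟨∑ i, (a i).natAbs, fun i => ?_⟩
    have := Finset.single_le_sum (f := fun i => (a i).natAbs) (fun _ _ => Nat.zero_le _)
      (Finset.mem_univ i)
    omega
  choose n hn using fun i => Int.eq_ofNat_of_zero_le (hk i)
  have hlat := isLattice_iSup htop hK hspan
  have h := latticeIndex_iSup_pow (ϖ := ϖ) hind htop hK hspan n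
  have hlat' : (⨆ i, uniformizerMul ϖ L N ^ a i • K i).IsLattice L := by
    refine isLattice_iSup htop (fun i => smul_fg _ (hK i)) fun i => ?_
    rw [← hspan i]
    apply le_antisymm
    · rw [Submodule.span_le]
      intro x hx
      have := zpow_uniformizerMul_smul_mem (ϖ := ϖ) (a i)
        (Submodule.subset_span (R := L) (mem_smul.mp hx))
      rwa [smul_inv_smul] at this
    · rw [Submodule.span_le]
      intro x hx
      have := zpow_uniformizerMul_smul_mem (ϖ := ϖ) (-a i) (Submodule.subset_span (R := L)
        (smul_mem_smul (g := uniformizerMul ϖ L N ^ a i).mpr hx))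
      rwa [zpow_neg, inv_smul_smul] at this
  have h1 : ⨆ i, uniformizerMul ϖ L N ^ n i • K i =
      uniformizerMul ϖ L N ^ (k : ℤ) • ⨆ i, uniformizerMul ϖ L N ^ a i • K i := by
    rw [smul_iSup]
    refine iSup_congr fun i => ?_
    rw [smul_smul, ← zpow_add, add_comm, hn i, zpow_natCast]
  rw [h1, ← latticeIndex_add hlat hlat' (smul_isLattice _ hlat'),
    latticeIndex_zpow_uniformizerMul hlat'] at h
  have h2 : ∀ i, (n i : ℤ) = a i + k := fun i => (hn i).symm
  simp only [h2, add_mul, Finset.sum_add_distrib, ← Finset.mul_sum] at h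
  rw [← Nat.cast_sum, sum_finrank_eq hind htop hK hspan] at h
  linarith

theorem exists_common_exponent [Fintype ι] {f : SemilinearGroup ϖ L N} {s : ι → ℚ}
    (h : ∀ i, IsIsoclinicSubspace (OL := OL) f (W i) (s i)) :
    ∃ K : ι → Submodule OL N, (∀ i, (K i).FG) ∧
      (∀ i, Submodule.span L (K i : Set N) = W i) ∧ ∃ t : ℕ, 0 < t ∧ ∃ a : ι → ℤ,
        (∀ i, (a i : ℚ) = t * s i) ∧ ∀ i, f ^ t • K i = uniformizerMul ϖ L N ^ a i • K i := by
  choose hf K hK hspan t ht a ha hfa using h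
  choose d hd using fun i => Finset.dvd_prod_of_mem t (Finset.mem_univ i)
  refine ⟨K, hK, hspan, ∏ i, t i, Finset.prod_pos fun i _ => ht i, fun i => a i * d i,
    fun i => ?_, fun i => ?_⟩
  · rw [hd i]
    push_cast
    rw [ha]
    ring
  · rw [hd i, pow_mul]
    exact pow_smul_eq_zpow_smul (hfa i) (d i)

/-- The index `[M : f M]` is the sum of the slopes, with multiplicities. -/
theorem latticeIndex_eq_sum_slopes [Fintype ι] {f : SemilinearGroup ϖ L N} {s : ι → ℚ}
    (hind : iSupIndep W) (htop : ⨆ i, W i = ⊤)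
    (h : ∀ i, IsIsoclinicSubspace (OL := OL) f (W i) (s i)) {M : Submodule OL N}
    (hM : M.IsLattice L) :
    (latticeIndex M (f • M) : ℚ) = ∑ i, s i * Module.finrank L (W i) := by
  obtain ⟨K, hK, hspan, t, ht, a, ha, hfa⟩ := exists_common_exponent h
  have hlat := isLattice_iSup htop hK hspan
  have h1 := latticeIndex_iSup_zpow (ϖ := ϖ) hind htop hK hspan a
  have h2 : f ^ t • ⨆ i, K i = ⨆ i, uniformizerMul ϖ L N ^ a i • K i := by
    rw [smul_iSup]
    exact iSup_congr hfa
  rw [← h2, latticeIndex_pow_smul f hlat, latticeIndex_smul_eq f hlat hM] at h1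
  have ht0 : (t : ℚ) ≠ 0 := by exact_mod_cast ht.ne'
  have h3 : (t : ℚ) * latticeIndex M (f • M) = ∑ i, (a i : ℚ) * Module.finrank L (W i) := by
    exact_mod_cast h1
  rw [← mul_right_inj' ht0, h3, Finset.mul_sum]
  exact Finset.sum_congr rfl fun i _ => by rw [ha, mul_assoc]

theorem smul_iSup_pow_smul_le {f : SemilinearGroup ϖ L N} {M : Submodule OL N} {t : ℕ}
    (h : f ^ t • M ≤ M) : f • (⨆ k : Fin t, f ^ (k : ℕ) • M) ≤ ⨆ k : Fin t, f ^ (k : ℕ) • M := by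
  rw [smul_iSup]
  refine iSup_le fun k => ?_
  rw [smul_smul, ← pow_succ']
  rcases Nat.lt_or_ge (k + 1) t with hk | hk
  · exact le_iSup (fun k : Fin t => f ^ (k : ℕ) • M) ⟨k + 1, hk⟩
  · have hkt : (k : ℕ) + 1 = t := by omega
    rw [hkt]
    refine h.trans ?_
    have := le_iSup (fun k : Fin t => f ^ (k : ℕ) • M) ⟨0, by omega⟩
    simpa using this

theorem isLattice_iSup_pow_smul {f : SemilinearGroup ϖ L N} {M : Submodule OL N} {t : ℕ}
    (ht : 0 < t) (hM : M.IsLattice L) : (⨆ k : Fin t, f ^ (k : ℕ) • M).IsLattice L := by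
  refine ⟨Submodule.fg_iSup _ fun k => smul_fg _ hM.fg, ?_⟩
  rw [eq_top_iff, ← hM.span_eq_top]
  refine Submodule.span_mono ?_
  have := le_iSup (fun k : Fin t => f ^ (k : ℕ) • M) ⟨0, ht⟩
  simpa using this

/-- If all slopes lie between `0` and `1`, there is a lattice stable under `f` and `ϖ f⁻¹`: some
powers of these operators preserve a sum of lattices of the isoclinic parts. -/
theorem exists_isStableLattice [Fintype ι] {f : SemilinearGroup ϖ L N} {s : ι → ℚ}
    (htop : ⨆ i, W i = ⊤) (h : ∀ i, IsIsoclinicSubspace (OL := OL) f (W i) (s i))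
    (hs : ∀ i, 0 ≤ s i ∧ s i ≤ 1) : ∃ M : Submodule OL N, IsStableLattice f M := by
  obtain ⟨K, hK, hspan, t, ht, a, ha, hfa⟩ := exists_common_exponent h
  have hlat := isLattice_iSup htop hK hspan
  have ht0 : (0 : ℚ) < t := by exact_mod_cast ht
  have h0 : ∀ i, 0 ≤ a i := fun i => by
    have : (0 : ℚ) ≤ a i := by rw [ha]; exact mul_nonneg ht0.le (hs i).1
    exact_mod_cast this
  have h1 : ∀ i, a i ≤ t := fun i => by
    have : (a i : ℚ) ≤ t := by rw [ha]; exact mul_le_of_le_one_right ht0.le (hs i).2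
    exact_mod_cast this
  let g : SemilinearGroup ϖ L N := uniformizerMul ϖ L N * f⁻¹
  have hgf : Commute g f := (uniformizerMul_comm f).mul_left (Commute.refl f).inv_left
  have hft : f ^ t • (⨆ i, K i) ≤ ⨆ i, K i := by
    rw [smul_iSup]
    refine iSup_mono fun i => ?_
    rw [hfa]
    simpa using zpow_uniformizerMul_smul_anti (ϖ := ϖ) (L := L) (h0 i) (K i)
  have hgt : g ^ t • (⨆ i, K i) ≤ ⨆ i, K i := by
    rw [smul_iSup]
    refine iSup_mono fun i => ?_
    rw [pow_smul_eq_of_pow_smul_eq (hfa i)]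
    simpa using zpow_uniformizerMul_smul_anti (ϖ := ϖ) (L := L) (sub_nonneg.mpr (h1 i)) (K i)
  let M₁ := ⨆ k : Fin t, f ^ (k : ℕ) • ⨆ i, K i
  have hgt' : g ^ t • M₁ ≤ M₁ := by
    rw [smul_iSup]
    refine iSup_mono fun k => ?_
    rw [smul_smul, (hgf.pow_pow t k).eq, mul_smul]
    exact smul_mono _ hgt
  refine ⟨⨆ l : Fin t, g ^ (l : ℕ) • M₁,
    isLattice_iSup_pow_smul ht (isLattice_iSup_pow_smul ht hlat), ?_, ?_⟩
  · have := smul_mono f (smul_iSup_pow_smul_le hgt')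
    rwa [smul_smul, hgf.symm.eq, inv_mul_cancel_right] at this
  · rw [smul_iSup]
    refine iSup_mono fun l => ?_
    rw [smul_smul, (hgf.symm.pow_right l).eq, mul_smul]
    exact smul_mono _ (smul_iSup_pow_smul_le hft)

end Sum

/-- If `a < 0`, then `M` would contain the multiples of `K` by arbitrarily negative powers
of `ϖ`. -/
theorem nonneg_of_pow_smul_eq {g : SemilinearGroup ϖ L N} {M K : Submodule OL N}
    (hM : M.IsLattice L) (hg : g • M ≤ M) (hK : K.FG) (hK0 : K ≠ ⊥) {t : ℕ} {a : ℤ}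
    (h : g ^ t • K = uniformizerMul ϖ L N ^ a • K) : 0 ≤ a := by
  by_contra! hneg
  obtain ⟨e, he⟩ := exists_pow_smul_le_of_isLattice (ϖ := ϖ) (L := L) hK hM
  obtain ⟨x, hx, hx0⟩ := Submodule.exists_mem_ne_zero_of_ne_bot hK0
  refine hx0 (eq_zero_of_forall_mem_pow_smul (ϖ := ϖ) (L := L) hM.fg fun n => ?_)
  have hpow : ∀ j : ℕ, g ^ j • M ≤ M := by
    intro j
    induction j with
    | zero => simp
    | succ j ih => rw [pow_succ, mul_smul]; exact (smul_mono _ hg).trans ih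
  have h1 : uniformizerMul ϖ L N ^ (a * (n + e : ℕ) + e) • K ≤ M := by
    rw [add_comm, zpow_add, mul_smul, ← pow_smul_eq_zpow_smul h, ← smul_zpow_uniformizerMul_smul,
      ← pow_mul, zpow_natCast]
    exact (smul_mono _ he).trans (hpow _)
  have h2 : x ∈ uniformizerMul ϖ L N ^ (-(a * (n + e : ℕ) + e)) • M := by
    rw [mem_smul, ← zpow_neg, neg_neg]
    exact h1 (smul_mem_smul.mpr hx)
  rw [← zpow_natCast]
  refine zpow_uniformizerMul_smul_anti ?_ M h2
  push_cast
  nlinarith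

theorem slope_mem_Icc {f : SemilinearGroup ϖ L N} {M : Submodule OL N} (hM : IsStableLattice f M)
    {W : Submodule L N} (hW : W ≠ ⊥) {s : ℚ} (h : IsIsoclinicSubspace (OL := OL) f W s) :
    0 ≤ s ∧ s ≤ 1 := by
  obtain ⟨-, K, hK, hspan, t, ht, a, ha, hfa⟩ := h
  have hK0 : K ≠ ⊥ := by
    rintro rfl
    apply hW
    rw [← hspan]
    simp
  have ht0 : (0 : ℚ) < t := by exact_mod_cast ht
  have h0 := nonneg_of_pow_smul_eq hM.isLattice hM.smul_le hK hK0 hfa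
  have h1 := nonneg_of_pow_smul_eq (g := uniformizerMul ϖ L N * f⁻¹) (t := t) (a := t - a)
    hM.isLattice (by
      rw [mul_smul, ← smul_uniformizerMul_smul, smul_le_iff, inv_inv]
      exact hM.uniformizerMul_smul_le) hK hK0 (pow_smul_eq_of_pow_smul_eq hfa)
  constructor
  · have : (0 : ℚ) ≤ a := by exact_mod_cast h0
    rw [ha] at this
    exact nonneg_of_mul_nonneg_right this ht0
  · have : (0 : ℚ) ≤ t - a := by exact_mod_cast h1
    rw [ha] at this
    nlinarith

end SlopesOfLattices

/-! ### Slope vectors -/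

section SlopeVectors

variable {OL : Type*} [CommRing OL] [IsDomain OL] [IsDiscreteValuationRing OL]
  {ϖ : OL} [hϖ : Fact (Irreducible ϖ)]
  {L N : Type*} [Field L] [Algebra OL L] [IsFractionRing OL L] [AddCommGroup N] [Module L N]
  [Module OL N] [IsScalarTower OL L N] {τ : L →+* L} {Φ : N →ₛₗ[τ] N} {f : SemilinearGroup ϖ L N}

open SemilinearGroup IsLocalRing

theorem isIsoclinic_iff (hΦ : ∀ x, Φ x = f • x) {W : Submodule L N} {s : ℚ} :
    IsIsoclinic OL (algebraMap OL L ϖ) Φ W s ↔ IsIsoclinicSubspace (OL := OL) f W s := by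
  have hpow : ∀ (t : ℕ) (x : N), Φ^[t] x = f ^ t • x := by
    intro t
    induction t with
    | zero => simp
    | succ t ih => intro x; rw [Function.iterate_succ_apply', ih, hΦ, pow_succ', mul_smul]
  have himage : ∀ (t : ℕ) (M : Submodule OL N),
      Φ^[t] '' (M : Set N) = ((f ^ t • M : Submodule OL N) : Set N) := fun t M => by
    rw [coe_smul]
    exact Set.image_congr fun x _ => hpow t x
  simp only [IsIsoclinic, IsIsoclinicSubspace, himage, hΦ, zpow_uniformizerMul_smul_eq,
    SetLike.coe_set_eq]

theorem iSup_coe_finset_eq {α ι : Type*} [CompleteLattice α] {W : ι → α} {S : Finset ι}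
    (hS : ∀ s, s ∉ S → W s = ⊥) : ⨆ s : S, W s = ⨆ s, W s := by
  apply le_antisymm
  · exact iSup_le fun s => le_iSup W s
  · refine iSup_le fun s => ?_
    by_cases hs : s ∈ S
    · exact le_iSup (fun s : S => W s) ⟨s, hs⟩
    · rw [hS s hs]
      exact bot_le

variable [FiniteDimensional L N]

/-- The slope vector lists the slopes of the slope decomposition with their multiplicities, sorted
in decreasing order. -/
theorem exists_isSlopeVector [IsAdicComplete (maximalIdeal OL) OL] (hΦ : ∀ x, Φ x = f • x) :
    ∃ ν : Fin (Module.finrank L N) → ℚ, IsSlopeVector OL (algebraMap OL L ϖ) Φ ν := by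
  classical
  obtain ⟨W, hind, htop, hiso⟩ := exists_slope_decomposition (OL := OL) f ⊤ (by simp)
  let S : Finset ℚ := (WellFoundedGT.finite_ne_bot_of_iSupIndep hind).toFinset
  have hS : ∀ s, s ∉ S → W s = ⊥ := by
    intro s hs
    simpa [S] using hs
  obtain ⟨K, hK, hspan, -⟩ := exists_common_exponent fun s : S => hiso s
  have hsum := sum_finrank_eq (hind.comp Subtype.val_injective)
    ((iSup_coe_finset_eq hS).trans htop) hK hspan
  have hcard : Fintype.card (Σ s : S, Fin (Module.finrank L (W s))) = Module.finrank L N := by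
    rw [Fintype.card_sigma, ← hsum]
    exact Finset.sum_congr rfl fun s _ => Fintype.card_fin _
  let e := (Fintype.equivFinOfCardEq hcard).symm
  let ν₀ : Fin (Module.finrank L N) → ℚ := fun i => (e i).1
  let E := (Fin.revPerm.trans (Tuple.sort ν₀)).trans e
  refine ⟨fun i => (E i).1, fun i j hij => Tuple.monotone_sort ν₀ (Fin.rev_le_rev.mpr hij),
    W, hind, htop, fun s => ⟨(isIsoclinic_iff hΦ).mpr (hiso s), ?_⟩⟩
  rw [Finset.card_filter, E.sum_comp fun x => if (x.1 : ℚ) = s then 1 else 0, Fintype.sum_sigma]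
  have hfiber : ∀ t : S, ∑ j : Fin (Module.finrank L (W t)),
      (if ((⟨t, j⟩ : Σ t : S, Fin (Module.finrank L (W t))).1 : ℚ) = s then 1 else 0) =
        if (t : ℚ) = s then Module.finrank L (W t) else 0 := fun t => by
    split_ifs <;> simp
  rw [Finset.sum_congr rfl fun t _ => hfiber t,
    Finset.sum_coe_sort S fun t => if t = s then Module.finrank L (W t) else 0,
    Finset.sum_ite_eq']
  split_ifs with hs
  · rfl
  · rw [hS s hs, finrank_bot]

/-- The nonzero isoclinic parts, indexed by the finite set of slopes. -/
theorem exists_family_of_isSlopeVector (hΦ : ∀ x, Φ x = f • x) {m : ℕ} {ν : Fin m → ℚ}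
    (h : IsSlopeVector OL (algebraMap OL L ϖ) Φ ν) :
    ∃ W : Finset.univ.image ν → Submodule L N, iSupIndep W ∧ ⨆ s, W s = ⊤ ∧
      ∀ s, IsIsoclinicSubspace (OL := OL) f (W s) s ∧ W s ≠ ⊥ ∧
        Module.finrank L (W s) = (Finset.univ.filter fun i => ν i = s).card := by
  obtain ⟨-, W, hind, htop, hW⟩ := h
  have hcard : ∀ s, s ∈ Finset.univ.image ν ↔ (Finset.univ.filter fun i => ν i = s).card ≠ 0 := by
    intro s
    simp [Finset.card_eq_zero, Finset.filter_eq_empty_iff]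
  refine ⟨fun s => W s, hind.comp Subtype.val_injective,
    (iSup_coe_finset_eq fun s hs => ?_).trans htop,
    fun s => ⟨(isIsoclinic_iff hΦ).mp (hW s).1, fun h0 => ?_, (hW s).2⟩⟩
  · rw [← Submodule.finrank_eq_zero (R := L), (hW s).2]
    exact not_not.mp (mt (hcard s).mpr hs)
  · exact (hcard s).mp s.2 (by rw [← (hW s).2, Submodule.finrank_eq_zero.mpr h0])

/-- The isocrystal is minuscule of weight `r` if and only if there is a lattice whose position
relative to its image under Frobenius is minuscule of weight `r`. -/
theorem isMinuscule_iff_exists_isStableLattice [IsAdicComplete (maximalIdeal OL) OL]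
    (hΦ : ∀ x, Φ x = f • x) {r : ℕ} :
    IsMinuscule OL (algebraMap OL L ϖ) Φ r ↔
      ∃ M : Submodule OL N, IsStableLattice f M ∧ latticeIndex M (f • M) = r := by
  have hsum : ∀ {m : ℕ} {ν : Fin m → ℚ}, IsSlopeVector OL (algebraMap OL L ϖ) Φ ν →
      ∀ M : Submodule OL N, M.IsLattice L → (latticeIndex M (f • M) : ℚ) = ∑ i, ν i := by
    intro m ν hν M hM
    obtain ⟨W, hind, htop, hW⟩ := exists_family_of_isSlopeVector hΦ hν
    rw [latticeIndex_eq_sum_slopes hind htop (fun s => (hW s).1) hM,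
      Finset.sum_congr rfl fun s _ => by rw [(hW s).2.2],
      Finset.sum_coe_sort (Finset.univ.image ν)
        fun s => s * ((Finset.univ.filter fun i => ν i = s).card : ℚ)]
    have := Finset.sum_comp (s := Finset.univ) (fun s : ℚ => s) ν
    rw [this]
    exact Finset.sum_congr rfl fun s _ => by rw [nsmul_eq_mul, mul_comm]
  constructor
  · rintro ⟨ν, hν, hbound, hr⟩
    obtain ⟨W, hind, htop, hW⟩ := exists_family_of_isSlopeVector hΦ hν
    obtain ⟨M, hM⟩ := exists_isStableLattice htop (fun s => (hW s).1) fun s => by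
      obtain ⟨i, -, hi⟩ := Finset.mem_image.mp s.2
      rw [← hi]
      exact hbound i
    refine ⟨M, hM, ?_⟩
    have := hsum hν M hM.isLattice
    rw [hr] at this
    exact_mod_cast this
  · rintro ⟨M, hM, hr⟩
    obtain ⟨ν, hν⟩ := exists_isSlopeVector (f := f) hΦ
    refine ⟨ν, hν, fun i => ?_, ?_⟩
    · obtain ⟨W, -, -, hW⟩ := exists_family_of_isSlopeVector hΦ hν
      let s : Finset.univ.image ν := ⟨ν i, Finset.mem_image_of_mem ν (Finset.mem_univ i)⟩
      exact slope_mem_Icc hM (hW s).2.1 (hW s).1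
    · rw [← hsum hν M hM.isLattice, hr]
      simp

end SlopeVectors

/-! ### The fields `F` and `L` -/

section Fields

open IsLocalRing

/-- `OF` is finite over `ℤ_p`, so its residue field is finite over that of `ℤ_p`. -/
theorem finite_residueField (p : ℕ) [Fact p.Prime]
    (F OF : Type*) [Field F] [Algebra ℚ_[p] F] [FiniteDimensional ℚ_[p] F]
    [Algebra ℤ_[p] F] [IsScalarTower ℤ_[p] ℚ_[p] F]
    [CommRing OF] [IsLocalRing OF] [Algebra OF F] [IsIntegralClosure OF ℤ_[p] F] :
    Finite (IsLocalRing.ResidueField OF) := by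
  let C := integralClosure ℤ_[p] F
  have hC : ∀ x : C, ∃ y : OF, algebraMap OF F y = x := fun x =>
    IsIntegralClosure.isIntegral_iff.mp x.2
  have hinj := IsIntegralClosure.algebraMap_injective OF ℤ_[p] F
  choose e he using hC
  let φ : C →+* OF :=
    { toFun := e
      map_one' := hinj (by rw [he]; simp)
      map_mul' := fun x y => hinj (by rw [map_mul, he, he, he]; rfl)
      map_zero' := hinj (by rw [he]; simp)
      map_add' := fun x y => hinj (by rw [map_add, he, he, he]; rfl) }
  have hφ : Function.Surjective φ := fun y =>
    ⟨⟨algebraMap OF F y, IsIntegralClosure.isIntegral_iff.mpr ⟨y, rfl⟩⟩, hinj (he _)⟩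
  let _ : Algebra ℤ_[p] OF := (φ.comp (algebraMap ℤ_[p] C)).toAlgebra
  have : Module.Finite ℤ_[p] C := IsIntegralClosure.finite ℤ_[p] ℚ_[p] F C
  let φ' : C →ₐ[ℤ_[p]] OF := { φ with commutes' := fun _ => rfl }
  have : Module.Finite ℤ_[p] OF := Module.Finite.of_surjective φ'.toLinearMap hφ
  have : Finite (IsLocalRing.ResidueField ℤ_[p]) :=
    Finite.of_equiv _ (PadicInt.residueField (p := p)).symm.toEquiv
  have : FaithfulSMul ℤ_[p] OF := by
    refine (faithfulSMul_iff_algebraMap_injective _ _).mpr fun x y hxy => ?_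
    have h1 : ∀ x, algebraMap OF F (algebraMap ℤ_[p] OF x) = algebraMap ℤ_[p] F x := fun x => he _
    have h2 := congrArg (algebraMap OF F) hxy
    rw [h1, h1, IsScalarTower.algebraMap_apply ℤ_[p] ℚ_[p] F,
      IsScalarTower.algebraMap_apply ℤ_[p] ℚ_[p] F] at h2
    exact IsFractionRing.injective ℤ_[p] ℚ_[p] ((algebraMap ℚ_[p] F).injective h2)
  exact IsLocalRing.ResidueField.finite_of_finite (R := ℤ_[p]) ‹_›

theorem IsCompletedMaxUnramified.irreducible_algebraMap {OF OL : Type*} [CommRing OF] [IsDomain OF]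
    [IsDiscreteValuationRing OF] [CommRing OL] [IsDomain OL] [IsDiscreteValuationRing OL]
    [Algebra OF OL] (hL : IsCompletedMaxUnramified OF OL) {π : OF} (hπ : Irreducible π) :
    Irreducible (algebraMap OF OL π) := by
  rw [IsDiscreteValuationRing.irreducible_iff_uniformizer, ← hL.unramified, hπ.maximalIdeal_eq,
    Ideal.map_span, Set.image_singleton]

/-- The Frobenius preserves `OL`, also in the backward direction: the inverse of a non-integral
element lies in the maximal ideal, which the Frobenius preserves. -/
theorem IsRelativeFrobenius.mem_one_iff {OF OL F L : Type*} [CommRing OF] [IsDomain OF]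
    [IsDiscreteValuationRing OF] [CommRing OL] [IsDomain OL] [IsDiscreteValuationRing OL]
    [Field F] [Field L] [Algebra F L] [Algebra OL L] [IsFractionRing OL L] {σ : L ≃ₐ[F] L}
    (hσ : IsRelativeFrobenius OF OL σ) (hq : Nat.card (ResidueField OF) ≠ 0) (x : L) :
    σ x ∈ (1 : Submodule OL L) ↔ x ∈ (1 : Submodule OL L) := by
  constructor
  · intro h
    rcases ValuationRing.isInteger_or_isInteger OL x with ⟨y, hy⟩ | ⟨y, hy⟩
    · exact Submodule.mem_one.mpr ⟨y, hy⟩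
    obtain ⟨o, ho⟩ := Submodule.mem_one.mp h
    rcases eq_or_ne x 0 with rfl | hx
    · exact zero_mem _
    have hyu : IsUnit y := by
      by_contra hyu
      obtain ⟨b, hb, hby⟩ := hσ y
      rw [(residue_eq_zero_iff y).mpr ((mem_maximalIdeal y).mpr hyu), zero_pow hq,
        residue_eq_zero_iff, mem_maximalIdeal] at hby
      refine hby (IsUnit.of_mul_eq_one o (IsFractionRing.injective OL L ?_))
      rw [map_mul, ← hb, ho, hy, ← map_mul, inv_mul_cancel₀ hx, map_one, map_one]
    obtain ⟨u, rfl⟩ := hyu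
    refine Submodule.mem_one.mpr ⟨(u⁻¹ : OLˣ), ?_⟩
    rw [← inv_inv x, ← hy]
    refine eq_inv_of_mul_eq_one_left ?_
    rw [← map_mul, Units.inv_mul, map_one]
  · intro h
    obtain ⟨a, rfl⟩ := Submodule.mem_one.mp h
    obtain ⟨b, hb, -⟩ := hσ a
    exact Submodule.mem_one.mpr ⟨b, hb.symm⟩

end Fields

theorem proposition2p1 {p : ℕ} [Fact p.Prime]
    -- `F` is a finite extension of `ℚ_p` with ring of integers `OF` and uniformizer `π`
    {F OF : Type*} [Field F] [Algebra ℚ_[p] F] [FiniteDimensional ℚ_[p] F]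
    [Algebra ℤ_[p] F] [IsScalarTower ℤ_[p] ℚ_[p] F]
    [CommRing OF] [IsDomain OF] [IsDiscreteValuationRing OF] [Algebra OF F]
    [IsIntegralClosure OF ℤ_[p] F] {π : OF} (hπ : Irreducible π)
    -- `L` is the completed maximal unramified extension of `F`, with ring of integers `OL`
    {L OL : Type*} [Field L] [Algebra F L]
    [CommRing OL] [IsDomain OL] [IsDiscreteValuationRing OL] [Algebra OL L] [IsFractionRing OL L]
    [Algebra OF OL] [Algebra OF L] [IsScalarTower OF F L] [IsScalarTower OF OL L]
    (hL : IsCompletedMaxUnramified OF OL)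
    {σ : L ≃ₐ[F] L} (hσ : IsRelativeFrobenius OF OL σ)
    -- `(N, B, Φ)` is a symplectic isocrystal of dimension `2 n`
    {N : Type*} [AddCommGroup N] [Module L N] [Module OL N] [IsScalarTower OL L N]
    {n : ℕ} (hn : 0 < n) {Φ : N →ₛₗ[(σ : L →+* L)] N} {B : LinearMap.BilinForm L N}
    (hN : IsSymplecticIsocrystal n Φ B) {r : ℕ} (hr : r ≤ 2 * n) :
    (∀ I : Set (ZMod (2 * n)), I.Nonempty → IsSymmetricType I →
      ((selfdualMinusculeChains OL (algebraMap OF L π) Φ B r I).Nonempty ↔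
        IsMinuscule OL (algebraMap OF L π) Φ r)) ∧
    (∀ I J : Set (ZMod (2 * n)), I.Nonempty → IsSymmetricType I →
      J.Nonempty → IsSymmetricType J → ∀ h : J ⊆ I,
      Function.Surjective (forgetChain OL (algebraMap OF L π) Φ B r h)) := by
  have := hN.finiteDimensional
  have : IsAdicComplete (IsLocalRing.maximalIdeal OL) OL := hL.complete
  have : IsAlgClosed (IsLocalRing.ResidueField OL) := hL.residue_isAlgClosed
  have : Fact (Irreducible (algebraMap OF OL π)) := ⟨hL.irreducible_algebraMap hπ⟩
  have : Finite (IsLocalRing.ResidueField OF) := finite_residueField p F OF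
  have hq : 2 ≤ Nat.card (IsLocalRing.ResidueField OF) :=
    Finite.one_lt_card_iff_nontrivial.mpr inferInstance
  have hσO := hσ.mem_one_iff (by omega)
  have hϖL : algebraMap OF L π = algebraMap OL L (algebraMap OF OL π) :=
    IsScalarTower.algebraMap_apply OF OL L π
  let f : SemilinearGroup (algebraMap OF OL π) L N :=
    ⟨Equiv.ofBijective Φ hN.bijective, map_add Φ, σ.toRingEquiv, by
      rw [← hϖL, IsScalarTower.algebraMap_apply OF F L]
      exact σ.commutes _, hσO, fun c x => Φ.map_smulₛₗ c x⟩
  have hΦ : ∀ x, Φ x = f • x := fun _ => rfl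
  have hf : IsFrobeniusSemilinear (Nat.card (IsLocalRing.ResidueField OF)) f := by
    intro a
    obtain ⟨b, hb, hab⟩ := hσ a
    refine ⟨b, hab, fun x => ?_⟩
    rw [← hΦ, ← hΦ, ← algebraMap_smul L a, ← algebraMap_smul L b, ← hb]
    exact Φ.map_smulₛₗ _ x
  obtain ⟨c, hc, hBc⟩ := hN.similitude
  obtain ⟨w, hw⟩ := exists_dualSubmodule_smul f hσO hc hBc
  have hpos : 0 < 2 * n := by omega
  rw [hϖL]
  refine ⟨fun I hI _ => ⟨fun ⟨M, hM⟩ => ?_, fun h => ?_⟩, fun I J _ _ hJ hJs h =>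
    forgetChain_surjective hq hf hN.nondegenerate hN.isAlt hN.finrank_eq hpos hw hΦ r hJ hJs h⟩
  · obtain ⟨i, hi⟩ := hI
    obtain ⟨i, rfl⟩ := ZMod.intCast_surjective i
    exact (isMinuscule_iff_exists_isStableLattice hΦ).mpr
      ⟨M ⟨i, hi⟩, isStableLattice_of_hasMinusculePosition hΦ (hM.1.isLattice _) (hM.2.2 _)⟩
  · obtain ⟨M, hM, hMr⟩ := (isMinuscule_iff_exists_isStableLattice hΦ).mp h
    exact selfdualMinusculeChains_nonempty hq hf hN.nondegenerate hN.isAlt hN.finrank_eq hpos hw hΦ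
      I hM hMr
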